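/- **Setting.** Identify $\mathbb S^3$ with the unit quaternions. A flat CMC torus is a flat conformal immersion $f:\mathbb C\to\mathbb S^3$ of constant mean curvature together with a lattice $\Gamma\subset\mathbb C$ of rank two of periods of $f$; it is regarded as an immersion of $\mathbb C/\Gamma$. Up to an orientation preserving isometry of $\mathbb S^3$ and a change of coordinate $z\mapsto az$, $f=F_{\lambda_1}F_{\lambda_2}^{-1}$ with distinct Sym points $\lambda_1,\lambda_2\in\mathbb S^1$ and the extended frame $$F_\lambda(z)=\exp\bigl(\pi(-\operatorname{Im}(w)\,\mathbf j+\operatorname{Re}(w)\,\mathbf k)\bigr),\qquad w=z\lambda^{-1}+\bar z ,$$ whose eigenvalues in $\mathrm{SU}(2)$ are $\exp(\pm\pi i(z\lambda^{-1/2}+\bar z\lambda^{1/2}))$. A double point on $\mathbb S^1$ is a $\lambda_0\in\mathbb S^1\setminus\{\lambda_1,\lambda_2\}$ such that the monodromy $F_{\lambda_0}(\gamma)$ is $\pm1$ for every $\gamma\in\Gamma$ (in the coordinate in which $f$ has the above form). The spectral data of the torus with this double point is the triple $(\lambda_0,\lambda_1,\lambda_2)$. Spectral data are taken up to (A) rotation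 $(\lambda_0,\lambda_1,\lambda_2)\mapsto\delta(\lambda_0,\lambda_1,\lambda_2)$, $\delta\in\mathbb S^1$; (B) inversion of all three entries; (C) swapping $\lambda_1$ and $\lambda_2$. For square roots $m=(\lambda_0^{1/2},\lambda_1^{1/2},\lambda_2^{1/2})$ put $s=i\,m\times\bar m\in\mathbb R^3$. The equivariant action of the torus (with its double point) is the one-parameter group of isometries of $\mathbb S^3$ induced by the translations of $\mathbb C$ along the real line on which $F_{\lambda_0}$ is constant. Its axes are the great circles that it preserves as sets; the torus is called rotational if one of its axes is fixed pointwise. If $A$ is an axis, $S$ a geodesic 2-sphere containing $A$ and $h$ one of the two open hemispheres of $S\setminus A$, the corresponding profile curve set is the part of the torus $\mathbb C/\Gamma$ that $f$ maps into $h$; each of its components is a closed curve, and its total turning number is the sum of the unsigned turning numbers of the images of these curves under stereographic projection of $h$ to the plane. **Theorem.** 1. There is a bijection from the set of spectral data of flat CMC tori with a double point on $\mathbb S^1$, up to (A)–(C), onto the set of integer triples $(\ell_0,\ell_1,\ell_2)$ with $\gcd(\ell_0,\ell_1,\ell_2)=1$ and $0\le\ell_1<\ell_0<\ell_2$, for which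 the triple of the class of $(\lambda_0,\lambda_1,\lambda_2)$ satisfies $$(\ell_0:\ell_1:\ell_2)=\bigl(|s_0|:\min\{|s_1+s_2|,|s_1-s_2|\}:\max\{|s_1+s_2|,|s_1-s_2|\}\bigr).$$ 2. Consider an $(\ell_0,\ell_1,\ell_2)$ flat CMC torus, i.e. a flat CMC torus whose spectral data has this triple and whose lattice $\Gamma$ consists of all periods $\gamma$ of $f$ with $F_{\lambda_0}(\gamma)=\pm1$. It covers an embedded flat CMC torus with rectangular lattice (given by the same $f$) exactly $\ell_0$ times. It has exactly two axes, and these can be labelled $A_1,A_2$ so that for $k=1,2$ every profile curve set with respect to $A_k$ has total turning number $\ell_0$ and is a union of $\gcd(\ell_0,\ell_k)$ coinciding circles, each of which is wrapped $\ell_0/\gcd(\ell_0,\ell_k)$ times. 3. For every flat CMC torus whose spectral data has the triple $(\ell_0,\ell_1,\ell_2)$: $\ell_1=0$ if and only if the torus is rotational. -/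

import Mathlib

open scoped Quaternion Matrix ContDiff

noncomputable section

/-! ### Flat CMC tori in the 3-sphere

The 3-sphere is the set of unit quaternions, `𝕊³ ⊂ ℍ = ℝ⁴`. -/

/-- Partial derivative with respect to `x` of a function of `z = x + i y`. -/
def partialX {E : Type*} [NormedAddCommGroup E] [NormedSpace ℝ E] (g : ℂ → E) (z : ℂ) : E :=
  fderiv ℝ g z 1

/-- Partial derivative with respect to `y` of a function of `z = x + i y`. -/
def partialY {E : Type*} [NormedAddCommGroup E] [NormedSpace ℝ E] (g : ℂ → E) (z : ℂ) : E :=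
  fderiv ℝ g z Complex.I

/-- The flat Laplacian `∂²/∂x² + ∂²/∂y²`. -/
def planeLaplacian {E : Type*} [NormedAddCommGroup E] [NormedSpace ℝ E] (g : ℂ → E) (z : ℂ) : E :=
  partialX (partialX g) z + partialY (partialY g) z

/-- `f : ℂ → 𝕊³` is a smooth conformal immersion with induced metric `v² |dz|²`, the metric is flat
(its Gauss curvature `-v⁻² Δ log v` vanishes), and the mean curvature
`½ v⁻² ⟨Δ f, N⟩` with respect to a continuous unit normal field `N` in `𝕊³` is constant. -/
structure IsFlatCMCImmersion (f : ℂ → ℍ[ℝ]) : Prop where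
  smooth : ContDiff ℝ ∞ f
  norm_one : ∀ z, ‖f z‖ = 1
  flat_cmc : ∃ (v : ℂ → ℝ) (N : ℂ → ℍ[ℝ]) (H : ℝ),
    (∀ z, 0 < v z ∧ ‖partialX f z‖ = v z ∧ ‖partialY f z‖ = v z ∧
      inner ℝ (partialX f z) (partialY f z) = 0) ∧
    (∀ z, planeLaplacian (fun w => Real.log (v w)) z = 0) ∧
    Continuous N ∧
    (∀ z, ‖N z‖ = 1 ∧ inner ℝ (N z) (f z) = 0 ∧
      inner ℝ (N z) (partialX f z) = 0 ∧ inner ℝ (N z) (partialY f z) = 0) ∧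
    (∀ z, inner ℝ (planeLaplacian f z) (N z) = 2 * v z ^ 2 * H)

/-- A flat CMC torus in `𝕊³`: a flat CMC immersion of the plane that is periodic with respect to a
lattice of rank two, regarded as an immersion of the torus `ℂ / lattice`. -/
structure FlatCMCTorus where
  immersion : ℂ → ℍ[ℝ]
  isFlatCMC : IsFlatCMCImmersion immersion
  lattice : AddSubgroup ℂ
  isLattice : ∃ ω₁ ω₂ : ℂ, LinearIndependent ℝ ![ω₁, ω₂] ∧
    lattice = AddSubgroup.closure {ω₁, ω₂}
  periodic : ∀ γ ∈ lattice, ∀ z, immersion (z + γ) = immersion z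

namespace FlatCMCTorus

/-- The map `ℂ / lattice → 𝕊³` induced by the immersion. -/
def map (T : FlatCMCTorus) : ℂ ⧸ T.lattice → ℍ[ℝ] :=
  Quotient.lift T.immersion (by
    intro x y hxy
    have h : -x + y ∈ T.lattice := QuotientAddGroup.leftRel_apply.mp hxy
    have h2 := T.periodic _ h x
    rw [show x + (-x + y) = y by ring] at h2
    exact h2.symm)

/-- The torus is embedded. -/
def IsEmbedded (T : FlatCMCTorus) : Prop := Topology.IsEmbedding T.map

/-- The period lattice is rectangular. -/
def IsRectangular (T : FlatCMCTorus) : Prop :=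
  ∃ ω₁ ω₂ : ℂ, ω₁ ≠ 0 ∧ ω₂ ≠ 0 ∧ inner ℝ ω₁ ω₂ = 0 ∧ T.lattice = AddSubgroup.closure {ω₁, ω₂}

/-- `T` covers `T'` exactly `n` times: both have the same immersion of the plane, and the projection
`ℂ / T.lattice → ℂ / T'.lattice` is a covering map all of whose fibres have `n` points. -/
def Covers (T T' : FlatCMCTorus) (n : ℕ) : Prop :=
  T'.immersion = T.immersion ∧ ∃ h : T.lattice ≤ T'.lattice,
    IsCoveringMap (QuotientAddGroup.map T.lattice T'.lattice (AddMonoidHom.id ℂ) h) ∧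
    ∀ y : ℂ ⧸ T'.lattice,
      Nat.card {x // QuotientAddGroup.map T.lattice T'.lattice (AddMonoidHom.id ℂ) h x = y} = n

end FlatCMCTorus

/-! ### Extended frame and spectral data -/

/-- The extended frame of a flat CMC surface,
`F_λ(z) = exp (π i ((z λ⁻¹ + z̄) ε₁ - (z + z̄ λ) ε₂))`, where `ε₁ = ½ (e₁ - i e₂)`,
`ε₂ = ½ (e₁ + i e₂)` in `sl₂(ℂ)` and `e₀, e₁, e₂` are the imaginary quaternion units `i, j, k`.
With `w = z λ⁻¹ + z̄` one has `z + z̄ λ = w̄` for unimodular `λ`, and the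
exponent is `π (-(Im w) e₁ + (Re w) e₂)`. The eigenvalues of `F_λ(z)` in `SU(2)` are
`exp (± π i (z λ^(-1/2) + z̄ λ^(1/2)))`. -/
def flatFrame (lam : Circle) (z : ℂ) : ℍ[ℝ] :=
  let w : ℂ := z * (lam : ℂ)⁻¹ + (starRingEnd ℂ) z
  NormedSpace.exp (⟨0, 0, -(Real.pi * w.im), Real.pi * w.re⟩ : ℍ[ℝ])

/-- `SpectralFrame T lam` says (with the data) that `lam 0` is a double point on the unit circle and
`lam 1`, `lam 2` are the Sym points of the torus `T`: the three values are distinct; up to the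
orientation preserving isometry `P ↦ U P V` of `𝕊³` and the conformal change of coordinate
`z ↦ a z`, the immersion is `F_{λ₁} F_{λ₂}⁻¹`; and the monodromy `F_{λ₀}(a γ)` along every period
`γ` of the torus is `± 1` (equivalently, its eigenvalues are `± 1`). -/
structure SpectralFrame (T : FlatCMCTorus) (lam : Fin 3 → Circle) where
  distinct : Function.Injective lam
  a : ℂ
  a_ne_zero : a ≠ 0
  U : ℍ[ℝ]
  V : ℍ[ℝ]
  norm_U : ‖U‖ = 1
  norm_V : ‖V‖ = 1
  sym : ∀ z, T.immersion z =
    U * (flatFrame (lam 1) (a * z) * (flatFrame (lam 2) (a * z))⁻¹) * V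
  double : ∀ γ ∈ T.lattice,
    flatFrame (lam 0) (a * γ) = 1 ∨ flatFrame (lam 0) (a * γ) = -1

/-- Spectral data of flat CMC tori with a double point on the unit circle: triples
(double point, Sym point, Sym point). -/
def SpectralData : Type :=
  {lam : Fin 3 → Circle // ∃ T : FlatCMCTorus, Nonempty (SpectralFrame T lam)}

/-- The transformations (A) rotation, (B) inversion, (C) swapping of the Sym points. -/
def SpectralData.Step (d d' : SpectralData) : Prop :=
  (∃ δ : Circle, ∀ i, d'.1 i = δ * d.1 i) ∨ (∀ i, d'.1 i = (d.1 i)⁻¹) ∨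
    (d'.1 0 = d.1 0 ∧ d'.1 1 = d.1 2 ∧ d'.1 2 = d.1 1)

/-- Spectral data up to the equivalence relation generated by (A), (B), (C). -/
def SpectralClass : Type := Quot SpectralData.Step

/-- Coprime integer triples `0 ≤ ℓ₁ < ℓ₀ < ℓ₂`. -/
structure TurnTriple where
  l0 : ℕ
  l1 : ℕ
  l2 : ℕ
  coprime : Nat.gcd (Nat.gcd l0 l1) l2 = 1
  lt1 : l1 < l0
  lt2 : l0 < l2

/-- The (real) vector `s = i m × m̄`. -/
def turnVector (m : Fin 3 → ℂ) (i : Fin 3) : ℝ :=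
  (Complex.I * (m ⨯₃ (star m)) i).re

/-- The triple of integers is the one belonging to the spectral data `lam`: for square roots `m` of
`lam` and `s = i m × m̄`, `(ℓ₀ : ℓ₁ : ℓ₂) = (|s₀| : min |s₁ ± s₂| : max |s₁ ± s₂|)`. -/
def HasTurnTriple (lam : Fin 3 → Circle) (l : TurnTriple) : Prop :=
  ∃ m : Fin 3 → ℂ, (∀ i, m i ^ 2 = (lam i : ℂ)) ∧ ∃ c : ℝ, 0 < c ∧
    |turnVector m 0| = c * l.l0 ∧
    min |turnVector m 1 + turnVector m 2| |turnVector m 1 - turnVector m 2| = c * l.l1 ∧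
    max |turnVector m 1 + turnVector m 2| |turnVector m 1 - turnVector m 2| = c * l.l2

/-! ### Equivariant action, axes -/

/-- The great circle through two orthonormal quaternions. -/
def greatCircle (u v : ℍ[ℝ]) : Set ℍ[ℝ] :=
  {P | ∃ s t : ℝ, s ^ 2 + t ^ 2 = 1 ∧ P = s • u + t • v}

/-- Geodesics of `𝕊³`. -/
def IsGreatCircle (A : Set ℍ[ℝ]) : Prop :=
  ∃ u v : ℍ[ℝ], Orthonormal ℝ ![u, v] ∧ A = greatCircle u v

namespace SpectralFrame

variable {T : FlatCMCTorus} {lam : Fin 3 → Circle}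

/-- The ambient isometry of `𝕊³` induced by the translation `z ↦ z + a⁻¹ ζ` of the surface. -/
def ambient (S : SpectralFrame T lam) (ζ : ℂ) (P : ℍ[ℝ]) : ℍ[ℝ] :=
  (S.U * flatFrame (lam 1) ζ * S.U⁻¹) * P * (S.V⁻¹ * (flatFrame (lam 2) ζ)⁻¹ * S.V)

/-- The translations belonging to the equivariant action: the real line of all `ζ` along which the
extended frame is constant at the double point. -/
def equivariantLine (_S : SpectralFrame T lam) : Set ℂ :=
  {ζ | ∀ t : ℝ, flatFrame (lam 0) (t * ζ) = 1}

/-- The axes: geodesics that the equivariant action preserves as sets. -/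
def IsAxis (S : SpectralFrame T lam) (A : Set ℍ[ℝ]) : Prop :=
  IsGreatCircle A ∧ ∀ ζ ∈ S.equivariantLine, S.ambient ζ '' A = A

/-- The torus (with its equivariant action) is rotational: an axis is fixed pointwise. -/
def IsRotational (S : SpectralFrame T lam) : Prop :=
  ∃ A, S.IsAxis A ∧ ∀ ζ ∈ S.equivariantLine, ∀ P ∈ A, S.ambient ζ P = P

/-- The lattice of `T` consists of all periods of the immersion whose monodromy at the double point
is `± 1`. -/
def IsPrimitive (S : SpectralFrame T lam) : Prop :=
  ∀ γ : ℂ, γ ∈ T.lattice ↔ (∀ z, T.immersion (z + γ) = T.immersion z) ∧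
    (flatFrame (lam 0) (S.a * γ) = 1 ∨ flatFrame (lam 0) (S.a * γ) = -1)

end SpectralFrame

/-! ### Profile curve sets -/

/-- For orthonormal `u, v, n`: one of the two hemispheres (the one containing `n`) into which the
great circle through `u, v` divides the geodesic 2-sphere spanned by `u, v, n`. -/
def hemisphere (u v n : ℍ[ℝ]) : Set ℍ[ℝ] :=
  {P | ‖P‖ = 1 ∧ P ∈ Submodule.span ℝ {u, v, n} ∧ 0 < inner ℝ n P}

/-- Stereographic projection of the 2-sphere spanned by `u, v, n` from `-n` to the plane. -/
def stereo (u v n P : ℍ[ℝ]) : ℂ :=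
  (inner ℝ u P / (1 + inner ℝ n P) : ℝ) + (inner ℝ v P / (1 + inner ℝ n P) : ℝ) * Complex.I

/-- The closed regular plane curve `c` of period one has (unsigned) turning number `N`: the unit
tangent `exp (i θ)` has degree `± N`. -/
def HasTurningNumber (c : ℝ → ℂ) (N : ℕ) : Prop :=
  Function.Periodic c 1 ∧
  ∃ θ : ℝ → ℝ, Continuous θ ∧
    (∀ t, deriv c t ≠ 0 ∧ deriv c t = ‖deriv c t‖ * Complex.exp (Complex.I * θ t)) ∧
    |θ 1 - θ 0| = 2 * Real.pi * N

namespace FlatCMCTorus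

/-- The profile curve set in the hemisphere given by `u, v, n`, as a subset of the torus. -/
def profileSet (T : FlatCMCTorus) (u v n : ℍ[ℝ]) : Set (ℂ ⧸ T.lattice) :=
  T.map ⁻¹' hemisphere u v n

/-- The connected components of the profile curve set. -/
def profileComponents (T : FlatCMCTorus) (u v n : ℍ[ℝ]) : Set (Set (ℂ ⧸ T.lattice)) :=
  {C | ∃ x ∈ T.profileSet u v n, C = connectedComponentIn (T.profileSet u v n) x}

/-- `σ` is (a lift to `ℂ` of) a regular parametrization, of period one and injective on each period,
of the closed curve `C` in the torus. -/
def IsClosedParam (T : FlatCMCTorus) (C : Set (ℂ ⧸ T.lattice)) (σ : ℝ → ℂ) : Prop :=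
  ContDiff ℝ ∞ σ ∧ (∀ t, deriv σ t ≠ 0) ∧
  (∀ s t, (QuotientAddGroup.mk (σ s) : ℂ ⧸ T.lattice) = QuotientAddGroup.mk (σ t) ↔
    ∃ k : ℤ, s - t = k) ∧
  Set.range (fun t => (QuotientAddGroup.mk (σ t) : ℂ ⧸ T.lattice)) = C

/-- The profile curve set in the hemisphere given by `u, v, n` consists of `p` closed curves, all
mapped to one and the same round circle, and each is wrapped `w` times around it. -/
def ProfileWrapsCircle (T : FlatCMCTorus) (u v n : ℍ[ℝ]) (p w : ℕ) : Prop :=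
  (T.profileComponents u v n).Finite ∧ (T.profileComponents u v n).ncard = p ∧
  ∃ (q e₁ e₂ : ℍ[ℝ]) (r : ℝ), 0 < r ∧ Orthonormal ℝ ![e₁, e₂] ∧
    ∀ C ∈ T.profileComponents u v n, ∃ σ : ℝ → ℂ, T.IsClosedParam C σ ∧
      ∀ t : ℝ, T.immersion (σ t) = q + (r * Real.cos (2 * Real.pi * w * t)) • e₁ +
        (r * Real.sin (2 * Real.pi * w * t)) • e₂

/-- The total turning number of the profile curve set in the hemisphere given by `u, v, n` is `N`:
its components are finitely many closed immersed curves, whose turning numbers (after stereographic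
projection of the hemisphere to the plane) add up to `N`. -/
def ProfileTotalTurning (T : FlatCMCTorus) (u v n : ℍ[ℝ]) (N : ℕ) : Prop :=
  (T.profileComponents u v n).Finite ∧
  ∃ τ : Set (ℂ ⧸ T.lattice) → ℕ,
    (∀ C ∈ T.profileComponents u v n, ∃ σ : ℝ → ℂ, T.IsClosedParam C σ ∧
      HasTurningNumber (fun t => stereo u v n (T.immersion (σ t))) (τ C)) ∧
    ∑ᶠ C ∈ T.profileComponents u v n, τ C = N

end FlatCMCTorus

end

/-!
**The surface as a product of two circles.** Let `m i` be a square root of `lam i`. The frame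
`flatFrame (lam i)` runs through a circle subgroup of `𝕊³`, at the angle `2 π Re (z · conj (m i))`
(`flatFrame_eq`). Hence the surface `F_{λ₁} F_{λ₂}⁻¹` is a product of two circles in orthogonal
planes (`flatFrame_mul_inv_eq`, `CircleProduct.ofFrame`), whose phases `φ`, `φ'`, counted in full
turns, are the pairings of `z` with the perpendicular vectors `m 1 - m 2` and `m 1 + m 2`. The
periods of the surface are the points at which both phases are integers. They form a rectangular
lattice, and the surface embeds the quotient by it (`CircleProduct.isEmbedded_fullTorus`).

**The congruence at the double point.** The vector `s` is the linear relation between the square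
roots, `s₀ m₀ + s₁ m₁ + s₂ m₂ = 0`. Paired with `z` it says that the frame at `λ₀` is `± 1` at a
period with phases `(i, j) ∈ ℤ²` exactly when `s₀` divides `(s₁ - s₂) i + (s₁ + s₂) j`, in the
sense that the quotient is an integer (`turnVector_mul_planePairing`). As a lattice provides two
independent such relations, the ratios of `s₀`, `s₁ - s₂`, `s₁ + s₂` are rational
(`SpectralFrame.exists_hasTurnTriple`). For the triple `(ℓ₀, ℓ₁, ℓ₂)` the periods with monodromy
`± 1` form the lattice given by one primitive congruence modulo `ℓ₀` with coefficients `± ℓ₁`,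
`± ℓ₂`, in some order. It has index `ℓ₀` in the lattice of all periods, which is the number of
sheets of the covering (`CircleProduct.card_ker_map`). The profile curves with respect to one of
the two circles are the lines on which the phase of the other circle is an integer
(`CircleProduct.apply_mem_hemisphere_iff`); counting them modulo the congruence lattice gives
`gcd (ℓ₀, ℓₖ)` closed curves (`CircleProduct.IsCongruenceLattice.profile`).

**The axes.** The equivariant action rotates the planes of the two circles, with frequencies
proportional to `s₁ + s₂` and `s₂ - s₁`. These differ in absolute value, as `ℓ₁ < ℓ₂`, and then no
other plane is invariant (`eq_greatCircle_of_rotation_of_ne_zero`). An axis is fixed pointwise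
exactly when its frequency vanishes, that is, `ℓ₁ = 0` (`SpectralFrame.isRotational_iff`).

**The classification.** The vectors `sᵢ mᵢ` are the edges of a triangle with side lengths
proportional to `2 ℓ₀`, `ℓ₁ + ℓ₂`, `ℓ₂ - ℓ₁`. The strict triangle inequalities are
`ℓ₁ < ℓ₀ < ℓ₂` (`turnVector_sq_mul_sq_neg`). The side lengths determine the triangle up to
rotation and orientation, and therefore the spectral data up to rotation, inversion and swapping
(`HasTurnTriple.exists_signedTriple`, `IsNormalRoots.unique`); conversely every admissible triangle
exists and produces a torus (`exists_hasTurnTriple_lam`, `exists_spectralFrame`).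
-/

noncomputable section

/-! ### The extended frame in terms of a square root of the spectral parameter -/

/-- The quaternion `a + b i + c j + d k`. -/
def quat (a b c d : ℝ) : ℍ[ℝ] := ⟨a, b, c, d⟩

@[simp] lemma quat_re (a b c d : ℝ) : (quat a b c d).re = a := rfl
@[simp] lemma quat_imI (a b c d : ℝ) : (quat a b c d).imI = b := rfl
@[simp] lemma quat_imJ (a b c d : ℝ) : (quat a b c d).imJ = c := rfl
@[simp] lemma quat_imK (a b c d : ℝ) : (quat a b c d).imK = d := rfl

/-- The real inner product `Re (z μ̄)` of the plane, as a linear form in `z`. -/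
def planePairing (μ : ℂ) : ℂ →ₗ[ℝ] ℝ where
  toFun z := (z * (starRingEnd ℂ) μ).re
  map_add' x y := by simp [add_mul]
  map_smul' c x := by simp; ring

lemma planePairing_apply (μ z : ℂ) : planePairing μ z = z.re * μ.re + z.im * μ.im := by
  simp [planePairing]

lemma planePairing_add_left (μ ν z : ℂ) :
    planePairing (μ + ν) z = planePairing μ z + planePairing ν z := by
  simp [planePairing_apply]; ring

lemma planePairing_sub_left (μ ν z : ℂ) :
    planePairing (μ - ν) z = planePairing μ z - planePairing ν z := by
  simp [planePairing_apply]; ring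

lemma re_sq_add_im_sq_of_sq_eq {μ : ℂ} {lam : Circle} (h : μ ^ 2 = lam) :
    μ.re ^ 2 + μ.im ^ 2 = 1 := by
  have h1 : ‖μ‖ ^ 2 = 1 := by rw [← norm_pow, h, Circle.norm_coe]
  rw [← Complex.normSq_eq_norm_sq, Complex.normSq_apply] at h1
  linarith

/-- The frame is the circle subgroup generated by the imaginary unit `k μ`, `μ² = λ`, at the
angle `2 π Re (z μ̄)`. -/
lemma flatFrame_eq {μ : ℂ} {lam : Circle} (h : μ ^ 2 = lam) (z : ℂ) :
    flatFrame lam z = quat (Real.cos (2 * Real.pi * planePairing μ z)) 0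
      (Real.sin (2 * Real.pi * planePairing μ z) * μ.im)
      (Real.sin (2 * Real.pi * planePairing μ z) * μ.re) := by
  have hμ := re_sq_add_im_sq_of_sq_eq h
  set x := planePairing μ z with hx
  rw [planePairing_apply] at hx
  have hw : z * (lam : ℂ)⁻¹ + (starRingEnd ℂ) z = ⟨2 * x * μ.re, - (2 * x * μ.im)⟩ := by
    have hinv : (lam : ℂ)⁻¹ = (starRingEnd ℂ) μ ^ 2 := by
      rw [← h, ← inv_pow]
      congr 1
      refine inv_eq_of_mul_eq_one_right ?_
      rw [Complex.mul_conj, Complex.normSq_apply]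
      norm_cast
      linarith
    rw [hinv]
    apply Complex.ext
    · simp [pow_two, hx]
      linear_combination (-z.re) * hμ
    · simp [pow_two, hx]
      linear_combination (z.im) * hμ
  have hq : quat 0 0 (-(Real.pi * (-(2 * x * μ.im)))) (Real.pi * (2 * x * μ.re))
      = (2 * Real.pi * x) • quat 0 0 μ.im μ.re := by
    ext <;> simp <;> ring
  have hn : ‖quat 0 0 μ.im μ.re‖ = 1 := by
    have : ‖quat 0 0 μ.im μ.re‖ ^ 2 = 1 := by
      rw [pow_two, ← Quaternion.normSq_eq_norm_mul_self, Quaternion.normSq_def']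
      simp; linarith
    nlinarith [norm_nonneg (quat 0 0 μ.im μ.re)]
  unfold flatFrame
  simp only [hw]
  change NormedSpace.exp (quat 0 0 (-(Real.pi * (-(2 * x * μ.im)))) (Real.pi * (2 * x * μ.re))) = _
  rw [hq, Quaternion.exp_of_re_eq_zero _ (by simp), norm_smul, hn, mul_one, Real.norm_eq_abs,
    Real.cos_abs]
  have hs : Real.sin |2 * Real.pi * x| / |2 * Real.pi * x| * (2 * Real.pi * x)
      = Real.sin (2 * Real.pi * x) := by
    rcases eq_or_ne (2 * Real.pi * x) 0 with h0 | h0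
    · simp [h0]
    · rcases abs_choice (2 * Real.pi * x) with h1 | h1 <;> rw [h1]
      · rw [div_mul_cancel₀ _ h0]
      · rw [Real.sin_neg, neg_div_neg_eq, div_mul_cancel₀ _ h0]
  rw [smul_smul, hs]
  ext <;> simp

/-- The frame is a homomorphism. -/
lemma flatFrame_add {μ : ℂ} {lam : Circle} (h : μ ^ 2 = lam) (z w : ℂ) :
    flatFrame lam (z + w) = flatFrame lam z * flatFrame lam w := by
  have hμ := re_sq_add_im_sq_of_sq_eq h
  simp only [flatFrame_eq h, map_add, mul_add, Real.cos_add, Real.sin_add]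
  ext
  · simp
    linear_combination (Real.sin (2 * Real.pi * planePairing μ z) *
      Real.sin (2 * Real.pi * planePairing μ w)) * hμ
  all_goals simp
  all_goals ring

lemma flatFrame_inv {μ : ℂ} {lam : Circle} (h : μ ^ 2 = lam) (z : ℂ) :
    (flatFrame lam z)⁻¹ = flatFrame lam (-z) := by
  refine inv_eq_of_mul_eq_one_right ?_
  rw [← flatFrame_add h, add_neg_cancel, flatFrame_eq h]
  ext <;> simp

/-- The monodromy is `± 1` exactly when the angle is a multiple of `π`. -/
lemma flatFrame_eq_one_or_neg_one_iff {μ : ℂ} {lam : Circle} (h : μ ^ 2 = lam) (z : ℂ) :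
    (flatFrame lam z = 1 ∨ flatFrame lam z = -1) ↔ ∃ n : ℤ, 2 * planePairing μ z = n := by
  have hμ := re_sq_add_im_sq_of_sq_eq h
  set x := planePairing μ z with hx
  have key : (flatFrame lam z = 1 ∨ flatFrame lam z = -1) ↔ Real.sin (2 * Real.pi * x) = 0 := by
    rw [flatFrame_eq h, ← hx]
    constructor
    · rintro (h1 | h1)
      all_goals
        have hJ := congrArg (fun q : ℍ[ℝ] => q.imJ) h1
        have hK := congrArg (fun q : ℍ[ℝ] => q.imK) h1
        simp only [quat_imJ, quat_imK, Quaternion.imJ_one, Quaternion.imK_one, Quaternion.imJ_neg,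
          Quaternion.imK_neg, neg_zero] at hJ hK
        have : Real.sin (2 * Real.pi * x) ^ 2 = 0 := by
          linear_combination (- Real.sin (2 * Real.pi * x) ^ 2) * hμ +
            Real.sin (2 * Real.pi * x) * μ.im * hJ + Real.sin (2 * Real.pi * x) * μ.re * hK
        exact pow_eq_zero_iff (two_ne_zero) |>.mp this
    · intro h0
      have hc : Real.cos (2 * Real.pi * x) = 1 ∨ Real.cos (2 * Real.pi * x) = -1 := by
        have := Real.sin_sq_add_cos_sq (2 * Real.pi * x)
        rw [h0] at this
        exact sq_eq_one_iff.mp (by linarith)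
      rcases hc with hc | hc
      · left; rw [h0, hc]; ext <;> simp
      · right; rw [h0, hc]; ext <;> simp
  rw [key, Real.sin_eq_zero_iff]
  refine exists_congr fun n => ?_
  constructor
  · intro h1
    have : Real.pi * (n - 2 * x) = 0 := by linarith
    rcases mul_eq_zero.mp this with h2 | h2
    · exact absurd h2 Real.pi_ne_zero
    · linarith
  · intro h1
    rw [← h1]; ring

/-- The line on which the frame is constant is perpendicular to the square root. -/
lemma forall_flatFrame_smul_eq_one_iff {μ : ℂ} {lam : Circle} (h : μ ^ 2 = lam) (ζ : ℂ) :
    (∀ t : ℝ, flatFrame lam (t * ζ) = 1) ↔ ∃ t : ℝ, ζ = t * (Complex.I * μ) := by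
  have hμ := re_sq_add_im_sq_of_sq_eq h
  have hp : ∀ t : ℝ, planePairing μ (t * ζ) = t * planePairing μ ζ := by
    intro t; simp [planePairing_apply]; ring
  have h2 : (∀ t : ℝ, flatFrame lam (t * ζ) = 1) ↔ planePairing μ ζ = 0 := by
    constructor
    · intro h1
      by_contra h0
      obtain ⟨n, hn⟩ := (flatFrame_eq_one_or_neg_one_iff h _).mp
        (Or.inl (h1 (1 / (4 * planePairing μ ζ))))
      rw [hp] at hn
      have h3 : ((1 : ℤ) : ℝ) = ((2 * n : ℤ) : ℝ) := by
        push_cast; rw [← hn]; field_simp; norm_num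
      have := Int.cast_injective (α := ℝ) h3
      omega
    · intro h0 t
      rw [flatFrame_eq h, hp, h0]
      ext <;> simp
  rw [h2, planePairing_apply]
  constructor
  · intro h0
    refine ⟨ζ.im * μ.re - ζ.re * μ.im, ?_⟩
    apply Complex.ext
    · simp
      linear_combination (-ζ.re) * hμ + μ.re * h0
    · simp
      linear_combination (-ζ.im) * hμ + μ.im * h0
  · rintro ⟨t, rfl⟩
    simp; ring

/-! ### Square roots of unimodular numbers and the vector `s` -/

/-- The oriented area `Im (z̄ w)` of the parallelogram spanned by `z` and `w`. -/
def planeCross (z w : ℂ) : ℝ := z.re * w.im - z.im * w.re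

lemma planeCross_mul_add (x y z : ℂ) :
    (planeCross y z : ℂ) * x + planeCross z x * y + planeCross x y * z = 0 := by
  apply Complex.ext <;> simp [planeCross] <;> ring

lemma turnVector_zero (m : Fin 3 → ℂ) : turnVector m 0 = 2 * planeCross (m 1) (m 2) := by
  simp [turnVector, cross_apply, planeCross]; ring

lemma turnVector_one (m : Fin 3 → ℂ) : turnVector m 1 = 2 * planeCross (m 2) (m 0) := by
  simp [turnVector, cross_apply, planeCross]; ring

lemma turnVector_two (m : Fin 3 → ℂ) : turnVector m 2 = 2 * planeCross (m 0) (m 1) := by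
  simp [turnVector, cross_apply, planeCross]; ring

lemma planeCross_sq_add_planePairing_sq {z w : ℂ} (hz : z.re ^ 2 + z.im ^ 2 = 1)
    (hw : w.re ^ 2 + w.im ^ 2 = 1) : planeCross z w ^ 2 + planePairing w z ^ 2 = 1 := by
  rw [planeCross, planePairing_apply]
  linear_combination (w.re ^ 2 + w.im ^ 2) * hz + hw

/-- Unit vectors with distinct squares are not parallel. -/
lemma planeCross_ne_zero {z w : ℂ} {l l' : Circle} (hz : z ^ 2 = l) (hw : w ^ 2 = l')
    (h : l ≠ l') : planeCross z w ≠ 0 := by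
  intro h0
  have hz1 := re_sq_add_im_sq_of_sq_eq hz
  have hw1 := re_sq_add_im_sq_of_sq_eq hw
  have h1 := planeCross_sq_add_planePairing_sq hz1 hw1
  rw [h0] at h1
  have h2 : z = (planePairing w z : ℂ) * w := by
    apply Complex.ext
    · simp [planePairing_apply]
      rw [planeCross] at h0
      linear_combination (-z.re) * hw1 + w.im * h0
    · simp [planePairing_apply]
      rw [planeCross] at h0
      linear_combination (-z.im) * hw1 - w.re * h0
  apply h
  apply Subtype.ext
  rw [← hz, ← hw, h2, mul_pow]
  have : ((planePairing w z : ℝ) : ℂ) ^ 2 = 1 := by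
    norm_cast; linarith
  rw [this, one_mul]

/-! ### Products of two circles in the 3-sphere -/

/-- The circle `cos (2 π x) p + sin (2 π x) q`, parametrized with period one. -/
def circlePath (p q : ℍ[ℝ]) (x : ℝ) : ℍ[ℝ] :=
  Real.cos (2 * Real.pi * x) • p + Real.sin (2 * Real.pi * x) • q

/-- A presentation of `f : ℂ → 𝕊³` as a product of two circles of radii `r`, `r'` in the orthogonal
planes spanned by `p, q` and by `p', q'`: the phases (in multiples of a full turn) are affine
functions `φ + c`, `φ' + c'` whose linear parts are linearly independent. -/
structure CircleProduct (f : ℂ → ℍ[ℝ]) where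
  p : ℍ[ℝ]
  q : ℍ[ℝ]
  p' : ℍ[ℝ]
  q' : ℍ[ℝ]
  orthonormal : Orthonormal ℝ ![p, q, p', q']
  r : ℝ
  r' : ℝ
  r_pos : 0 < r
  r'_pos : 0 < r'
  φ : ℂ →ₗ[ℝ] ℝ
  φ' : ℂ →ₗ[ℝ] ℝ
  c : ℝ
  c' : ℝ
  eq_zero : ∀ z, φ z = 0 → φ' z = 0 → z = 0
  eq_add : ∀ z, f z = r • circlePath p q (φ z + c) + r' • circlePath p' q' (φ' z + c')

lemma orthonormal_two_iff {p q : ℍ[ℝ]} : Orthonormal ℝ ![p, q] ↔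
    inner ℝ p p = 1 ∧ inner ℝ q q = 1 ∧ inner ℝ p q = 0 := by
  rw [orthonormal_iff_ite]
  simp only [Fin.forall_fin_succ, Matrix.cons_val_zero, Matrix.cons_val_succ, IsEmpty.forall_iff,
    Fin.succ_ne_zero, (Fin.succ_ne_zero _).symm, Fin.succ_inj, if_true, if_false]
  have := real_inner_comm p q
  simp only [this]
  tauto

lemma orthonormal_three_iff {p q n : ℍ[ℝ]} : Orthonormal ℝ ![p, q, n] ↔
    inner ℝ p p = 1 ∧ inner ℝ q q = 1 ∧ inner ℝ n n = 1 ∧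
    inner ℝ p q = 0 ∧ inner ℝ p n = 0 ∧ inner ℝ q n = 0 := by
  rw [orthonormal_iff_ite]
  simp only [Fin.forall_fin_succ, Matrix.cons_val_zero, Matrix.cons_val_succ, IsEmpty.forall_iff,
    Fin.succ_ne_zero, (Fin.succ_ne_zero _).symm, Fin.succ_inj, if_true, if_false]
  simp only [real_inner_comm p q, real_inner_comm p n, real_inner_comm q n]
  tauto

lemma orthonormal_four_iff {p q p' q' : ℍ[ℝ]} : Orthonormal ℝ ![p, q, p', q'] ↔
    inner ℝ p p = 1 ∧ inner ℝ q q = 1 ∧ inner ℝ p' p' = 1 ∧ inner ℝ q' q' = 1 ∧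
    inner ℝ p q = 0 ∧ inner ℝ p p' = 0 ∧ inner ℝ p q' = 0 ∧
    inner ℝ q p' = 0 ∧ inner ℝ q q' = 0 ∧ inner ℝ p' q' = 0 := by
  rw [orthonormal_iff_ite]
  simp only [Fin.forall_fin_succ, Matrix.cons_val_zero, Matrix.cons_val_succ, IsEmpty.forall_iff,
    Fin.succ_ne_zero, (Fin.succ_ne_zero _).symm, Fin.succ_inj, if_true, if_false]
  simp only [real_inner_comm p q, real_inner_comm p p', real_inner_comm p q',
    real_inner_comm q p', real_inner_comm q q', real_inner_comm p' q']
  tauto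

lemma inner_quat (a b c d a' b' c' d' : ℝ) :
    inner ℝ (quat a b c d) (quat a' b' c' d') = a * a' + b * b' + c * c' + d * d' := by
  rw [Quaternion.inner_def]; simp

/-- Multiplication from both sides with unit quaternions, an isometry of `ℍ`. -/
def unitSandwich (U V : ℍ[ℝ]) (hU : ‖U‖ = 1) (hV : ‖V‖ = 1) : ℍ[ℝ] →ₗᵢ[ℝ] ℍ[ℝ] where
  toFun P := U * P * V
  map_add' x y := by rw [mul_add, add_mul]
  map_smul' c x := by simp
  norm_map' x := by simp [hU, hV]

@[simp] lemma unitSandwich_apply (U V : ℍ[ℝ]) (hU : ‖U‖ = 1) (hV : ‖V‖ = 1) (P : ℍ[ℝ]) :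
    unitSandwich U V hU hV P = U * P * V := rfl

/-- The surface `F_{λ₁} F_{λ₂}⁻¹` in terms of the sum and the difference of the two phases. -/
lemma flatFrame_mul_inv_eq {μ ν : ℂ} {l l' : Circle} (hμ : μ ^ 2 = l) (hν : ν ^ 2 = l') (z : ℂ) :
    flatFrame l z * (flatFrame l' z)⁻¹ =
      circlePath (quat ((1 + planePairing ν μ) / 2) (planeCross μ ν / 2) 0 0)
        (quat 0 0 ((μ.im + ν.im) / 2) ((μ.re + ν.re) / 2)) (planePairing (μ - ν) z) +
      circlePath (quat ((1 - planePairing ν μ) / 2) (- planeCross μ ν / 2) 0 0)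
        (quat 0 0 ((μ.im - ν.im) / 2) ((μ.re - ν.re) / 2)) (planePairing (μ + ν) z) := by
  rw [flatFrame_inv hν, flatFrame_eq hμ, flatFrame_eq hν, map_neg, planePairing_sub_left,
    planePairing_add_left, planePairing_apply ν μ, planeCross, mul_neg, Real.cos_neg, Real.sin_neg]
  simp only [circlePath, mul_add, mul_sub, Real.cos_add, Real.cos_sub, Real.sin_add, Real.sin_sub]
  ext <;> simp <;> ring

/-- A surface with an extended frame is a product of two circles, whose phases are the pairings
with the difference and the sum of the square roots of the Sym points. -/
def CircleProduct.ofFrame {f : ℂ → ℍ[ℝ]} {U V : ℍ[ℝ]} (hU : ‖U‖ = 1) (hV : ‖V‖ = 1)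
    {a : ℂ} (ha : a ≠ 0) {μ ν : ℂ} {l l' : Circle} (hμ : μ ^ 2 = l) (hν : ν ^ 2 = l') (hl : l ≠ l')
    (hf : ∀ z, f z = U * (flatFrame l (a * z) * (flatFrame l' (a * z))⁻¹) * V) :
    CircleProduct f :=
  let D := planePairing ν μ
  let E := planeCross μ ν
  let r := Real.sqrt ((1 + D) / 2)
  let r' := Real.sqrt ((1 - D) / 2)
  have h1 := re_sq_add_im_sq_of_sq_eq hμ
  have h2 := re_sq_add_im_sq_of_sq_eq hν
  have hDE : E ^ 2 + D ^ 2 = 1 := planeCross_sq_add_planePairing_sq h1 h2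
  have hE : E ≠ 0 := planeCross_ne_zero hμ hν hl
  have hE2 : 0 < E ^ 2 := by positivity
  have hr : 0 < (1 + D) / 2 := by nlinarith
  have hr' : 0 < (1 - D) / 2 := by nlinarith
  have hrs : r ^ 2 = (1 + D) / 2 := Real.sq_sqrt hr.le
  have hrs' : r' ^ 2 = (1 - D) / 2 := Real.sq_sqrt hr'.le
  have hr0 : r ≠ 0 := (Real.sqrt_pos.mpr hr).ne'
  have hr0' : r' ≠ 0 := (Real.sqrt_pos.mpr hr').ne'
  have hD : D = μ.re * ν.re + μ.im * ν.im := planePairing_apply _ _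
  { p := U * (r⁻¹ • quat ((1 + D) / 2) (E / 2) 0 0) * V
    q := U * (r⁻¹ • quat 0 0 ((μ.im + ν.im) / 2) ((μ.re + ν.re) / 2)) * V
    p' := U * (r'⁻¹ • quat ((1 - D) / 2) (- E / 2) 0 0) * V
    q' := U * (r'⁻¹ • quat 0 0 ((μ.im - ν.im) / 2) ((μ.re - ν.re) / 2)) * V
    orthonormal := by
      rw [orthonormal_four_iff]
      simp only [← unitSandwich_apply U V hU hV, LinearIsometry.inner_map_map,
        inner_smul_left, inner_smul_right, inner_quat]
      simp only [RCLike.conj_to_real]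
      refine ⟨?_, ?_, ?_, ?_, ?_, ?_, ?_, ?_, ?_, ?_⟩
      · field_simp
        linear_combination hDE - 4 * hrs
      · field_simp
        linear_combination h1 + h2 - 4 * hrs - 2 * hD
      · field_simp
        linear_combination hDE - 4 * hrs'
      · field_simp
        linear_combination h1 + h2 - 4 * hrs' + 2 * hD
      · ring
      · field_simp
        linear_combination -hDE
      · ring
      · ring
      · field_simp
        linear_combination h1 - h2
      · ring
    r := r
    r' := r'
    r_pos := Real.sqrt_pos.mpr hr
    r'_pos := Real.sqrt_pos.mpr hr'
    φ := planePairing (μ - ν) ∘ₗ LinearMap.mulLeft ℝ a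
    φ' := planePairing (μ + ν) ∘ₗ LinearMap.mulLeft ℝ a
    c := 0
    c' := 0
    eq_zero := by
      intro z hz hz'
      simp only [LinearMap.comp_apply, LinearMap.mulLeft_apply] at hz hz'
      have hw : a * z = 0 := by
        generalize a * z = w at hz hz'
        rw [planePairing_sub_left, planePairing_apply, planePairing_apply] at hz
        rw [planePairing_add_left, planePairing_apply, planePairing_apply] at hz'
        have e : E = μ.re * ν.im - μ.im * ν.re := rfl
        apply Complex.ext
        · apply mul_left_cancel₀ hE
          simp only [Complex.zero_re, mul_zero]
          linear_combination w.re * e + (ν.im / 2 - μ.im / 2) * hz' +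
            (ν.im / 2 + μ.im / 2) * hz
        · apply mul_left_cancel₀ hE
          simp only [Complex.zero_im, mul_zero]
          linear_combination w.im * e + (- ν.re / 2 + μ.re / 2) * hz' +
            (- ν.re / 2 - μ.re / 2) * hz
      exact (mul_eq_zero.mp hw).resolve_left ha
    eq_add := by
      intro z
      rw [hf z, flatFrame_mul_inv_eq hμ hν, mul_add, add_mul]
      simp only [circlePath, mul_add, add_mul, mul_smul_comm, smul_mul_assoc, smul_add, smul_smul,
        LinearMap.comp_apply, LinearMap.mulLeft_apply, add_zero]
      have e1 : ∀ x : ℝ, r * (x * r⁻¹) = x := fun x => by field_simp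
      have e2 : ∀ x : ℝ, r' * (x * r'⁻¹) = x := fun x => by field_simp
      simp only [e1, e2]
      rfl }

/-- The immersion of a torus with a spectral frame as a product of two circles. -/
def SpectralFrame.circleProduct {T : FlatCMCTorus} {lam : Fin 3 → Circle} (S : SpectralFrame T lam)
    (m : Fin 3 → ℂ) (hm : ∀ i, m i ^ 2 = (lam i : ℂ)) : CircleProduct T.immersion :=
  CircleProduct.ofFrame S.norm_U S.norm_V S.a_ne_zero (hm 1) (hm 2)
    (S.distinct.ne (by decide)) S.sym

lemma circlePath_zero (p q : ℍ[ℝ]) : circlePath p q 0 = p := by simp [circlePath]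

lemma circlePath_int (p q : ℍ[ℝ]) (j : ℤ) : circlePath p q j = p := by
  have h : 2 * Real.pi * (j : ℝ) = j * (2 * Real.pi) := by ring
  rw [circlePath, h, Real.cos_int_mul_two_pi, show (j : ℝ) * (2 * Real.pi) = ((2 * j : ℤ) : ℝ) *
    Real.pi by push_cast; ring, Real.sin_int_mul_pi]
  simp

lemma circlePath_add_int (p q : ℍ[ℝ]) (x : ℝ) (j : ℤ) :
    circlePath p q (x + j) = circlePath p q x := by
  have h : 2 * Real.pi * (x + j) = 2 * Real.pi * x + j * (2 * Real.pi) := by ring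
  rw [circlePath, h, Real.cos_add_int_mul_two_pi, Real.sin_add_int_mul_two_pi, circlePath]

/-- Equality of cosines and sines means equality of the phases modulo full turns. -/
lemma exists_int_of_cos_sin_eq {x y : ℝ}
    (hc : Real.cos (2 * Real.pi * x) = Real.cos (2 * Real.pi * y))
    (hs : Real.sin (2 * Real.pi * x) = Real.sin (2 * Real.pi * y)) : ∃ j : ℤ, x - y = j := by
  have h := Real.Angle.cos_sin_inj hc hs
  rw [Real.Angle.angle_eq_iff_two_pi_dvd_sub] at h
  obtain ⟨k, hk⟩ := h
  refine ⟨k, ?_⟩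
  have : (2 * Real.pi) * (x - y - k) = 0 := by linarith
  rcases mul_eq_zero.mp this with h0 | h0
  · exact absurd h0 (by positivity)
  · linarith

/-- Every point is the combination of an orthonormal basis with its inner products. -/
lemma eq_sum_inner_of_orthonormal {p q p' q' : ℍ[ℝ]} (h : Orthonormal ℝ ![p, q, p', q'])
    (x : ℍ[ℝ]) : x = (inner ℝ p x) • p + (inner ℝ q x) • q + (inner ℝ p' x) • p' +
      (inner ℝ q' x) • q' := by
  have hcard : Fintype.card (Fin 4) = Module.finrank ℝ ℍ[ℝ] := by
    rw [Quaternion.finrank_eq_four]; rfl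
  let b := basisOfOrthonormalOfCardEqFinrank h hcard
  have hb : ⇑b = ![p, q, p', q'] := coe_basisOfOrthonormalOfCardEqFinrank h hcard
  let ob := b.toOrthonormalBasis (by rw [hb]; exact h)
  have hob : ⇑ob = ![p, q, p', q'] := by simp [ob, hb]
  have := ob.sum_repr' x
  rw [hob] at this
  simp [Fin.sum_univ_four] at this
  exact this.symm

namespace CircleProduct

variable {f : ℂ → ℍ[ℝ]} (D : CircleProduct f)

/-- The same surface with the roles of the two circles exchanged. -/
def swap : CircleProduct f where
  p := D.p'
  q := D.q'
  p' := D.p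
  q' := D.q
  orthonormal := by
    have h := D.orthonormal
    rw [orthonormal_four_iff] at h ⊢
    simp only [real_inner_comm D.p D.p', real_inner_comm D.p D.q', real_inner_comm D.q D.p',
      real_inner_comm D.q D.q']
    tauto
  r := D.r'
  r' := D.r
  r_pos := D.r'_pos
  r'_pos := D.r_pos
  φ := D.φ'
  φ' := D.φ
  c := D.c'
  c' := D.c
  eq_zero z h h' := D.eq_zero z h' h
  eq_add z := by rw [D.eq_add z, add_comm]

/-- The two phases as linear coordinates of the plane. -/
def coords : ℂ ≃ₗ[ℝ] ℝ × ℝ :=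
  LinearEquiv.ofInjectiveOfFinrankEq (D.φ.prod D.φ')
    ((injective_iff_map_eq_zero _).mpr (fun z hz => by
      exact D.eq_zero z (congrArg Prod.fst hz) (congrArg Prod.snd hz))) (by simp)

lemma coords_apply (z : ℂ) : D.coords z = (D.φ z, D.φ' z) := rfl

/-- The point of the plane with given (linear) phases. -/
def point (x y : ℝ) : ℂ := x • D.coords.symm (1, 0) + y • D.coords.symm (0, 1)

@[simp] lemma φ_point (x y : ℝ) : D.φ (D.point x y) = x := by
  have h1 := D.coords.apply_symm_apply (1, 0)
  have h2 := D.coords.apply_symm_apply (0, 1)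
  rw [coords_apply, Prod.mk.injEq] at h1 h2
  rw [point, map_add, map_smul, map_smul, h1.1, h2.1]; simp

@[simp] lemma φ'_point (x y : ℝ) : D.φ' (D.point x y) = y := by
  have h1 := D.coords.apply_symm_apply (1, 0)
  have h2 := D.coords.apply_symm_apply (0, 1)
  rw [coords_apply, Prod.mk.injEq] at h1 h2
  rw [point, map_add, map_smul, map_smul, h1.2, h2.2]; simp

lemma ext_phase {z w : ℂ} (h : D.φ z = D.φ w) (h' : D.φ' z = D.φ' w) : z = w :=
  D.coords.injective (by rw [coords_apply, coords_apply, h, h'])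

lemma inner_p (z : ℂ) : inner ℝ D.p (f z) = D.r * Real.cos (2 * Real.pi * (D.φ z + D.c)) := by
  obtain ⟨h1, h2, h3, h4, h5, h6, h7, h8, h9, h10⟩ := orthonormal_four_iff.mp D.orthonormal
  rw [D.eq_add z]
  simp only [circlePath, inner_add_right, inner_smul_right, h1, h5, h6, h7]
  ring

lemma inner_q (z : ℂ) : inner ℝ D.q (f z) = D.r * Real.sin (2 * Real.pi * (D.φ z + D.c)) := by
  obtain ⟨h1, h2, h3, h4, h5, h6, h7, h8, h9, h10⟩ := orthonormal_four_iff.mp D.orthonormal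
  rw [D.eq_add z]
  simp only [circlePath, inner_add_right, inner_smul_right, h2, h5, h8, h9,
    real_inner_comm D.p D.q]
  ring

lemma inner_p' (z : ℂ) :
    inner ℝ D.p' (f z) = D.r' * Real.cos (2 * Real.pi * (D.φ' z + D.c')) :=
  D.swap.inner_p z

lemma inner_q' (z : ℂ) :
    inner ℝ D.q' (f z) = D.r' * Real.sin (2 * Real.pi * (D.φ' z + D.c')) :=
  D.swap.inner_q z

lemma exists_int_of_apply_eq {z w : ℂ} (h : f z = f w) : ∃ i : ℤ, D.φ z - D.φ w = i := by
  have hp := D.inner_p z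
  have hq := D.inner_q z
  rw [h, D.inner_p w] at hp
  rw [h, D.inner_q w] at hq
  obtain ⟨i, hi⟩ := exists_int_of_cos_sin_eq (mul_left_cancel₀ D.r_pos.ne' hp).symm
    (mul_left_cancel₀ D.r_pos.ne' hq).symm
  exact ⟨i, by linarith⟩

/-- The surface passes through the same point exactly when both phases agree modulo full turns. -/
lemma apply_eq_iff (z w : ℂ) :
    f z = f w ↔ (∃ i : ℤ, D.φ z - D.φ w = i) ∧ ∃ j : ℤ, D.φ' z - D.φ' w = j := by
  refine ⟨fun h => ⟨D.exists_int_of_apply_eq h, D.swap.exists_int_of_apply_eq h⟩, ?_⟩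
  rintro ⟨⟨i, hi⟩, j, hj⟩
  rw [D.eq_add z, D.eq_add w, show D.φ z + D.c = D.φ w + D.c + i by linarith,
    show D.φ' z + D.c' = D.φ' w + D.c' + j by linarith, circlePath_add_int, circlePath_add_int]

lemma isPeriod_iff (γ : ℂ) : (∀ z, f (z + γ) = f z) ↔
    (∃ i : ℤ, D.φ γ = i) ∧ ∃ j : ℤ, D.φ' γ = j := by
  simp only [D.apply_eq_iff, map_add, add_sub_cancel_left, forall_const]

lemma cos_pos_sin_zero_iff (x : ℝ) :
    (Real.sin (2 * Real.pi * x) = 0 ∧ 0 < Real.cos (2 * Real.pi * x)) ↔ ∃ j : ℤ, x = j := by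
  constructor
  · rintro ⟨hs, hc⟩
    have h1 : Real.cos (2 * Real.pi * x) = 1 := by
      have := Real.sin_sq_add_cos_sq (2 * Real.pi * x)
      rw [hs] at this
      nlinarith
    obtain ⟨j, hj⟩ := exists_int_of_cos_sin_eq (x := x) (y := 0) (by simpa using h1)
      (by simpa using hs)
    exact ⟨j, by simpa using hj⟩
  · rintro ⟨j, rfl⟩
    have h : 2 * Real.pi * (j : ℝ) = j * (2 * Real.pi) := by ring
    rw [h, Real.cos_int_mul_two_pi, show (j : ℝ) * (2 * Real.pi) = ((2 * j : ℤ) : ℝ) *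
      Real.pi by push_cast; ring, Real.sin_int_mul_pi]
    simp

/-- The surface meets the hemisphere bounded by the first circle and containing `p'` along the
lines on which the second phase is an integer. -/
lemma apply_mem_hemisphere_iff (hf : ∀ z, ‖f z‖ = 1) (z : ℂ) :
    f z ∈ hemisphere D.p D.q D.p' ↔ ∃ j : ℤ, D.φ' z + D.c' = j := by
  obtain ⟨h1, h2, h3, h4, h5, h6, h7, h8, h9, h10⟩ := orthonormal_four_iff.mp D.orthonormal
  rw [← cos_pos_sin_zero_iff]
  constructor
  · rintro ⟨-, hspan, hpos⟩
    rw [D.inner_p'] at hpos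
    refine ⟨?_, (mul_pos_iff_of_pos_left D.r'_pos).mp hpos⟩
    have h0 : inner ℝ D.q' (f z) = 0 := by
      rw [Submodule.mem_span_triple] at hspan
      obtain ⟨a, b, c, habc⟩ := hspan
      rw [← habc]
      simp [inner_add_right, inner_smul_right, real_inner_comm D.p D.q',
        real_inner_comm D.q D.q', real_inner_comm D.p' D.q', h7, h9, h10]
    rw [D.inner_q'] at h0
    exact (mul_eq_zero.mp h0).resolve_left D.r'_pos.ne'
  · rintro ⟨hs, hc⟩
    refine ⟨hf z, ?_, ?_⟩
    · rw [Submodule.mem_span_triple]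
      refine ⟨D.r * Real.cos (2 * Real.pi * (D.φ z + D.c)),
        D.r * Real.sin (2 * Real.pi * (D.φ z + D.c)),
        D.r' * Real.cos (2 * Real.pi * (D.φ' z + D.c')), ?_⟩
      rw [D.eq_add z, circlePath, circlePath, hs]
      module
    · rw [D.inner_p']
      exact mul_pos D.r'_pos hc

end CircleProduct

lemma greatCircle_eq {u v : ℍ[ℝ]} (h : Orthonormal ℝ ![u, v]) :
    greatCircle u v = {P | P ∈ Submodule.span ℝ {u, v} ∧ inner ℝ P P = (1 : ℝ)} := by
  obtain ⟨h1, h2, h3⟩ := orthonormal_two_iff.mp h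
  ext P
  simp only [greatCircle, Set.mem_ofPred_eq, Submodule.mem_span_pair]
  have key : ∀ s t : ℝ, inner ℝ (s • u + t • v) (s • u + t • v) = s ^ 2 + t ^ 2 := by
    intro s t
    simp only [inner_add_right, inner_add_left, inner_smul_right, inner_smul_left,
      RCLike.conj_to_real, h1, h2, h3, real_inner_comm u v]
    ring
  constructor
  · rintro ⟨s, t, hst, rfl⟩
    exact ⟨⟨s, t, rfl⟩, by rw [key, hst]⟩
  · rintro ⟨⟨s, t, rfl⟩, hP⟩
    exact ⟨s, t, by rw [← key, hP], rfl⟩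

lemma left_mem_greatCircle (u v : ℍ[ℝ]) : u ∈ greatCircle u v := ⟨1, 0, by norm_num, by simp⟩

lemma right_mem_greatCircle (u v : ℍ[ℝ]) : v ∈ greatCircle u v := ⟨0, 1, by norm_num, by simp⟩

lemma circlePath_mem_greatCircle (u v : ℍ[ℝ]) (x : ℝ) : circlePath u v x ∈ greatCircle u v :=
  ⟨_, _, Real.cos_sq_add_sin_sq _, rfl⟩

lemma exists_circlePath_of_mem_greatCircle {u v P : ℍ[ℝ]} (h : P ∈ greatCircle u v) :
    ∃ x, P = circlePath u v x := by
  obtain ⟨s, t, hst, rfl⟩ := h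
  have hn : ‖(⟨s, t⟩ : ℂ)‖ = 1 := by
    rw [← sq_eq_sq₀ (norm_nonneg _) zero_le_one, ← Complex.normSq_eq_norm_sq,
      Complex.normSq_apply]
    linarith
  have hz : (⟨s, t⟩ : ℂ) ≠ 0 := by
    intro h0; rw [h0] at hn; simp at hn
  refine ⟨Complex.arg ⟨s, t⟩ / (2 * Real.pi), ?_⟩
  have : 2 * Real.pi * (Complex.arg ⟨s, t⟩ / (2 * Real.pi)) = Complex.arg ⟨s, t⟩ := by
    field_simp
  rw [circlePath, this, Complex.cos_arg hz, Complex.sin_arg, hn]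
  simp

/-- Change of the orthonormal basis of the plane of a circle: the phase is shifted, and changes
its sign if the bases have different orientations. -/
lemma exists_circlePath_eq_of_orthonormal {p q u v : ℍ[ℝ]} (h : Orthonormal ℝ ![p, q])
    (h' : Orthonormal ℝ ![u, v]) (hu : u ∈ greatCircle p q) (hv : v ∈ greatCircle p q) :
    ∃ (ε : ℤ) (a : ℝ), (ε = 1 ∨ ε = -1) ∧
      ∀ x, circlePath p q x = circlePath u v (ε * x + a) := by
  obtain ⟨h1, h2, h3⟩ := orthonormal_two_iff.mp h
  obtain ⟨-, -, h3'⟩ := orthonormal_two_iff.mp h'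
  obtain ⟨a, rfl⟩ := exists_circlePath_of_mem_greatCircle hu
  obtain ⟨s, t, hst, rfl⟩ := hv
  have hcs := Real.cos_sq_add_sin_sq (2 * Real.pi * a)
  set C := Real.cos (2 * Real.pi * a) with hC
  set S := Real.sin (2 * Real.pi * a) with hS
  have h0 : C * s + S * t = 0 := by
    rw [← h3', circlePath]
    simp only [inner_add_right, inner_add_left, inner_smul_right, inner_smul_left,
      RCLike.conj_to_real, h1, h2, h3, real_inner_comm p q, ← hC, ← hS]
    ring
  obtain ⟨ε, hε, hs, ht⟩ : ∃ ε : ℤ, (ε = 1 ∨ ε = -1) ∧ s = - ε * S ∧ t = ε * C := by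
    have hk : (C * t - S * s) ^ 2 = 1 := by
      linear_combination (s ^ 2 + t ^ 2) * hcs + hst - (C * s + S * t) * h0
    have hs : s = - (C * t - S * s) * S := by linear_combination (-s) * hcs + C * h0
    have ht : t = (C * t - S * s) * C := by linear_combination (-t) * hcs + S * h0
    rcases sq_eq_one_iff.mp hk with hk | hk
    · exact ⟨1, Or.inl rfl, by rw [hs, hk]; simp, by rw [ht, hk]; simp⟩
    · exact ⟨-1, Or.inr rfl, by rw [hs, hk]; simp, by rw [ht, hk]; simp⟩
  rcases hε with rfl | rfl
  · refine ⟨1, -a, Or.inl rfl, fun x => ?_⟩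
    rw [hs, ht]
    simp only [circlePath, ← hC, ← hS, mul_add, mul_neg, Real.cos_add, Real.sin_add, Real.cos_neg,
      Real.sin_neg, Int.cast_one, one_mul]
    match_scalars
    · linear_combination (-Real.cos (2 * Real.pi * x)) * hcs
    · linear_combination (-Real.sin (2 * Real.pi * x)) * hcs
  · refine ⟨-1, a, Or.inr rfl, fun x => ?_⟩
    rw [hs, ht]
    simp only [circlePath, ← hC, ← hS, mul_add, Real.cos_add, Real.sin_add, Real.cos_neg,
      Real.sin_neg, Int.cast_neg, Int.cast_one, neg_mul, mul_neg, one_mul]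
    match_scalars
    · linear_combination (-Real.cos (2 * Real.pi * x)) * hcs
    · linear_combination (-Real.sin (2 * Real.pi * x)) * hcs

/-- A product of two circles can be written in any orthonormal basis `u, v, n, n'` for which `u, v`
span the plane of the first circle. -/
lemma CircleProduct.exists_rebase {f : ℂ → ℍ[ℝ]} (D : CircleProduct f) {u v n : ℍ[ℝ]}
    (h : Orthonormal ℝ ![u, v, n]) (huv : greatCircle u v = greatCircle D.p D.q) :
    ∃ D' : CircleProduct f, D'.p = u ∧ D'.q = v ∧ D'.p' = n ∧
      (∃ ε : ℤ, (ε = 1 ∨ ε = -1) ∧ ∀ z, D'.φ z = ε * D.φ z) ∧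
      ∃ ε : ℤ, (ε = 1 ∨ ε = -1) ∧ ∀ z, D'.φ' z = ε * D.φ' z := by
  obtain ⟨h1, h2, h3, h4, h5, h6, h7, h8, h9, h10⟩ := orthonormal_four_iff.mp D.orthonormal
  obtain ⟨k1, k2, k3, k4, k5, k6⟩ := orthonormal_three_iff.mp h
  have hpq : Orthonormal ℝ ![D.p, D.q] := orthonormal_two_iff.mpr ⟨h1, h2, h5⟩
  have hpq' : Orthonormal ℝ ![D.p', D.q'] := orthonormal_two_iff.mpr ⟨h3, h4, h10⟩
  have huv' : Orthonormal ℝ ![u, v] := orthonormal_two_iff.mpr ⟨k1, k2, k4⟩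
  have hu : u ∈ greatCircle D.p D.q := huv ▸ left_mem_greatCircle u v
  have hv : v ∈ greatCircle D.p D.q := huv ▸ right_mem_greatCircle u v
  obtain ⟨ε, a, hε, ha⟩ := exists_circlePath_eq_of_orthonormal hpq huv' hu hv
  -- the vector `n` is perpendicular to the plane of the first circle
  have hperp : ∀ P ∈ greatCircle u v, inner ℝ P n = (0 : ℝ) := by
    rintro P ⟨s, t, -, rfl⟩
    simp [inner_add_left, inner_smul_left, k5, k6]
  have hpn := hperp D.p (huv ▸ left_mem_greatCircle _ _)
  have hqn := hperp D.q (huv ▸ right_mem_greatCircle _ _)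
  have hn := eq_sum_inner_of_orthonormal D.orthonormal n
  rw [hpn, hqn, zero_smul, zero_smul, zero_add, zero_add] at hn
  set s := inner ℝ D.p' n with hs
  set t := inner ℝ D.q' n with ht
  have hst : s ^ 2 + t ^ 2 = 1 := by
    rw [← k3]
    nth_rewrite 1 [hn]
    rw [inner_add_left, inner_smul_left, inner_smul_left, RCLike.conj_to_real,
      RCLike.conj_to_real, ← hs, ← ht]
    ring
  have hnc : n ∈ greatCircle D.p' D.q' := ⟨s, t, hst, hn⟩
  have hn'c : (-t) • D.p' + s • D.q' ∈ greatCircle D.p' D.q' := ⟨-t, s, by linarith, rfl⟩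
  have hnn' : Orthonormal ℝ ![n, (-t) • D.p' + s • D.q'] := by
    rw [orthonormal_two_iff]
    refine ⟨k3, ?_, ?_⟩
    · simp only [inner_add_right, inner_add_left, inner_smul_right, inner_smul_left,
        RCLike.conj_to_real, h3, h4, h10, real_inner_comm D.p' D.q']
      linear_combination hst
    · rw [inner_add_right, inner_smul_right, inner_smul_right, real_inner_comm, ← hs,
        real_inner_comm, ← ht]
      ring
  obtain ⟨ε', a', hε', ha'⟩ := exists_circlePath_eq_of_orthonormal hpq' hnn' hnc hn'c
  have hne : ∀ ε : ℤ, (ε = 1 ∨ ε = -1) → (ε : ℝ) ≠ 0 := by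
    rintro ε (rfl | rfl) <;> norm_num
  have horth : ∀ P ∈ greatCircle D.p D.q, ∀ Q ∈ greatCircle D.p' D.q',
      inner ℝ P Q = (0 : ℝ) := by
    rintro P ⟨s₁, t₁, -, rfl⟩ Q ⟨s₂, t₂, -, rfl⟩
    simp [inner_add_left, inner_smul_left, inner_add_right, inner_smul_right, h6, h7, h8, h9]
  refine ⟨{ p := u, q := v, p' := n, q' := (-t) • D.p' + s • D.q'
            orthonormal := ?_
            r := D.r, r' := D.r', r_pos := D.r_pos, r'_pos := D.r'_pos
            φ := (ε : ℝ) • D.φ, φ' := (ε' : ℝ) • D.φ'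
            c := ε * D.c + a, c' := ε' * D.c' + a'
            eq_zero := ?_
            eq_add := ?_ }, rfl, rfl, rfl, ⟨ε, hε, fun z => rfl⟩, ⟨ε', hε', fun z => rfl⟩⟩
  · obtain ⟨n1, n2, n3⟩ := orthonormal_two_iff.mp hnn'
    exact orthonormal_four_iff.mpr ⟨k1, k2, k3, n2, k4, k5, horth _ hu _ hn'c, k6,
      horth _ hv _ hn'c, n3⟩
  · intro z hz hz'
    exact D.eq_zero z ((mul_eq_zero.mp hz).resolve_left (hne ε hε))
      ((mul_eq_zero.mp hz').resolve_left (hne ε' hε'))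
  · intro z
    rw [D.eq_add z, ha, ha']
    simp only [LinearMap.smul_apply, smul_eq_mul, mul_add, add_assoc]

/-! ### Lattices of periods and coverings -/

namespace CircleProduct

variable {f : ℂ → ℍ[ℝ]} (D : CircleProduct f)

/-- The lattice `L` consists of the periods with phases `(i, j) ∈ ℤ²` that satisfy the congruence
`α i + α' j ≡ 0` modulo `ℓ`. -/
def IsCongruenceLattice (L : AddSubgroup ℂ) (α α' : ℤ) (ℓ : ℕ) : Prop :=
  ∀ γ, γ ∈ L ↔ ∃ i j : ℤ, D.φ γ = i ∧ D.φ' γ = j ∧ (ℓ : ℤ) ∣ α * i + α' * j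

variable {D} in
lemma IsCongruenceLattice.swap {L : AddSubgroup ℂ} {α α' : ℤ} {ℓ : ℕ}
    (h : D.IsCongruenceLattice L α α' ℓ) : D.swap.IsCongruenceLattice L α' α ℓ := by
  intro γ
  rw [h γ]
  constructor
  · rintro ⟨i, j, hi, hj, hd⟩
    exact ⟨j, i, hj, hi, by rwa [add_comm]⟩
  · rintro ⟨i, j, hi, hj, hd⟩
    exact ⟨j, i, hj, hi, by rwa [add_comm]⟩

/-- The points of the plane with integral phases. -/
def intPoint : ℤ × ℤ →+ ℂ where
  toFun x := D.point x.1 x.2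
  map_zero' := by simp [point]
  map_add' x y := D.ext_phase (by simp) (by simp)

lemma intPoint_apply (x : ℤ × ℤ) : D.intPoint x = D.point x.1 x.2 := rfl

lemma mem_closure_point_iff (γ : ℂ) : γ ∈ AddSubgroup.closure {D.point 1 0, D.point 0 1} ↔
    (∃ i : ℤ, D.φ γ = i) ∧ ∃ j : ℤ, D.φ' γ = j := by
  rw [AddSubgroup.mem_closure_pair]
  constructor
  · rintro ⟨i, j, rfl⟩
    exact ⟨⟨i, by simp [-zsmul_eq_mul]⟩, j, by simp [-zsmul_eq_mul]⟩
  · rintro ⟨⟨i, hi⟩, j, hj⟩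
    exact ⟨i, j, D.ext_phase (by simp [-zsmul_eq_mul, hi]) (by simp [-zsmul_eq_mul, hj])⟩

lemma mem_closure_iff_intPoint (γ : ℂ) : γ ∈ AddSubgroup.closure {D.point 1 0, D.point 0 1} ↔
    ∃ x, D.intPoint x = γ := by
  rw [mem_closure_point_iff]
  constructor
  · rintro ⟨⟨i, hi⟩, j, hj⟩
    exact ⟨(i, j), D.ext_phase (by simp [intPoint_apply, hi]) (by simp [intPoint_apply, hj])⟩
  · rintro ⟨x, rfl⟩
    exact ⟨⟨x.1, by simp [intPoint_apply]⟩, x.2, by simp [intPoint_apply]⟩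

lemma linearIndependent_point (a b : ℝ) (ha : a ≠ 0) (hb : b ≠ 0) :
    LinearIndependent ℝ ![D.point a 0, D.point 0 b] := by
  rw [LinearIndependent.pair_iff]
  intro s t h
  have h1 := congrArg D.φ h
  have h2 := congrArg D.φ' h
  rw [map_add, map_smul, map_smul, map_zero, φ_point, φ_point] at h1
  rw [map_add, map_smul, map_smul, map_zero, φ'_point, φ'_point] at h2
  simpa [ha, hb] using And.intro h1 h2

lemma continuous_φ : Continuous D.φ := D.φ.continuous_of_finiteDimensional

lemma continuous_φ' : Continuous D.φ' := D.φ'.continuous_of_finiteDimensional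

lemma continuous_point : Continuous fun x : ℝ × ℝ => D.point x.1 x.2 := by
  unfold point
  fun_prop

lemma continuous_f {f : ℂ → ℍ[ℝ]} (D : CircleProduct f) : Continuous f := by
  have h : f = fun z => D.r • circlePath D.p D.q (D.φ z + D.c) +
    D.r' • circlePath D.p' D.q' (D.φ' z + D.c') := funext D.eq_add
  have h1 := D.continuous_φ
  have h2 := D.continuous_φ'
  rw [h]
  unfold circlePath
  fun_prop

/-- Every point is congruent to a point of the compact fundamental parallelogram. -/
lemma compactSpace_quotient (L : AddSubgroup ℂ)
    (hL : AddSubgroup.closure {D.point 1 0, D.point 0 1} ≤ L) : CompactSpace (ℂ ⧸ L) := by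
  have hK : IsCompact ((fun x : ℝ × ℝ => (QuotientAddGroup.mk (D.point x.1 x.2) : ℂ ⧸ L)) ''
      (Set.Icc 0 1 ×ˢ Set.Icc 0 1)) :=
    (isCompact_Icc.prod isCompact_Icc).image (continuous_quot_mk.comp D.continuous_point)
  refine ⟨hK.of_isClosed_subset isClosed_univ ?_⟩
  intro y _
  induction y using QuotientAddGroup.induction_on with | _ z => ?_
  refine ⟨(Int.fract (D.φ z), Int.fract (D.φ' z)), ⟨⟨Int.fract_nonneg _, (Int.fract_lt_one _).le⟩,
    Int.fract_nonneg _, (Int.fract_lt_one _).le⟩, ?_⟩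
  refine (QuotientAddGroup.eq).mpr (hL ((D.mem_closure_point_iff _).mpr ⟨⟨⌊D.φ z⌋, ?_⟩,
    ⌊D.φ' z⌋, ?_⟩))
  · simp [-Int.self_sub_floor, Int.fract]
  · simp [-Int.self_sub_floor, Int.fract]

/-- A congruence lattice is closed, being the preimage of a set of integral phases. -/
lemma IsCongruenceLattice.isClosed {L : AddSubgroup ℂ} {α α' : ℤ} {ℓ : ℕ}
    (h : D.IsCongruenceLattice L α α' ℓ) : IsClosed (L : Set ℂ) := by
  have h1 : (L : Set ℂ) = (fun z => (D.φ z, D.φ' z)) ⁻¹'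
      (Prod.map ((↑) : ℤ → ℝ) ((↑) : ℤ → ℝ) '' {x | (ℓ : ℤ) ∣ α * x.1 + α' * x.2}) := by
    ext γ
    rw [SetLike.mem_coe, h γ]
    constructor
    · rintro ⟨i, j, hi, hj, hd⟩
      exact ⟨(i, j), hd, by simp [hi, hj]⟩
    · rintro ⟨⟨i, j⟩, hd, he⟩
      simp only [Prod.map_apply, Prod.mk.injEq] at he
      exact ⟨i, j, he.1.symm, he.2.symm, hd⟩
  rw [h1]
  exact ((Int.isClosedEmbedding_coe_real.prodMap Int.isClosedEmbedding_coe_real).isClosedMap _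
    (isClosed_discrete _)).preimage (D.continuous_φ.prodMk D.continuous_φ')

end CircleProduct

lemma exists_bezout_of_gcd_eq_one {ℓ : ℕ} {α α' : ℤ}
    (h : Nat.gcd (Nat.gcd ℓ α.natAbs) α'.natAbs = 1) :
    ∃ x y z : ℤ, ℓ * x + α * y + α' * z = 1 := by
  have h1 := Int.gcd_eq_gcd_ab (ℓ : ℤ) α
  have h2 := Int.gcd_eq_gcd_ab (Int.gcd (ℓ : ℤ) α : ℤ) α'
  have h3 : Int.gcd (Int.gcd (ℓ : ℤ) α : ℤ) α' = 1 := by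
    simpa [Int.gcd_def] using h
  rw [h3] at h2
  generalize Int.gcdA (Int.gcd (ℓ : ℤ) α : ℤ) α' = a at h2
  generalize Int.gcdB (Int.gcd (ℓ : ℤ) α : ℤ) α' = b at h2
  rw [h1] at h2
  exact ⟨Int.gcdA ℓ α * a, Int.gcdB ℓ α * a, b, by push_cast at h2; linear_combination -h2⟩

namespace CircleProduct

variable {f : ℂ → ℍ[ℝ]} (D : CircleProduct f)

/-- A primitive congruence modulo `ℓ` defines a sublattice of index `ℓ`. -/
lemma card_ker_map {L L' : AddSubgroup ℂ} {α α' : ℤ} {ℓ : ℕ} (hℓ : 0 < ℓ)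
    (hL : D.IsCongruenceLattice L α α' ℓ)
    (hcop : Nat.gcd (Nat.gcd ℓ α.natAbs) α'.natAbs = 1)
    (hL' : L' = AddSubgroup.closure {D.point 1 0, D.point 0 1}) (h : L ≤ L') :
    Nat.card (QuotientAddGroup.map L L' (AddMonoidHom.id ℂ) h).ker = ℓ := by
  have : NeZero ℓ := ⟨hℓ.ne'⟩
  let χ : ℤ × ℤ →+ ZMod ℓ :=
    { toFun := fun x => ((α * x.1 + α' * x.2 : ℤ) : ZMod ℓ)
      map_zero' := by simp
      map_add' := fun x y => by push_cast [Prod.fst_add, Prod.snd_add]; ring }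
  have hχ : Function.Surjective χ := by
    intro y
    obtain ⟨a, b, c, habc⟩ := exists_bezout_of_gcd_eq_one hcop
    obtain ⟨k, rfl⟩ := ZMod.intCast_surjective y
    refine ⟨(b * k, c * k), ?_⟩
    change ((α * (b * k) + α' * (c * k) : ℤ) : ZMod ℓ) = k
    rw [ZMod.intCast_eq_intCast_iff_dvd_sub]
    exact ⟨a * k, by linear_combination (-k) * habc⟩
  let ψ : ℤ × ℤ →+ ℂ ⧸ L := (QuotientAddGroup.mk' L).comp D.intPoint
  have hker : ψ.ker = χ.ker := by
    ext x
    rw [AddMonoidHom.mem_ker, AddMonoidHom.mem_ker]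
    change (QuotientAddGroup.mk (D.intPoint x) : ℂ ⧸ L) = 0 ↔
      ((α * x.1 + α' * x.2 : ℤ) : ZMod ℓ) = 0
    rw [QuotientAddGroup.eq_zero_iff, hL, ZMod.intCast_zmod_eq_zero_iff_dvd]
    constructor
    · rintro ⟨i, j, hi, hj, hd⟩
      rw [D.intPoint_apply, φ_point, Int.cast_inj] at hi
      rw [D.intPoint_apply, φ'_point, Int.cast_inj] at hj
      rwa [hi, hj]
    · intro hd
      exact ⟨x.1, x.2, by simp [intPoint_apply], by simp [intPoint_apply], hd⟩
  have hrange : ψ.range = (QuotientAddGroup.map L L' (AddMonoidHom.id ℂ) h).ker := by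
    ext y
    induction y using QuotientAddGroup.induction_on with | _ z => ?_
    rw [AddMonoidHom.mem_ker, AddMonoidHom.mem_range]
    change _ ↔ (QuotientAddGroup.mk z : ℂ ⧸ L') = 0
    rw [QuotientAddGroup.eq_zero_iff, hL', mem_closure_iff_intPoint]
    constructor
    · rintro ⟨x, hx⟩
      have h1 : -(D.intPoint x) + z ∈ L := QuotientAddGroup.eq.mp hx
      obtain ⟨y, hy⟩ := (D.mem_closure_iff_intPoint _).mp (hL' ▸ h h1)
      exact ⟨x + y, by rw [map_add, hy]; ring⟩
    · rintro ⟨x, rfl⟩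
      exact ⟨x, rfl⟩
  rw [← hrange, ← AddSubgroup.index_ker, hker, AddSubgroup.index_ker,
    AddMonoidHom.range_eq_top.mpr hχ]
  simp

end CircleProduct

/-- The projection between the quotients by two lattices with finite quotient is a covering, whose
number of sheets is the order of its kernel. -/
lemma isCoveringMap_quotient_map {L L' : AddSubgroup ℂ} (h : L ≤ L') (hL : IsClosed (L : Set ℂ))
    {ℓ : ℕ} (hℓ : 0 < ℓ)
    (hcard : Nat.card (QuotientAddGroup.map L L' (AddMonoidHom.id ℂ) h).ker = ℓ) :
    IsCoveringMap (QuotientAddGroup.map L L' (AddMonoidHom.id ℂ) h) ∧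
    ∀ y : ℂ ⧸ L',
      Nat.card {x // QuotientAddGroup.map L L' (AddMonoidHom.id ℂ) h x = y} = ℓ := by
  set π := QuotientAddGroup.map L L' (AddMonoidHom.id ℂ) h with hπ
  have hsurj : Function.Surjective π := by
    intro y
    induction y using QuotientAddGroup.induction_on with | _ z => ?_
    exact ⟨QuotientAddGroup.mk z, rfl⟩
  constructor
  · have hquot : Topology.IsQuotientMap π := by
      have h1 : Topology.IsQuotientMap (QuotientAddGroup.mk : ℂ → ℂ ⧸ L') :=
        isQuotientMap_quotient_mk'
      have hc : Continuous π := by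
        refine (isQuotientMap_quotient_mk' : Topology.IsQuotientMap
          (QuotientAddGroup.mk : ℂ → ℂ ⧸ L)).continuous_iff.mpr ?_
        exact continuous_quot_mk
      exact Topology.IsQuotientMap.of_comp (f := (QuotientAddGroup.mk : ℂ → ℂ ⧸ L))
        continuous_quot_mk hc h1
    have : Finite π.ker := Nat.finite_of_card_ne_zero (by rw [hcard]; exact hℓ.ne')
    -- as `L` is closed, its quotient is Hausdorff, and the finite kernel is discrete
    exact (hquot.isAddQuotientCoveringMap_of_isDiscrete_ker_addMonoidHom
      (Set.Finite.isDiscrete (Set.toFinite _))).isCoveringMap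
  · intro y
    rw [← hcard]
    exact Nat.card_congr (AddMonoidHom.fiberEquivKerOfSurjective hsurj y)

/-- The torus with the same immersion whose lattice is the full lattice of periods. -/
def CircleProduct.fullTorus {T : FlatCMCTorus} (D : CircleProduct T.immersion) : FlatCMCTorus where
  immersion := T.immersion
  isFlatCMC := T.isFlatCMC
  lattice := AddSubgroup.closure {D.point 1 0, D.point 0 1}
  isLattice := ⟨_, _, D.linearIndependent_point 1 1 one_ne_zero one_ne_zero, rfl⟩
  periodic γ hγ := (D.isPeriod_iff γ).mpr ((D.mem_closure_point_iff γ).mp hγ)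

/-- The full period torus is embedded, being compact and mapped injectively. -/
lemma CircleProduct.isEmbedded_fullTorus {T : FlatCMCTorus} (D : CircleProduct T.immersion) :
    D.fullTorus.IsEmbedded := by
  have : CompactSpace (ℂ ⧸ D.fullTorus.lattice) := D.compactSpace_quotient _ le_rfl
  refine (Continuous.isClosedEmbedding ?_ ?_).isEmbedding
  · exact D.continuous_f.quotient_lift _
  · intro x y hxy
    induction x using QuotientAddGroup.induction_on with | _ z => ?_
    induction y using QuotientAddGroup.induction_on with | _ w => ?_
    have h1 : T.immersion w = T.immersion z := hxy.symm
    refine QuotientAddGroup.eq.mpr ((D.mem_closure_point_iff _).mpr ?_)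
    simpa [neg_add_eq_sub] using (D.apply_eq_iff w z).mp h1

/-! ### Profile curves -/

namespace CircleProduct

variable {T : FlatCMCTorus} (D : CircleProduct T.immersion)

/-- The image in the torus of the line on which the second phase equals the integer `j`. -/
def profileLine (j : ℤ) : Set (ℂ ⧸ T.lattice) :=
  QuotientAddGroup.mk '' {z : ℂ | D.φ' z + D.c' = j}

/-- The line on which the second phase is `j`, in the parametrization that has first phase `w t`. -/
def lineParam (w : ℕ) (j : ℤ) (t : ℝ) : ℂ := D.point (w * t - D.c) (j - D.c')

lemma profileLine_eq_range {w : ℕ} (hw : 0 < w) (j : ℤ) : D.profileLine j =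
    Set.range fun t => (QuotientAddGroup.mk (D.lineParam w j t) : ℂ ⧸ T.lattice) := by
  have hw' : (w : ℝ) ≠ 0 := by exact_mod_cast hw.ne'
  ext y
  constructor
  · rintro ⟨z, hz, rfl⟩
    refine ⟨(D.φ z + D.c) / w, congrArg _ (D.ext_phase ?_ ?_)⟩
    · rw [lineParam, φ_point]; field_simp; ring
    · rw [lineParam, φ'_point]
      have : D.φ' z + D.c' = j := hz
      linarith
  · rintro ⟨t, rfl⟩
    refine ⟨_, ?_, rfl⟩
    change D.φ' _ + D.c' = j
    rw [lineParam, φ'_point]; ring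

lemma hasDerivAt_lineParam (w : ℕ) (j : ℤ) (t : ℝ) :
    HasDerivAt (D.lineParam w j) ((w : ℝ) • D.coords.symm (1, 0)) t := by
  have h : HasDerivAt (fun t : ℝ => (w : ℝ) * t - D.c) (w : ℝ) t := by
    simpa using ((hasDerivAt_id t).const_mul (w : ℝ)).sub_const D.c
  exact (h.smul_const _).add_const _

lemma contDiff_lineParam (w : ℕ) (j : ℤ) : ContDiff ℝ ∞ (D.lineParam w j) := by
  unfold lineParam point
  fun_prop

/-- Along the line the surface runs through a circle parallel to the first one. -/
lemma apply_lineParam (w : ℕ) (j : ℤ) (t : ℝ) : T.immersion (D.lineParam w j t) =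
    D.r' • D.p' + (D.r * Real.cos (2 * Real.pi * w * t)) • D.p +
      (D.r * Real.sin (2 * Real.pi * w * t)) • D.q := by
  rw [D.eq_add, lineParam, φ_point, φ'_point, sub_add_cancel, sub_add_cancel, circlePath_int,
    circlePath, ← mul_assoc]
  module

lemma mem_profileSet_iff (z : ℂ) :
    (QuotientAddGroup.mk z : ℂ ⧸ T.lattice) ∈ T.profileSet D.p D.q D.p' ↔
      ∃ j : ℤ, D.φ' z + D.c' = j :=
  D.apply_mem_hemisphere_iff T.isFlatCMC.norm_one z

section Lattice

variable {D} {α α' : ℤ} {ℓ : ℕ} (hL : D.IsCongruenceLattice T.lattice α α' ℓ)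
  (hcop : Nat.gcd (Nat.gcd ℓ α.natAbs) α'.natAbs = 1)

include hL hcop in
/-- The second phase of a lattice point is divisible by `gcd ℓ α`. -/
lemma IsCongruenceLattice.exists_phase_eq_mul {γ : ℂ} (hγ : γ ∈ T.lattice) :
    ∃ k : ℤ, D.φ' γ = k * (Nat.gcd ℓ α.natAbs : ℕ) := by
  obtain ⟨i, j, -, hj, hd⟩ := (hL γ).mp hγ
  have h1 : ((Nat.gcd ℓ α.natAbs : ℕ) : ℤ) ∣ α' * j := by
    have h2 : ((Nat.gcd ℓ α.natAbs : ℕ) : ℤ) ∣ α * i :=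
      (Int.natCast_dvd.mpr (Nat.gcd_dvd_right _ _)).mul_right i
    have h3 : ((Nat.gcd ℓ α.natAbs : ℕ) : ℤ) ∣ α * i + α' * j :=
      (Int.natCast_dvd_natCast.mpr (Nat.gcd_dvd_left _ _)).trans hd
    exact (dvd_add_right h2).mp h3
  have h4 : IsCoprime ((Nat.gcd ℓ α.natAbs : ℕ) : ℤ) α' := by
    rw [Int.isCoprime_iff_gcd_eq_one, Int.gcd_def]
    simpa using hcop
  obtain ⟨k, hk⟩ := h4.dvd_of_dvd_mul_left h1
  exact ⟨k, by rw [hj, hk]; push_cast; ring⟩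

include hL in
/-- The second phase of a lattice point can be equal to `gcd ℓ α`. -/
lemma IsCongruenceLattice.exists_phase_eq_gcd :
    ∃ γ ∈ T.lattice, D.φ' γ = (Nat.gcd ℓ α.natAbs : ℕ) := by
  have h1 := Int.gcd_eq_gcd_ab (ℓ : ℤ) α
  have h2 : Int.gcd (ℓ : ℤ) α = Nat.gcd ℓ α.natAbs := by simp [Int.gcd_def]
  rw [h2] at h1
  generalize Int.gcdA (ℓ : ℤ) α = x at h1
  generalize Int.gcdB (ℓ : ℤ) α = y at h1
  refine ⟨D.point ((-(y * α') : ℤ) : ℝ) (((Nat.gcd ℓ α.natAbs : ℕ) : ℤ) : ℝ),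
    (hL _).mpr ⟨_, _, D.φ_point _ _, D.φ'_point _ _, ?_⟩, by simp⟩
  rw [h1]
  exact ⟨x * α', by ring⟩

include hL in
/-- The lattice points on the line of vanishing second phase have first phase divisible by
`ℓ / gcd ℓ α`. -/
lemma IsCongruenceLattice.point_mem_iff (hℓ : 0 < ℓ) (t : ℝ) :
    D.point ((ℓ / Nat.gcd ℓ α.natAbs : ℕ) * t) 0 ∈ T.lattice ↔ ∃ k : ℤ, t = k := by
  have hg : 0 < Nat.gcd ℓ α.natAbs := Nat.gcd_pos_of_pos_left _ hℓ
  obtain ⟨w, hw⟩ := Nat.gcd_dvd_left ℓ α.natAbs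
  obtain ⟨a, ha⟩ := Nat.gcd_dvd_right ℓ α.natAbs
  set g := Nat.gcd ℓ α.natAbs with hgdef
  have hwℓ : ℓ / g = w := by
    conv_lhs => rw [hw]
    exact Nat.mul_div_cancel_left _ hg
  have hw0 : 0 < w := by
    rcases Nat.eq_zero_or_pos w with h | h
    · rw [h] at hw; omega
    · exact h
  have hcop : Nat.Coprime w a := by
    have h2 : Nat.gcd (g * w) (g * a) = g := by rw [← hw, ← ha]
    rw [Nat.gcd_mul_left] at h2
    exact Nat.eq_of_mul_eq_mul_left hg (by rw [mul_one]; exact h2)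
  have key : ∀ n : ℤ, (ℓ : ℤ) ∣ α * n ↔ (w : ℤ) ∣ n := by
    intro n
    rw [← Int.natAbs_dvd_natAbs, ← Int.natAbs_dvd_natAbs, Int.natAbs_mul, Int.natAbs_natCast,
      Int.natAbs_natCast, ha]
    conv_lhs => rw [hw]
    rw [mul_assoc, Nat.mul_dvd_mul_iff_left hg]
    exact hcop.dvd_mul_left
  rw [hL, hwℓ]
  constructor
  · rintro ⟨i, j, hi, hj, hd⟩
    rw [φ_point] at hi
    rw [φ'_point] at hj
    have hj0 : j = 0 := by exact_mod_cast hj.symm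
    rw [hj0, mul_zero, add_zero, key] at hd
    obtain ⟨k, rfl⟩ := hd
    refine ⟨k, ?_⟩
    have hw' : (w : ℝ) ≠ 0 := by exact_mod_cast hw0.ne'
    push_cast at hi
    exact mul_left_cancel₀ hw' hi
  · rintro ⟨k, rfl⟩
    refine ⟨w * k, 0, by simp, by simp, ?_⟩
    rw [mul_zero, add_zero, key]
    exact dvd_mul_right _ _

include hL hcop in
lemma IsCongruenceLattice.dvd_of_mem_profileLine {j j' : ℤ} {y : ℂ ⧸ T.lattice}
    (h : y ∈ D.profileLine j) (h' : y ∈ D.profileLine j') :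
    ((Nat.gcd ℓ α.natAbs : ℕ) : ℤ) ∣ j - j' := by
  obtain ⟨z, hz, rfl⟩ := h
  obtain ⟨z', hz', he⟩ := h'
  obtain ⟨k, hk⟩ := hL.exists_phase_eq_mul hcop (QuotientAddGroup.eq.mp he)
  have h1 : D.φ' z + D.c' = j := hz
  have h2 : D.φ' z' + D.c' = j' := hz'
  rw [map_add, map_neg] at hk
  refine ⟨k, ?_⟩
  have : ((j - j' : ℤ) : ℝ) = (((Nat.gcd ℓ α.natAbs : ℕ) : ℤ) * k : ℤ) := by
    push_cast; linarith
  exact_mod_cast this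

include hL in
lemma IsCongruenceLattice.profileLine_subset {j j' : ℤ}
    (h : ((Nat.gcd ℓ α.natAbs : ℕ) : ℤ) ∣ j - j') : D.profileLine j ⊆ D.profileLine j' := by
  obtain ⟨k, hk⟩ := h
  obtain ⟨γ, hγ, hγ'⟩ := hL.exists_phase_eq_gcd
  rintro _ ⟨z, hz, rfl⟩
  have hz' : D.φ' z + D.c' = j := hz
  refine ⟨z - k • γ, ?_, QuotientAddGroup.eq.mpr ?_⟩
  · change D.φ' _ + D.c' = j'
    rw [map_sub, map_zsmul, hγ', zsmul_eq_mul]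
    have : ((j - j' : ℤ) : ℝ) = (((Nat.gcd ℓ α.natAbs : ℕ) : ℤ) * k : ℤ) := by rw [hk]
    push_cast at this
    linarith
  · rw [show -(z - k • γ) + z = k • γ by ring]
    exact T.lattice.zsmul_mem hγ k

include hL in
lemma IsCongruenceLattice.profileLine_eq {j j' : ℤ}
    (h : ((Nat.gcd ℓ α.natAbs : ℕ) : ℤ) ∣ j - j') : D.profileLine j = D.profileLine j' :=
  (hL.profileLine_subset h).antisymm (hL.profileLine_subset (by rwa [← neg_sub, dvd_neg] at h))

include hL hcop in
/-- The components of the profile curve set are the images of the lines. Two lines with second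
phases that are incongruent modulo `gcd ℓ α` are separated by the second phase, a continuous
function on the torus with values modulo `gcd ℓ α` and finitely many values on the profile set. -/
lemma IsCongruenceLattice.connectedComponentIn_eq (hℓ : 0 < ℓ) {x : ℂ ⧸ T.lattice} {j : ℤ}
    (hx : x ∈ D.profileLine j) :
    connectedComponentIn (T.profileSet D.p D.q D.p') x = D.profileLine j := by
  have hg : 0 < Nat.gcd ℓ α.natAbs := Nat.gcd_pos_of_pos_left _ hℓ
  set g := Nat.gcd ℓ α.natAbs with hgdef
  have hsub : D.profileLine j ⊆ T.profileSet D.p D.q D.p' := by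
    rintro _ ⟨z, hz, rfl⟩
    exact (D.mem_profileSet_iff z).mpr ⟨j, hz⟩
  apply Set.Subset.antisymm
  · let θ : ℂ ⧸ T.lattice →+ AddCircle (g : ℝ) :=
      QuotientAddGroup.lift T.lattice ((QuotientAddGroup.mk' _).comp D.φ'.toAddMonoidHom) (by
        intro γ hγ
        obtain ⟨k, hk⟩ := hL.exists_phase_eq_mul hcop hγ
        refine (QuotientAddGroup.eq_zero_iff _).mpr ?_
        exact AddSubgroup.mem_zmultiples_iff.mpr ⟨k, by rw [zsmul_eq_mul]; exact hk.symm⟩)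
    have hθ : ∀ z : ℂ, θ (QuotientAddGroup.mk z) = ((D.φ' z : ℝ) : AddCircle (g : ℝ)) :=
      fun z => rfl
    have hθc : Continuous θ := by
      refine (isQuotientMap_quotient_mk' : Topology.IsQuotientMap
        (QuotientAddGroup.mk : ℂ → ℂ ⧸ T.lattice)).continuous_iff.mpr ?_
      exact continuous_quot_mk.comp D.continuous_φ'
    have hfin : (θ '' connectedComponentIn (T.profileSet D.p D.q D.p') x).Finite := by
      refine (Set.Finite.image (fun k : ℕ => ((k - D.c' : ℝ) : AddCircle (g : ℝ)))
        (Set.finite_Iio g)).subset ?_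
      rintro _ ⟨y, hy, rfl⟩
      have hyP := connectedComponentIn_subset _ _ hy
      induction y using QuotientAddGroup.induction_on with | _ z => ?_
      obtain ⟨j', hj'⟩ := (D.mem_profileSet_iff z).mp hyP
      have hmod := Int.emod_nonneg j' (b := (g : ℤ)) (by omega)
      refine ⟨(j' % (g : ℤ)).toNat, ?_, ?_⟩
      · have := Int.emod_lt_of_pos j' (b := (g : ℤ)) (by omega)
        rw [Set.mem_Iio]; omega
      · refine QuotientAddGroup.eq.mpr (AddSubgroup.mem_zmultiples_iff.mpr ⟨j' / g, ?_⟩)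
        have h1 : (((j' % (g : ℤ)).toNat : ℕ) : ℝ) = ((j' % (g : ℤ) : ℤ) : ℝ) := by
          exact_mod_cast congrArg (Int.cast : ℤ → ℝ) (Int.toNat_of_nonneg hmod)
        have h2 : ((j' % (g : ℤ) : ℤ) : ℝ) + g * ((j' / g : ℤ) : ℝ) = j' := by
          exact_mod_cast Int.emod_add_mul_ediv j' g
        change (j' / (g : ℤ)) • (g : ℝ) = -((((j' % (g : ℤ)).toNat : ℕ) : ℝ) - D.c') + D.φ' z
        rw [zsmul_eq_mul, h1]
        linarith
    have hsing : (θ '' connectedComponentIn (T.profileSet D.p D.q D.p') x).Subsingleton := by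
      by_contra hns
      exact (isPreconnected_connectedComponentIn.image θ hθc.continuousOn).infinite_of_nontrivial
        (Set.not_subsingleton_iff.mp hns) hfin
    intro y hy
    have hxy := hsing ⟨y, hy, rfl⟩ ⟨x, mem_connectedComponentIn (hsub hx), rfl⟩
    have hyP := connectedComponentIn_subset _ _ hy
    induction y using QuotientAddGroup.induction_on with | _ z => ?_
    obtain ⟨j', hj'⟩ := (D.mem_profileSet_iff z).mp hyP
    obtain ⟨z₀, hz₀, rfl⟩ := hx
    have hz₀' : D.φ' z₀ + D.c' = j := hz₀
    rw [hθ, hθ] at hxy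
    obtain ⟨k, hk⟩ := AddSubgroup.mem_zmultiples_iff.mp (QuotientAddGroup.eq.mp hxy)
    rw [zsmul_eq_mul] at hk
    refine hL.profileLine_subset (j := j') ⟨-k, ?_⟩ ⟨z, hj', rfl⟩
    have : ((j' - j : ℤ) : ℝ) = (((g : ℕ) : ℤ) * -k : ℤ) := by
      push_cast; linarith
    exact_mod_cast this
  · refine IsPreconnected.subset_connectedComponentIn ?_ hx hsub
    rw [D.profileLine_eq_range one_pos j]
    exact isPreconnected_range (continuous_quot_mk.comp (D.contDiff_lineParam 1 j).continuous)

include hL hcop in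
/-- The profile curves are represented by the lines whose second phase is one of the residues
modulo `gcd ℓ α`. -/
lemma IsCongruenceLattice.profileComponents_eq (hℓ : 0 < ℓ) :
    T.profileComponents D.p D.q D.p' =
      Set.range fun k : Fin (Nat.gcd ℓ α.natAbs) => D.profileLine (k : ℕ) := by
  have hg : 0 < Nat.gcd ℓ α.natAbs := Nat.gcd_pos_of_pos_left _ hℓ
  ext C
  constructor
  · rintro ⟨x, hx, rfl⟩
    induction x using QuotientAddGroup.induction_on with | _ z => ?_
    obtain ⟨j, hj⟩ := (D.mem_profileSet_iff z).mp hx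
    have h1 := Int.emod_nonneg j (b := ((Nat.gcd ℓ α.natAbs : ℕ) : ℤ)) (by omega)
    have h2 := Int.emod_lt_of_pos j (b := ((Nat.gcd ℓ α.natAbs : ℕ) : ℤ)) (by omega)
    refine ⟨⟨(j % ((Nat.gcd ℓ α.natAbs : ℕ) : ℤ)).toNat, by omega⟩, ?_⟩
    rw [hL.connectedComponentIn_eq hcop hℓ ⟨z, hj, rfl⟩]
    refine hL.profileLine_eq ?_
    rw [Int.toNat_of_nonneg h1]
    exact (Int.mod_modEq j _).symm.dvd
  · rintro ⟨k, rfl⟩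
    have hmem : (QuotientAddGroup.mk (D.lineParam 1 (k : ℕ) 0) : ℂ ⧸ T.lattice) ∈
        D.profileLine (k : ℕ) := by
      rw [D.profileLine_eq_range one_pos]; exact ⟨0, rfl⟩
    refine ⟨_, ?_, (hL.connectedComponentIn_eq hcop hℓ hmem).symm⟩
    obtain ⟨z, hz, he⟩ := hmem
    rw [← he]
    exact (D.mem_profileSet_iff z).mpr ⟨_, hz⟩

include hL hcop in
lemma IsCongruenceLattice.injective_profileLine :
    Function.Injective fun k : Fin (Nat.gcd ℓ α.natAbs) => D.profileLine (k : ℕ) := by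
  intro k k' h
  have hmem : (QuotientAddGroup.mk (D.lineParam 1 (k : ℕ) 0) : ℂ ⧸ T.lattice) ∈
      D.profileLine (k : ℕ) := by
    rw [D.profileLine_eq_range one_pos]; exact ⟨0, rfl⟩
  have h' : D.profileLine (k : ℕ) = D.profileLine (k' : ℕ) := h
  have hd := hL.dvd_of_mem_profileLine hcop hmem (by rw [← h']; exact hmem)
  have h1 := k.2
  have h2 := k'.2
  apply Fin.ext
  have h3 : ((k : ℕ) : ℤ) - ((k' : ℕ) : ℤ) = 0 := by
    refine Int.eq_zero_of_abs_lt_dvd hd ?_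
    rw [abs_lt]; omega
  omega

include hL in
lemma IsCongruenceLattice.isClosedParam (hℓ : 0 < ℓ) (j : ℤ) :
    T.IsClosedParam (D.profileLine j) (D.lineParam (ℓ / Nat.gcd ℓ α.natAbs) j) := by
  have hw : 0 < ℓ / Nat.gcd ℓ α.natAbs :=
    Nat.div_pos (Nat.le_of_dvd hℓ (Nat.gcd_dvd_left _ _)) (Nat.gcd_pos_of_pos_left _ hℓ)
  refine ⟨D.contDiff_lineParam _ _, ?_, ?_, (D.profileLine_eq_range hw j).symm⟩
  · intro t
    rw [(D.hasDerivAt_lineParam _ _ _).deriv]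
    refine smul_ne_zero (by exact_mod_cast hw.ne') ?_
    simp
  · intro s t
    rw [eq_comm, QuotientAddGroup.eq, ← hL.point_mem_iff hℓ]
    have : -D.lineParam (ℓ / Nat.gcd ℓ α.natAbs) j t + D.lineParam (ℓ / Nat.gcd ℓ α.natAbs) j s =
        D.point ((ℓ / Nat.gcd ℓ α.natAbs : ℕ) * (s - t)) 0 :=
      D.ext_phase (by rw [map_add, map_neg, lineParam, lineParam, φ_point, φ_point, φ_point]; ring)
        (by rw [map_add, map_neg, lineParam, lineParam, φ'_point, φ'_point, φ'_point]; ring)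
    rw [this]

end Lattice

/-- In the plane of the stereographic projection the profile circle, centred at the origin, is
traversed `w` times. -/
lemma hasTurningNumber_lineParam {w : ℕ} (hw : 0 < w) (j : ℤ) :
    HasTurningNumber (fun t => stereo D.p D.q D.p' (T.immersion (D.lineParam w j t))) w := by
  obtain ⟨h1, h2, h3, h4, h5, h6, h7, h8, h9, h10⟩ := orthonormal_four_iff.mp D.orthonormal
  set K : ℝ := D.r / (1 + D.r') with hK
  have hK0 : 0 < K := div_pos D.r_pos (by linarith [D.r'_pos])
  have hc : (fun t => stereo D.p D.q D.p' (T.immersion (D.lineParam w j t))) =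
      fun t : ℝ => (K : ℂ) * Complex.exp ((2 * Real.pi * w * t : ℝ) * Complex.I) := by
    funext t
    have e1 : inner ℝ D.p (T.immersion (D.lineParam w j t)) =
        D.r * Real.cos (2 * Real.pi * w * t) := by
      rw [apply_lineParam]
      simp only [inner_add_right, inner_smul_right, h1, h5, h6]
      ring
    have e2 : inner ℝ D.q (T.immersion (D.lineParam w j t)) =
        D.r * Real.sin (2 * Real.pi * w * t) := by
      rw [apply_lineParam]
      simp only [inner_add_right, inner_smul_right, h2, h8, real_inner_comm D.p D.q, h5]
      ring
    have e3 : inner ℝ D.p' (T.immersion (D.lineParam w j t)) = D.r' := by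
      rw [apply_lineParam]
      simp only [inner_add_right, inner_smul_right, h3, real_inner_comm D.p D.p',
        real_inner_comm D.q D.p', h6, h8]
      ring
    rw [stereo, e1, e2, e3, Complex.exp_mul_I, ← Complex.ofReal_cos, ← Complex.ofReal_sin, hK]
    push_cast
    ring
  have hd : ∀ t : ℝ, HasDerivAt
      (fun t : ℝ => (K : ℂ) * Complex.exp ((2 * Real.pi * w * t : ℝ) * Complex.I))
      ((K * (2 * Real.pi * w) : ℝ) *
        Complex.exp (Complex.I * (2 * Real.pi * w * t + Real.pi / 2 : ℝ))) t := by
    intro t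
    have h0 : HasDerivAt (fun t : ℝ => (((2 * Real.pi * w * t : ℝ) : ℂ) * Complex.I))
        (((2 * Real.pi * w : ℝ) : ℂ) * Complex.I) t := by
      have h : HasDerivAt (fun t : ℝ => 2 * Real.pi * w * t) (2 * Real.pi * w) t := by
        simpa using (hasDerivAt_id t).const_mul (2 * Real.pi * w : ℝ)
      exact h.ofReal_comp.mul_const _
    refine ((h0.cexp).const_mul (K : ℂ)).congr_deriv ?_
    rw [Complex.ofReal_add, mul_add, Complex.exp_add]
    have : Complex.I * ((Real.pi / 2 : ℝ) : ℂ) = Real.pi / 2 * Complex.I := by push_cast; ring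
    rw [this, Complex.exp_pi_div_two_mul_I, mul_comm Complex.I]
    push_cast
    ring
  have hpos : 0 < K * (2 * Real.pi * w) := by
    have : (0 : ℝ) < w := by exact_mod_cast hw
    positivity
  rw [hc]
  refine ⟨?_, fun t => 2 * Real.pi * w * t + Real.pi / 2, by fun_prop, ?_, ?_⟩
  · intro t
    change (K : ℂ) * _ = (K : ℂ) * _
    congr 1
    rw [Complex.exp_eq_exp_iff_exists_int]
    exact ⟨w, by push_cast; ring⟩
  · intro t
    rw [(hd t).deriv]
    refine ⟨mul_ne_zero (by exact_mod_cast hpos.ne') (Complex.exp_ne_zero _), ?_⟩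
    rw [norm_mul, Complex.norm_real, Real.norm_of_nonneg hpos.le, mul_comm Complex.I,
      Complex.norm_exp_ofReal_mul_I, mul_one]
  · have : (0 : ℝ) ≤ 2 * Real.pi * w := by positivity
    rw [show 2 * Real.pi * w * 1 + Real.pi / 2 - (2 * Real.pi * w * 0 + Real.pi / 2) =
      2 * Real.pi * w by ring, abs_of_nonneg this]

/-- The profile curves of a product of two circles, with respect to the first circle. -/
lemma IsCongruenceLattice.profile {D : CircleProduct T.immersion} {α α' : ℤ} {ℓ : ℕ}
    (hL : D.IsCongruenceLattice T.lattice α α' ℓ) (hℓ : 0 < ℓ)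
    (hcop : Nat.gcd (Nat.gcd ℓ α.natAbs) α'.natAbs = 1) :
    T.ProfileTotalTurning D.p D.q D.p' ℓ ∧
    T.ProfileWrapsCircle D.p D.q D.p' (Nat.gcd ℓ α.natAbs) (ℓ / Nat.gcd ℓ α.natAbs) := by
  have hw : 0 < ℓ / Nat.gcd ℓ α.natAbs :=
    Nat.div_pos (Nat.le_of_dvd hℓ (Nat.gcd_dvd_left _ _)) (Nat.gcd_pos_of_pos_left _ hℓ)
  have hfin : (T.profileComponents D.p D.q D.p').Finite := by
    rw [hL.profileComponents_eq hcop hℓ]; exact Set.finite_range _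
  have hcard : (T.profileComponents D.p D.q D.p').ncard = Nat.gcd ℓ α.natAbs := by
    rw [hL.profileComponents_eq hcop hℓ, ← Set.image_univ,
      Set.ncard_image_of_injective _ (hL.injective_profileLine hcop), Set.ncard_univ, Nat.card_fin]
  obtain ⟨h1, h2, -, -, h5, -⟩ := orthonormal_four_iff.mp D.orthonormal
  refine ⟨⟨hfin, fun _ => ℓ / Nat.gcd ℓ α.natAbs, ?_, ?_⟩,
    hfin, hcard, D.r' • D.p', D.p, D.q, D.r, D.r_pos, orthonormal_two_iff.mpr ⟨h1, h2, h5⟩, ?_⟩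
  · rw [hL.profileComponents_eq hcop hℓ]
    rintro _ ⟨k, rfl⟩
    exact ⟨_, hL.isClosedParam hℓ _, D.hasTurningNumber_lineParam hw _⟩
  · rw [finsum_mem_eq_finite_toFinset_sum _ hfin, Finset.sum_const, smul_eq_mul,
      ← Set.ncard_eq_toFinset_card _ hfin, hcard]
    exact Nat.mul_div_cancel' (Nat.gcd_dvd_left _ _)
  · rw [hL.profileComponents_eq hcop hℓ]
    rintro _ ⟨k, rfl⟩
    exact ⟨_, hL.isClosedParam hℓ _, fun t => D.apply_lineParam _ _ t⟩

/-- The profile curves in an arbitrary hemisphere bounded by the first circle: rebasing the product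
changes the phases only by signs and additive constants. -/
lemma IsCongruenceLattice.profile_of_greatCircle_eq {D : CircleProduct T.immersion} {α α' : ℤ}
    {ℓ : ℕ} (hL : D.IsCongruenceLattice T.lattice α α' ℓ) (hℓ : 0 < ℓ)
    (hcop : Nat.gcd (Nat.gcd ℓ α.natAbs) α'.natAbs = 1) {u v n : ℍ[ℝ]}
    (h : Orthonormal ℝ ![u, v, n]) (huv : greatCircle u v = greatCircle D.p D.q) :
    T.ProfileTotalTurning u v n ℓ ∧
    T.ProfileWrapsCircle u v n (Nat.gcd ℓ α.natAbs) (ℓ / Nat.gcd ℓ α.natAbs) := by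
  obtain ⟨D', rfl, rfl, rfl, ⟨ε, hε, hφ⟩, ε', hε', hφ'⟩ := D.exists_rebase h huv
  have habs : ∀ ε : ℤ, (ε = 1 ∨ ε = -1) → ∀ β : ℤ, (ε * β).natAbs = β.natAbs := by
    rintro ε (rfl | rfl) β <;> simp
  have hsq : ∀ ε : ℤ, (ε = 1 ∨ ε = -1) → ε * ε = 1 := by
    rintro ε (rfl | rfl) <;> norm_num
  have hL' : D'.IsCongruenceLattice T.lattice (ε * α) (ε' * α') ℓ := by
    have e1 : (ε : ℝ) * ε = 1 := by exact_mod_cast hsq ε hε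
    have e2 : (ε' : ℝ) * ε' = 1 := by exact_mod_cast hsq ε' hε'
    intro γ
    rw [hL γ, hφ, hφ']
    constructor
    · rintro ⟨i, j, hi, hj, hd⟩
      refine ⟨ε * i, ε' * j, by rw [hi]; push_cast; rfl, by rw [hj]; push_cast; rfl, ?_⟩
      have : ε * α * (ε * i) + ε' * α' * (ε' * j) = α * i + α' * j := by
        linear_combination (α * i) * hsq ε hε + (α' * j) * hsq ε' hε'
      rwa [this]
    · rintro ⟨i, j, hi, hj, hd⟩
      refine ⟨ε * i, ε' * j, ?_, ?_, ?_⟩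
      · push_cast; rw [← hi]; linear_combination (-D.φ γ) * e1
      · push_cast; rw [← hj]; linear_combination (-D.φ' γ) * e2
      · have : α * (ε * i) + α' * (ε' * j) = ε * α * i + ε' * α' * j := by ring
        rwa [this]
  have := hL'.profile hℓ (by rw [habs ε hε, habs ε' hε']; exact hcop)
  rwa [habs ε hε] at this

end CircleProduct

/-! ### The axes of the equivariant action -/

lemma finrank_span_of_orthonormal {u v : ℍ[ℝ]} (h : Orthonormal ℝ ![u, v]) :
    Module.finrank ℝ (Submodule.span ℝ {u, v}) = 2 := by
  have h1 := finrank_span_eq_card h.linearIndependent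
  rwa [Matrix.range_cons, Matrix.range_cons, Matrix.range_empty, Set.union_empty,
    Set.singleton_union, Fintype.card_fin] at h1

lemma greatCircle_eq_of_span_le {u v p q : ℍ[ℝ]} (h : Orthonormal ℝ ![u, v])
    (h' : Orthonormal ℝ ![p, q])
    (hle : Submodule.span ℝ {u, v} ≤ Submodule.span ℝ {p, q}) :
    greatCircle u v = greatCircle p q := by
  have := Submodule.eq_of_le_of_finrank_eq hle
    (by rw [finrank_span_of_orthonormal h, finrank_span_of_orthonormal h'])
  rw [greatCircle_eq h, greatCircle_eq h', this]

/-- Distinct absolute frequencies are distinguished by the cosine at some time. -/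
lemma exists_cos_ne_cos {ν ν' : ℝ} (h : |ν| ≠ |ν'|) :
    ∃ t : ℝ, Real.cos (2 * Real.pi * (ν * t)) ≠ Real.cos (2 * Real.pi * (ν' * t)) := by
  have hpos : 0 < |ν| + |ν'| := by
    rcases (add_nonneg (abs_nonneg ν) (abs_nonneg ν')).lt_or_eq with h0 | h0
    · exact h0
    · have h1 := abs_nonneg ν
      have h2 := abs_nonneg ν'
      exact absurd (by linarith) h
  -- at this time both angles are at most `π` in absolute value
  have ht : 0 < 1 / (2 * (|ν| + |ν'|)) := by positivity
  refine ⟨1 / (2 * (|ν| + |ν'|)), fun he => h ?_⟩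
  set t := 1 / (2 * (|ν| + |ν'|)) with htdef
  have hsum : (|ν| + |ν'|) * t = 1 / 2 := by rw [htdef]; field_simp
  have hcos : ∀ x : ℝ, Real.cos (2 * Real.pi * (x * t)) = Real.cos (2 * Real.pi * (|x| * t)) := by
    intro x
    rw [← Real.cos_abs, abs_mul, abs_mul x t, abs_of_pos ht, abs_of_pos Real.two_pi_pos]
  rw [hcos ν, hcos ν'] at he
  have hmem : ∀ x : ℝ, |x| ≤ |ν| + |ν'| → 2 * Real.pi * (|x| * t) ∈ Set.Icc 0 Real.pi := by
    intro x hx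
    have h1 : |x| * t ≤ 1 / 2 := by rw [← hsum]; exact mul_le_mul_of_nonneg_right hx ht.le
    constructor
    · positivity
    · nlinarith [Real.pi_pos]
  have h2 := Real.injOn_cos (hmem ν (by linarith [abs_nonneg ν']))
    (hmem ν' (by linarith [abs_nonneg ν])) he
  exact mul_right_cancel₀ ht.ne' (mul_left_cancel₀ Real.two_pi_pos.ne' h2)

lemma circlePath_quarter_add (p q : ℍ[ℝ]) (x : ℝ) :
    circlePath p q (1 / 4 + x) = circlePath q (-p) x := by
  have h : 2 * Real.pi * (1 / 4 + x) = 2 * Real.pi * x + Real.pi / 2 := by ring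
  rw [circlePath, h, Real.cos_add_pi_div_two, Real.sin_add_pi_div_two, circlePath]
  module

lemma circlePath_quarter (p q : ℍ[ℝ]) : circlePath p q (1 / 4) = q := by
  rw [← add_zero (1 / 4 : ℝ), circlePath_quarter_add, circlePath_zero]

/-- A one-parameter group that rotates two orthogonal planes with different absolute frequencies
preserves no great circle besides the unit circles of these planes, as the projections of an
invariant plane to the two planes are contained in it and invariant. This version assumes that the
first plane is not fixed. -/
lemma eq_greatCircle_of_rotation_of_ne_zero {p q p' q' u v : ℍ[ℝ]}
    (h : Orthonormal ℝ ![p, q, p', q']) (huv : Orthonormal ℝ ![u, v])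
    (R : ℝ → ℍ[ℝ] →ₗ[ℝ] ℍ[ℝ]) {ν ν' : ℝ} (hν : |ν| ≠ |ν'|) (hν0 : ν ≠ 0)
    (hR : ∀ t x, R t (circlePath p q x) = circlePath p q (x + ν * t))
    (hR' : ∀ t x, R t (circlePath p' q' x) = circlePath p' q' (x + ν' * t))
    (hB : ∀ t, R t '' greatCircle u v = greatCircle u v) :
    greatCircle u v = greatCircle p q ∨ greatCircle u v = greatCircle p' q' := by
  obtain ⟨h1, h2, h3, h4, h5, h6, h7, h8, h9, h10⟩ := orthonormal_four_iff.mp h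
  have hpq : Orthonormal ℝ ![p, q] := orthonormal_two_iff.mpr ⟨h1, h2, h5⟩
  have hpq' : Orthonormal ℝ ![p', q'] := orthonormal_two_iff.mpr ⟨h3, h4, h10⟩
  have hsub : greatCircle u v ⊆ (Submodule.span ℝ {u, v} : Submodule ℝ ℍ[ℝ]) := by
    rintro _ ⟨s, t, -, rfl⟩
    exact Submodule.mem_span_pair.mpr ⟨s, t, rfl⟩
  -- the plane of the great circle is invariant
  have hinv : ∀ t, ∀ P ∈ Submodule.span ℝ {u, v}, R t P ∈ Submodule.span ℝ {u, v} := by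
    intro t P hP
    obtain ⟨a, b, rfl⟩ := Submodule.mem_span_pair.mp hP
    have hu := hsub ((hB t) ▸ Set.mem_image_of_mem (R t) (left_mem_greatCircle u v))
    have hv := hsub ((hB t) ▸ Set.mem_image_of_mem (R t) (right_mem_greatCircle u v))
    rw [map_add, map_smul, map_smul]
    exact Submodule.add_mem _ (Submodule.smul_mem _ _ hu) (Submodule.smul_mem _ _ hv)
  have hRp : ∀ t, R t p = circlePath p q (ν * t) := fun t => by
    rw [← zero_add (ν * t), ← hR, circlePath_zero]
  have hRq : ∀ t, R t q = circlePath q (-p) (ν * t) := fun t => by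
    rw [← circlePath_quarter_add, ← hR, circlePath_quarter]
  have hRp' : ∀ t, R t p' = circlePath p' q' (ν' * t) := fun t => by
    rw [← zero_add (ν' * t), ← hR', circlePath_zero]
  have hRq' : ∀ t, R t q' = circlePath q' (-p') (ν' * t) := fun t => by
    rw [← circlePath_quarter_add, ← hR', circlePath_quarter]
  -- the projection to the first plane maps the plane of the great circle to itself
  have hproj : ∀ a b a' b' : ℝ, a • p + b • q + a' • p' + b' • q' ∈ Submodule.span ℝ {u, v} →
      a • p + b • q ∈ Submodule.span ℝ {u, v} := by
    intro a b a' b' hP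
    obtain ⟨t, ht⟩ := exists_cos_ne_cos hν
    have e : R t (a • p + b • q + a' • p' + b' • q') + R (-t) (a • p + b • q + a' • p' + b' • q') -
        (2 * Real.cos (2 * Real.pi * (ν' * t))) • (a • p + b • q + a' • p' + b' • q') =
        (2 * (Real.cos (2 * Real.pi * (ν * t)) - Real.cos (2 * Real.pi * (ν' * t)))) •
          (a • p + b • q) := by
      simp only [map_add, map_smul, hRp, hRq, hRp', hRq', circlePath, mul_neg, Real.cos_neg,
        Real.sin_neg]
      module
    have hm := Submodule.sub_mem _ (Submodule.add_mem _ (hinv t _ hP) (hinv (-t) _ hP))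
      (Submodule.smul_mem _ (2 * Real.cos (2 * Real.pi * (ν' * t))) hP)
    rw [e] at hm
    exact (Submodule.smul_mem_iff _ (mul_ne_zero two_ne_zero (sub_ne_zero.mpr ht))).mp hm
  by_cases hall : ∀ P ∈ Submodule.span ℝ {u, v}, inner ℝ p P = (0 : ℝ) ∧ inner ℝ q P = (0 : ℝ)
  · right
    refine greatCircle_eq_of_span_le huv hpq' fun P hP => ?_
    rw [eq_sum_inner_of_orthonormal h P, (hall P hP).1, (hall P hP).2]
    exact Submodule.mem_span_pair.mpr ⟨inner ℝ p' P, inner ℝ q' P, by module⟩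
  · left
    push Not at hall
    obtain ⟨P, hP, hne⟩ := hall
    rw [eq_sum_inner_of_orthonormal h P] at hP
    have hP1 := hproj _ _ _ _ hP
    set a := inner ℝ p P with ha
    set b := inner ℝ q P with hb
    have hab : a ^ 2 + b ^ 2 ≠ 0 := by
      intro h0
      have ha0 : a = 0 := by nlinarith [sq_nonneg a, sq_nonneg b]
      have hb0 : b = 0 := by nlinarith [sq_nonneg a, sq_nonneg b]
      exact hne ha0 hb0
    -- a quarter turn
    have hP2 : a • q + b • (-p) ∈ Submodule.span ℝ {u, v} := by
      have h0 := hinv (1 / 4 / ν) _ hP1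
      have e : ν * (1 / 4 / ν) = 1 / 4 := by field_simp
      rwa [map_add, map_smul, map_smul, hRp, hRq, e, circlePath_quarter, circlePath_quarter] at h0
    refine (greatCircle_eq_of_span_le hpq huv ?_).symm
    rw [Submodule.span_le]
    rintro x (rfl | rfl)
    · have h0 := Submodule.sub_mem _ (Submodule.smul_mem _ a hP1) (Submodule.smul_mem _ b hP2)
      refine (Submodule.smul_mem_iff _ hab).mp ?_
      convert h0 using 1
      module
    · have h0 := Submodule.add_mem _ (Submodule.smul_mem _ b hP1) (Submodule.smul_mem _ a hP2)
      refine (Submodule.smul_mem_iff _ hab).mp ?_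
      convert h0 using 1
      module

lemma image_greatCircle_of_rotation {p q : ℍ[ℝ]} (R : ℍ[ℝ] →ₗ[ℝ] ℍ[ℝ]) {y : ℝ}
    (hR : ∀ x, R (circlePath p q x) = circlePath p q (x + y)) :
    R '' greatCircle p q = greatCircle p q := by
  apply Set.Subset.antisymm
  · rintro _ ⟨P, hP, rfl⟩
    obtain ⟨x, rfl⟩ := exists_circlePath_of_mem_greatCircle hP
    rw [hR]
    exact circlePath_mem_greatCircle _ _ _
  · intro P hP
    obtain ⟨x, rfl⟩ := exists_circlePath_of_mem_greatCircle hP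
    exact ⟨circlePath p q (x - y), circlePath_mem_greatCircle _ _ _, by rw [hR, sub_add_cancel]⟩

/-- A linear map that induces a translation of the surface rotates both circles. -/
lemma CircleProduct.map_circlePath {f : ℂ → ℍ[ℝ]} (D : CircleProduct f) (R : ℍ[ℝ] →ₗ[ℝ] ℍ[ℝ])
    {η : ℂ} (hR : ∀ z, R (f z) = f (z + η)) (x : ℝ) :
    R (circlePath D.p D.q x) = circlePath D.p D.q (x + D.φ η) := by
  -- the midpoint of two surface points with opposite second phase lies on the first circle
  have hhalf : ∀ y : ℝ, circlePath D.p' D.q' (1 / 2 + y) = - circlePath D.p' D.q' y := by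
    intro y
    have h : 2 * Real.pi * (1 / 2 + y) = 2 * Real.pi * y + Real.pi := by ring
    rw [circlePath, h, Real.cos_add_pi, Real.sin_add_pi, circlePath]
    module
  have h1 := hR (D.point (x - D.c) (-D.c'))
  have h2 := hR (D.point (x - D.c) (1 / 2 - D.c'))
  simp only [D.eq_add, map_add, φ_point, φ'_point, map_smul] at h1 h2
  rw [show 1 / 2 - D.c' + D.c' = 1 / 2 + 0 by ring,
    show 1 / 2 - D.c' + D.φ' η + D.c' = 1 / 2 + D.φ' η by ring, hhalf, hhalf] at h2
  rw [show -D.c' + D.c' = 0 by ring, show -D.c' + D.φ' η + D.c' = D.φ' η by ring] at h1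
  have h3 := congrArg₂ (· + ·) h1 h2
  simp only [smul_neg, map_neg] at h3
  rw [show x - D.c + D.c = x by ring, show x - D.c + D.φ η + D.c = x + D.φ η by ring] at h3
  have hr : 2 * D.r ≠ 0 := mul_ne_zero two_ne_zero D.r_pos.ne'
  refine smul_right_injective _ hr ?_
  change (2 * D.r) • _ = (2 * D.r) • _
  calc (2 * D.r) • R (circlePath D.p D.q x) = _ := by
        rw [two_mul, add_smul]
        have : ∀ a b : ℍ[ℝ], a + a = a + b + (a + -b) := fun a b => by abel
        exact this _ _
    _ = _ := h3
    _ = _ := by rw [two_mul, add_smul]; abel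

namespace SpectralFrame

variable {T : FlatCMCTorus} {lam : Fin 3 → Circle} (S : SpectralFrame T lam)

/-- The ambient isometry as a linear map of `ℍ`. -/
def ambientMap (ζ : ℂ) : ℍ[ℝ] →ₗ[ℝ] ℍ[ℝ] where
  toFun := S.ambient ζ
  map_add' x y := by simp only [ambient, mul_add, add_mul]
  map_smul' c x := by simp [ambient]

variable {m : Fin 3 → ℂ} (hm : ∀ i, m i ^ 2 = (lam i : ℂ))

include hm in
lemma ambient_immersion (ζ z : ℂ) :
    S.ambient ζ (T.immersion z) = T.immersion (z + S.a⁻¹ * ζ) := by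
  have hU : S.U ≠ 0 := by
    intro h; have := S.norm_U; rw [h] at this; simp at this
  have hV : S.V ≠ 0 := by
    intro h; have := S.norm_V; rw [h] at this; simp at this
  have e : S.a * (z + S.a⁻¹ * ζ) = ζ + S.a * z := by
    have := S.a_ne_zero
    field_simp
    ring
  rw [S.sym, S.sym, e, flatFrame_add (hm 1), flatFrame_add (hm 2), mul_inv_rev, ambient]
  simp only [mul_assoc]
  rw [inv_mul_cancel_left₀ hU, mul_inv_cancel_left₀ hV]

lemma circleProduct_φ (z : ℂ) :
    (S.circleProduct m hm).φ z = planePairing (m 1 - m 2) (S.a * z) := rfl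

lemma circleProduct_φ' (z : ℂ) :
    (S.circleProduct m hm).φ' z = planePairing (m 1 + m 2) (S.a * z) := rfl

/-- The frequencies of the equivariant action on the first circle. -/
lemma ambient_circlePath (t x : ℝ) :
    S.ambient (t * (Complex.I * m 0)) (circlePath (S.circleProduct m hm).p
      (S.circleProduct m hm).q x) = circlePath (S.circleProduct m hm).p (S.circleProduct m hm).q
        (x + (turnVector m 1 + turnVector m 2) / 2 * t) := by
  have h := (S.circleProduct m hm).map_circlePath (S.ambientMap (t * (Complex.I * m 0)))
    (S.ambient_immersion hm _) x
  have e : (S.circleProduct m hm).φ (S.a⁻¹ * (t * (Complex.I * m 0))) =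
      (turnVector m 1 + turnVector m 2) / 2 * t := by
    rw [circleProduct_φ, mul_inv_cancel_left₀ S.a_ne_zero, turnVector_one, turnVector_two,
      planePairing_apply, planeCross, planeCross]
    simp
    ring
  rw [e] at h
  exact h

/-- The frequencies of the equivariant action on the second circle. -/
lemma ambient_circlePath' (t x : ℝ) :
    S.ambient (t * (Complex.I * m 0)) (circlePath (S.circleProduct m hm).p'
      (S.circleProduct m hm).q' x) = circlePath (S.circleProduct m hm).p'
        (S.circleProduct m hm).q' (x + (turnVector m 2 - turnVector m 1) / 2 * t) := by
  have h := (S.circleProduct m hm).swap.map_circlePath (S.ambientMap (t * (Complex.I * m 0)))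
    (S.ambient_immersion hm _) x
  have e : (S.circleProduct m hm).φ' (S.a⁻¹ * (t * (Complex.I * m 0))) =
      (turnVector m 2 - turnVector m 1) / 2 * t := by
    rw [circleProduct_φ', mul_inv_cancel_left₀ S.a_ne_zero, turnVector_one, turnVector_two,
      planePairing_apply, planeCross, planeCross]
    simp
    ring
  have h' : (S.circleProduct m hm).swap.φ = (S.circleProduct m hm).φ' := rfl
  rw [h', e] at h
  exact h

include hm in
lemma mem_equivariantLine_iff (ζ : ℂ) :
    ζ ∈ S.equivariantLine ↔ ∃ t : ℝ, ζ = t * (Complex.I * m 0) :=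
  forall_flatFrame_smul_eq_one_iff (hm 0) ζ

/-- The axes are the unit circles of the two rotated planes. -/
lemma isAxis_iff (hs : |turnVector m 1 + turnVector m 2| ≠ |turnVector m 1 - turnVector m 2|)
    (B : Set ℍ[ℝ]) : S.IsAxis B ↔
      B = greatCircle (S.circleProduct m hm).p (S.circleProduct m hm).q ∨
      B = greatCircle (S.circleProduct m hm).p' (S.circleProduct m hm).q' := by
  set D := S.circleProduct m hm with hD
  have hR := S.ambient_circlePath hm
  have hR' := S.ambient_circlePath' hm
  set ν := (turnVector m 1 + turnVector m 2) / 2 with hν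
  set ν' := (turnVector m 2 - turnVector m 1) / 2 with hν'
  have hne : |ν| ≠ |ν'| := by
    rw [hν, hν', abs_div, abs_div, abs_sub_comm]
    intro h
    exact hs ((div_left_inj' (by norm_num)).mp h)
  constructor
  · rintro ⟨⟨u, v, huv, rfl⟩, hB⟩
    have hB' : ∀ t : ℝ, S.ambientMap (t * (Complex.I * m 0)) '' greatCircle u v =
        greatCircle u v := fun t => hB _ ((S.mem_equivariantLine_iff hm _).mpr ⟨t, rfl⟩)
    by_cases h0 : ν = 0
    · have h0' : ν' ≠ 0 := by
        intro h1; rw [h0, h1] at hne; exact hne rfl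
      exact (eq_greatCircle_of_rotation_of_ne_zero D.swap.orthonormal huv
        (fun t => S.ambientMap (t * (Complex.I * m 0))) hne.symm h0' hR' hR hB').symm
    · exact eq_greatCircle_of_rotation_of_ne_zero D.orthonormal huv
        (fun t => S.ambientMap (t * (Complex.I * m 0))) hne h0 hR hR' hB'
  · obtain ⟨h1, h2, h3, h4, h5, h6, h7, h8, h9, h10⟩ := orthonormal_four_iff.mp D.orthonormal
    rintro (rfl | rfl)
    · refine ⟨⟨_, _, orthonormal_two_iff.mpr ⟨h1, h2, h5⟩, rfl⟩, fun ζ hζ => ?_⟩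
      obtain ⟨t, rfl⟩ := (S.mem_equivariantLine_iff hm _).mp hζ
      exact image_greatCircle_of_rotation (S.ambientMap _) (hR t)
    · refine ⟨⟨_, _, orthonormal_two_iff.mpr ⟨h3, h4, h10⟩, rfl⟩, fun ζ hζ => ?_⟩
      obtain ⟨t, rfl⟩ := (S.mem_equivariantLine_iff hm _).mp hζ
      exact image_greatCircle_of_rotation (S.ambientMap _) (hR' t)

end SpectralFrame

/-- A rotating circle is fixed pointwise only if its frequency vanishes. -/
lemma forall_circlePath_add_eq_iff {p q : ℍ[ℝ]} (h : Orthonormal ℝ ![p, q]) (ν : ℝ) :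
    (∀ t x : ℝ, circlePath p q (x + ν * t) = circlePath p q x) ↔ ν = 0 := by
  constructor
  · intro h0
    by_contra hne
    have h1 := h0 (1 / 2 / ν) 0
    have e : 2 * Real.pi * (0 + ν * (1 / 2 / ν)) = Real.pi := by field_simp; ring
    rw [circlePath_zero, circlePath, e, Real.cos_pi, Real.sin_pi, zero_smul, add_zero] at h1
    have h2 := congrArg (fun P => (inner ℝ p P : ℝ)) h1
    simp only [inner_smul_right, (orthonormal_two_iff.mp h).1] at h2
    norm_num at h2
  · rintro rfl t x
    rw [zero_mul, add_zero]

lemma SpectralFrame.isRotational_iff {T : FlatCMCTorus} {lam : Fin 3 → Circle}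
    (S : SpectralFrame T lam) {m : Fin 3 → ℂ} (hm : ∀ i, m i ^ 2 = (lam i : ℂ))
    (hs : |turnVector m 1 + turnVector m 2| ≠ |turnVector m 1 - turnVector m 2|) :
    S.IsRotational ↔
      turnVector m 1 + turnVector m 2 = 0 ∨ turnVector m 1 - turnVector m 2 = 0 := by
  obtain ⟨h1, h2, h3, h4, h5, -, -, -, -, h10⟩ :=
    orthonormal_four_iff.mp (S.circleProduct m hm).orthonormal
  have hpq := orthonormal_two_iff.mpr ⟨h1, h2, h5⟩
  have hpq' := orthonormal_two_iff.mpr ⟨h3, h4, h10⟩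
  have e1 : turnVector m 1 + turnVector m 2 = 0 ↔ (turnVector m 1 + turnVector m 2) / 2 = 0 := by
    constructor <;> intro h <;> linarith
  have e2 : turnVector m 1 - turnVector m 2 = 0 ↔ (turnVector m 2 - turnVector m 1) / 2 = 0 := by
    constructor <;> intro h <;> linarith
  rw [e1, e2, ← forall_circlePath_add_eq_iff hpq, ← forall_circlePath_add_eq_iff hpq']
  constructor
  · rintro ⟨A, hA, hfix⟩
    rcases (S.isAxis_iff hm hs A).mp hA with rfl | rfl
    · left
      intro t x
      rw [← S.ambient_circlePath hm]
      exact hfix _ ((S.mem_equivariantLine_iff hm _).mpr ⟨t, rfl⟩) _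
        (circlePath_mem_greatCircle _ _ _)
    · right
      intro t x
      rw [← S.ambient_circlePath' hm]
      exact hfix _ ((S.mem_equivariantLine_iff hm _).mpr ⟨t, rfl⟩) _
        (circlePath_mem_greatCircle _ _ _)
  · rintro (h | h)
    · refine ⟨_, (S.isAxis_iff hm hs _).mpr (Or.inl rfl), fun ζ hζ P hP => ?_⟩
      obtain ⟨t, rfl⟩ := (S.mem_equivariantLine_iff hm _).mp hζ
      obtain ⟨x, rfl⟩ := exists_circlePath_of_mem_greatCircle hP
      rw [S.ambient_circlePath hm, h]
    · refine ⟨_, (S.isAxis_iff hm hs _).mpr (Or.inr rfl), fun ζ hζ P hP => ?_⟩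
      obtain ⟨t, rfl⟩ := (S.mem_equivariantLine_iff hm _).mp hζ
      obtain ⟨x, rfl⟩ := exists_circlePath_of_mem_greatCircle hP
      rw [S.ambient_circlePath' hm, h]

/-! ### The arithmetic of the triple of integers -/

/-- The linear relation between the square roots, which turns integrality of the two phases into a
congruence condition for the monodromy at the double point. -/
lemma turnVector_mul_planePairing (m : Fin 3 → ℂ) (w : ℂ) :
    turnVector m 0 * (2 * planePairing (m 0) w) =
      -((turnVector m 1 - turnVector m 2) * planePairing (m 1 - m 2) w +
        (turnVector m 1 + turnVector m 2) * planePairing (m 1 + m 2) w) := by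
  rw [turnVector_zero, turnVector_one, turnVector_two, planePairing_sub_left,
    planePairing_add_left]
  simp only [planePairing_apply, planeCross]
  ring

/-- Integers proportional to `s₀`, `s₁ - s₂`, `s₁ + s₂` with absolute values `ℓ₀`, `ℓ₁`, `ℓ₂`, in
some order of the last two. -/
lemma HasTurnTriple.exists_int {lam : Fin 3 → Circle} {l : TurnTriple}
    (h : HasTurnTriple lam l) :
    ∃ m : Fin 3 → ℂ, (∀ i, m i ^ 2 = (lam i : ℂ)) ∧ ∃ c : ℝ, 0 < c ∧ ∃ a b b' : ℤ,
      turnVector m 0 = c * a ∧ turnVector m 1 - turnVector m 2 = c * b ∧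
      turnVector m 1 + turnVector m 2 = c * b' ∧ a.natAbs = l.l0 ∧
      ((b.natAbs = l.l1 ∧ b'.natAbs = l.l2) ∨ (b.natAbs = l.l2 ∧ b'.natAbs = l.l1)) := by
  obtain ⟨m, hm, c, hc, h0, h1, h2⟩ := h
  have key : ∀ (x : ℝ) (n : ℕ), |x| = c * n → ∃ a : ℤ, x = c * a ∧ a.natAbs = n := by
    intro x n hx
    rcases abs_choice x with h | h
    · exact ⟨n, by rw [← h, hx]; simp, by simp⟩
    · exact ⟨-n, by rw [h] at hx; push_cast; linarith, by simp⟩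
  obtain ⟨a, ha, ha'⟩ := key _ _ h0
  refine ⟨m, hm, c, hc, a, ?_⟩
  rcases le_total |turnVector m 1 + turnVector m 2| |turnVector m 1 - turnVector m 2| with hle | hle
  · rw [min_eq_left hle] at h1
    rw [max_eq_right hle] at h2
    obtain ⟨b, hb, hb'⟩ := key _ _ h1
    obtain ⟨d, hd, hd'⟩ := key _ _ h2
    exact ⟨d, b, ha, hd, hb, ha', Or.inr ⟨hd', hb'⟩⟩
  · rw [min_eq_right hle] at h1
    rw [max_eq_left hle] at h2
    obtain ⟨b, hb, hb'⟩ := key _ _ h1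
    obtain ⟨d, hd, hd'⟩ := key _ _ h2
    exact ⟨b, d, ha, hb, hd, ha', Or.inl ⟨hb', hd'⟩⟩

lemma abs_add_ne_abs_sub_of_natAbs {x y c : ℝ} (hc : 0 < c) {l : TurnTriple} {b b' : ℤ}
    (hb : x - y = c * b) (hb' : x + y = c * b')
    (h : (b.natAbs = l.l1 ∧ b'.natAbs = l.l2) ∨ (b.natAbs = l.l2 ∧ b'.natAbs = l.l1)) :
    |x + y| ≠ |x - y| := by
  rw [hb, hb', abs_mul, abs_mul]
  intro he
  have h1 := mul_left_cancel₀ (abs_pos.mpr hc.ne').ne' he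
  rw [← Int.cast_abs, ← Int.cast_abs, Int.cast_inj, Int.abs_eq_natAbs, Int.abs_eq_natAbs] at h1
  have := l.lt1
  have := l.lt2
  omega

/-- The monodromy condition at the double point in terms of integral phases. -/
lemma exists_int_two_mul_planePairing_iff {m : Fin 3 → ℂ} {c : ℝ} (hc : 0 < c) {a b b' : ℤ}
    (ha0 : a ≠ 0) (ha : turnVector m 0 = c * a) (hb : turnVector m 1 - turnVector m 2 = c * b)
    (hb' : turnVector m 1 + turnVector m 2 = c * b') {w : ℂ} {i j : ℤ}
    (hi : planePairing (m 1 - m 2) w = i) (hj : planePairing (m 1 + m 2) w = j) :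
    (∃ n : ℤ, 2 * planePairing (m 0) w = n) ↔ a ∣ b * i + b' * j := by
  have h := turnVector_mul_planePairing m w
  rw [ha, hb, hb', hi, hj] at h
  have h1 : (a : ℝ) * (2 * planePairing (m 0) w) = -(b * i + b' * j) :=
    mul_left_cancel₀ hc.ne' (by linarith)
  constructor
  · rintro ⟨n, hn⟩
    rw [hn] at h1
    have h2 : a * n = -(b * i + b' * j) := by exact_mod_cast h1
    exact (dvd_neg).mp ⟨n, h2.symm⟩
  · rintro ⟨n, hn⟩
    refine ⟨-n, ?_⟩
    have ha0' : (a : ℝ) ≠ 0 := by exact_mod_cast ha0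
    apply mul_left_cancel₀ ha0'
    rw [h1]
    have h2 : ((b * i + b' * j : ℤ) : ℝ) = (a * n : ℤ) := by rw [hn]
    push_cast at h2 ⊢
    linarith

namespace SpectralFrame

variable {T : FlatCMCTorus} {lam : Fin 3 → Circle} (S : SpectralFrame T lam)

/-- All periods with monodromy `± 1` at the double point form the lattice given by the congruence
with coefficients proportional to `s₁ - s₂` and `s₁ + s₂`. -/
lemma isCongruenceLattice_of_isPrimitive (hS : S.IsPrimitive) {m : Fin 3 → ℂ}
    (hm : ∀ i, m i ^ 2 = (lam i : ℂ)) {c : ℝ} (hc : 0 < c) {a b b' : ℤ} {ℓ : ℕ} (hℓ : 0 < ℓ)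
    (haℓ : a.natAbs = ℓ) (ha : turnVector m 0 = c * a)
    (hb : turnVector m 1 - turnVector m 2 = c * b)
    (hb' : turnVector m 1 + turnVector m 2 = c * b') :
    (S.circleProduct m hm).IsCongruenceLattice T.lattice b b' ℓ := by
  have ha0 : a ≠ 0 := by rintro rfl; simp at haℓ; omega
  intro γ
  rw [hS γ, flatFrame_eq_one_or_neg_one_iff (hm 0), (S.circleProduct m hm).isPeriod_iff]
  have hdvd : ∀ x : ℤ, (ℓ : ℤ) ∣ x ↔ a ∣ x := by
    intro x; rw [← haℓ, Int.natAbs_dvd]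
  constructor
  · rintro ⟨⟨⟨i, hi⟩, j, hj⟩, hn⟩
    exact ⟨i, j, hi, hj, (hdvd _).mpr
      ((exists_int_two_mul_planePairing_iff hc ha0 ha hb hb' hi hj).mp hn)⟩
  · rintro ⟨i, j, hi, hj, hd⟩
    exact ⟨⟨⟨i, hi⟩, j, hj⟩, (exists_int_two_mul_planePairing_iff hc ha0 ha hb hb' hi hj).mpr
      ((hdvd _).mp hd)⟩

/-- The gradients of the two phases are perpendicular, hence so are the edges of the period
parallelogram. -/
lemma isRectangular_fullTorus {m : Fin 3 → ℂ} (hm : ∀ i, m i ^ 2 = (lam i : ℂ)) :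
    (S.circleProduct m hm).fullTorus.IsRectangular := by
  set D := S.circleProduct m hm with hD
  have hne1 : D.point 1 0 ≠ 0 := by
    intro h; have := D.φ_point 1 0; rw [h, map_zero] at this; norm_num at this
  have hne2 : D.point 0 1 ≠ 0 := by
    intro h; have := D.φ'_point 0 1; rw [h, map_zero] at this; norm_num at this
  refine ⟨D.point 1 0, D.point 0 1, hne1, hne2, ?_, rfl⟩
  have h1 : planePairing (m 1 + m 2) (S.a * D.point 1 0) = 0 := D.φ'_point 1 0
  have h2 : planePairing (m 1 - m 2) (S.a * D.point 0 1) = 0 := D.φ_point 0 1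
  generalize D.point 1 0 = e at h1
  generalize D.point 0 1 = e' at h2
  have hE : planeCross (m 1) (m 2) ≠ 0 :=
    planeCross_ne_zero (hm 1) (hm 2) (S.distinct.ne (by decide))
  have n1 := re_sq_add_im_sq_of_sq_eq (hm 1)
  have n2 := re_sq_add_im_sq_of_sq_eq (hm 2)
  have hw : (S.a * e).re * (S.a * e').re + (S.a * e).im * (S.a * e').im = 0 := by
    generalize S.a * e = w at h1
    generalize S.a * e' = w' at h2
    rw [planePairing_apply, Complex.add_re, Complex.add_im] at h1
    rw [planePairing_apply, Complex.sub_re, Complex.sub_im] at h2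
    apply mul_left_cancel₀ hE
    rw [planeCross]
    linear_combination (-(1 / 2)) * (w'.re * ((m 1).im - (m 2).im) -
        w'.im * ((m 1).re - (m 2).re)) * h1 +
      (1 / 2) * (w.re * ((m 1).im + (m 2).im) - w.im * ((m 1).re + (m 2).re)) * h2 -
      (1 / 2) * (w.re * w'.im - w.im * w'.re) * (n1 - n2)
  have ha : Complex.normSq S.a ≠ 0 := by
    rw [Ne, Complex.normSq_eq_zero]; exact S.a_ne_zero
  apply mul_left_cancel₀ ha
  rw [mul_zero, Complex.normSq_apply, Complex.inner]
  simp only [Complex.mul_re, Complex.mul_im, Complex.conj_re, Complex.conj_im] at hw ⊢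
  linear_combination hw

end SpectralFrame

/-! ### The geometry of primitive tori -/

/-- The unit circles of orthogonal planes are different. -/
lemma greatCircle_ne_of_orthonormal {p q p' q' : ℍ[ℝ]} (h : Orthonormal ℝ ![p, q, p', q']) :
    greatCircle p q ≠ greatCircle p' q' := by
  obtain ⟨h1, -, -, -, -, h6, h7, -⟩ := orthonormal_four_iff.mp h
  intro he
  obtain ⟨s, t, -, hst⟩ := he ▸ left_mem_greatCircle p q
  have : inner ℝ p p = (0 : ℝ) := by
    nth_rewrite 2 [hst]
    rw [inner_add_right, inner_smul_right, inner_smul_right, h6, h7]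
    ring
  rw [h1] at this
  norm_num at this

/-- The profile curves of both axes, with respect to a labelling in which the first axis carries the
phase with coefficient `± ℓ₁`. -/
lemma CircleProduct.IsCongruenceLattice.profile_axes {T : FlatCMCTorus}
    {D : CircleProduct T.immersion} {l : TurnTriple} {b b' : ℤ}
    (hL : D.IsCongruenceLattice T.lattice b b' l.l0) (hb : b.natAbs = l.l1)
    (hb' : b'.natAbs = l.l2) :
    Function.Injective ![greatCircle D.p D.q, greatCircle D.p' D.q'] ∧
    ∀ (k : Fin 2) (u v n : ℍ[ℝ]), Orthonormal ℝ ![u, v, n] →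
      greatCircle u v = ![greatCircle D.p D.q, greatCircle D.p' D.q'] k →
        T.ProfileTotalTurning u v n l.l0 ∧
        T.ProfileWrapsCircle u v n (Nat.gcd l.l0 (![l.l1, l.l2] k))
          (l.l0 / Nat.gcd l.l0 (![l.l1, l.l2] k)) := by
  have hℓ : 0 < l.l0 := lt_of_le_of_lt (Nat.zero_le _) l.lt1
  have hcop := l.coprime
  constructor
  · have := greatCircle_ne_of_orthonormal D.orthonormal
    intro i j hij
    fin_cases i <;> fin_cases j <;> simp_all
  · intro k u v n h huv
    fin_cases k
    · have := hL.profile_of_greatCircle_eq hℓ (by rw [hb, hb', hcop]) h huv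
      rwa [hb] at this
    · have := hL.swap.profile_of_greatCircle_eq hℓ (by
        rw [hb, hb', Nat.gcd_right_comm, hcop]) h huv
      rwa [hb'] at this

theorem SpectralFrame.primitive_geometry {T : FlatCMCTorus} {lam : Fin 3 → Circle}
    (S : SpectralFrame T lam) {l : TurnTriple} (hl : HasTurnTriple lam l) (hS : S.IsPrimitive) :
    (∃ T' : FlatCMCTorus, T'.IsEmbedded ∧ T'.IsRectangular ∧ T.Covers T' l.l0) ∧
    (∃ A : Fin 2 → Set ℍ[ℝ], Function.Injective A ∧ (∀ B, S.IsAxis B ↔ ∃ k, B = A k) ∧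
      ∀ (k : Fin 2) (u v n : ℍ[ℝ]), Orthonormal ℝ ![u, v, n] → greatCircle u v = A k →
        T.ProfileTotalTurning u v n l.l0 ∧
        T.ProfileWrapsCircle u v n (Nat.gcd l.l0 (![l.l1, l.l2] k))
          (l.l0 / Nat.gcd l.l0 (![l.l1, l.l2] k))) := by
  obtain ⟨m, hm, c, hc, a, b, b', ha, hb, hb', ha0, hcase⟩ := hl.exists_int
  have hℓ : 0 < l.l0 := lt_of_le_of_lt (Nat.zero_le _) l.lt1
  have hL := S.isCongruenceLattice_of_isPrimitive hS hm hc hℓ ha0 ha hb hb'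
  have hcop : Nat.gcd (Nat.gcd l.l0 b.natAbs) b'.natAbs = 1 := by
    rcases hcase with ⟨h1, h2⟩ | ⟨h1, h2⟩
    · rw [h1, h2, l.coprime]
    · rw [h1, h2, Nat.gcd_right_comm, l.coprime]
  have hax := S.isAxis_iff hm (abs_add_ne_abs_sub_of_natAbs hc hb hb' hcase)
  set D := S.circleProduct m hm with hD
  constructor
  · have hle : T.lattice ≤ D.fullTorus.lattice := by
      intro γ hγ
      obtain ⟨i, j, hi, hj, -⟩ := (hL γ).mp hγ
      exact (D.mem_closure_point_iff γ).mpr ⟨⟨i, hi⟩, j, hj⟩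
    exact ⟨D.fullTorus, D.isEmbedded_fullTorus, S.isRectangular_fullTorus hm, rfl, hle,
      isCoveringMap_quotient_map hle hL.isClosed hℓ (D.card_ker_map hℓ hL hcop rfl hle)⟩
  · rcases hcase with ⟨h1, h2⟩ | ⟨h1, h2⟩
    · obtain ⟨hinj, hprof⟩ := hL.profile_axes h1 h2
      refine ⟨_, hinj, fun B => ?_, hprof⟩
      rw [hax, Fin.exists_fin_two]
      rfl
    · obtain ⟨hinj, hprof⟩ := hL.swap.profile_axes h2 h1
      refine ⟨_, hinj, fun B => ?_, hprof⟩
      rw [hax, Fin.exists_fin_two, or_comm]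
      rfl

theorem SpectralFrame.l1_eq_zero_iff_isRotational {T : FlatCMCTorus} {lam : Fin 3 → Circle}
    (S : SpectralFrame T lam) {l : TurnTriple} (hl : HasTurnTriple lam l) :
    l.l1 = 0 ↔ S.IsRotational := by
  obtain ⟨m, hm, c, hc, a, b, b', ha, hb, hb', ha0, hcase⟩ := hl.exists_int
  rw [S.isRotational_iff hm (abs_add_ne_abs_sub_of_natAbs hc hb hb' hcase), hb, hb']
  simp only [mul_eq_zero, hc.ne', false_or, Int.cast_eq_zero]
  have := l.lt1
  have := l.lt2
  omega

/-! ### Constructing flat CMC tori -/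

namespace CircleProduct

variable {f : ℂ → ℍ[ℝ]} (D : CircleProduct f)

/-- Combinations of the two circles with the phases of the surface, shifted by `θ`. The surface, its
normal and its partial derivatives are all of this kind. -/
def wave (A B θ : ℝ) (z : ℂ) : ℍ[ℝ] :=
  A • circlePath D.p D.q (D.φ z + D.c + θ) + B • circlePath D.p' D.q' (D.φ' z + D.c' + θ)

lemma inner_wave (A B θ A' B' θ' : ℝ) (z : ℂ) :
    inner ℝ (D.wave A B θ z) (D.wave A' B' θ' z) =
      (A * A' + B * B') * Real.cos (2 * Real.pi * (θ - θ')) := by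
  obtain ⟨h1, h2, h3, h4, h5, h6, h7, h8, h9, h10⟩ := orthonormal_four_iff.mp D.orthonormal
  have key : ∀ x y : ℝ, Real.cos (2 * Real.pi * (x + θ)) * Real.cos (2 * Real.pi * (x + θ')) +
      Real.sin (2 * Real.pi * (x + θ)) * Real.sin (2 * Real.pi * (x + θ')) =
      Real.cos (2 * Real.pi * (θ - θ')) := by
    intro x y
    rw [← Real.cos_sub]
    congr 1
    ring
  have k1 := key (D.φ z + D.c) 0
  have k2 := key (D.φ' z + D.c') 0
  simp only [wave, circlePath, inner_add_left, inner_add_right, inner_smul_left, inner_smul_right,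
    RCLike.conj_to_real, h1, h2, h3, h4, h5, h6, h7, h8, h9, h10, real_inner_comm D.p D.q,
    real_inner_comm D.p D.p', real_inner_comm D.p D.q', real_inner_comm D.q D.p',
    real_inner_comm D.q D.q', real_inner_comm D.p' D.q']
  linear_combination (A * A') * k1 + (B * B') * k2

lemma hasDerivAt_circlePath (p q : ℍ[ℝ]) (x : ℝ) :
    HasDerivAt (circlePath p q) ((2 * Real.pi) • circlePath p q (x + 1 / 4)) x := by
  have h0 : HasDerivAt (fun x : ℝ => 2 * Real.pi * x) (2 * Real.pi) x := by
    simpa using (hasDerivAt_id x).const_mul (2 * Real.pi)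
  have h1 := (h0.cos.smul_const p).add (h0.sin.smul_const q)
  refine h1.congr_deriv ?_
  rw [add_comm x, circlePath_quarter_add, circlePath]
  module

lemma hasFDerivAt_wave (A B θ : ℝ) (z : ℂ) :
    HasFDerivAt (D.wave A B θ)
      (A • (D.φ.toContinuousLinearMap.smulRight
          ((2 * Real.pi) • circlePath D.p D.q (D.φ z + D.c + θ + 1 / 4))) +
        B • (D.φ'.toContinuousLinearMap.smulRight
          ((2 * Real.pi) • circlePath D.p' D.q' (D.φ' z + D.c' + θ + 1 / 4)))) z := by
  have h1 : HasFDerivAt (fun z => D.φ z + D.c + θ) D.φ.toContinuousLinearMap z :=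
    ((D.φ.toContinuousLinearMap.hasFDerivAt).add_const _).add_const _
  have h2 : HasFDerivAt (fun z => D.φ' z + D.c' + θ) D.φ'.toContinuousLinearMap z :=
    ((D.φ'.toContinuousLinearMap.hasFDerivAt).add_const _).add_const _
  exact (((hasDerivAt_circlePath _ _ _).hasFDerivAt.comp z h1).const_smul A).add
    (((hasDerivAt_circlePath _ _ _).hasFDerivAt.comp z h2).const_smul B)

lemma fderiv_wave (A B θ : ℝ) (z h : ℂ) : fderiv ℝ (D.wave A B θ) z h =
    D.wave (2 * Real.pi * D.φ h * A) (2 * Real.pi * D.φ' h * B) (θ + 1 / 4) z := by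
  rw [(D.hasFDerivAt_wave A B θ z).fderiv]
  simp only [wave, add_apply, smul_apply,
    ContinuousLinearMap.smulRight_apply, LinearMap.coe_toContinuousLinearMap', smul_smul, add_assoc]
  congr 2 <;> ring

lemma eq_wave : f = D.wave D.r D.r' 0 := by
  funext z
  rw [D.eq_add, wave, add_zero, add_zero]

lemma contDiff_wave (A B θ : ℝ) : ContDiff ℝ ∞ (D.wave A B θ) := by
  have h1 : ContDiff ℝ ∞ fun z => D.φ z := D.φ.toContinuousLinearMap.contDiff
  have h2 : ContDiff ℝ ∞ fun z => D.φ' z := D.φ'.toContinuousLinearMap.contDiff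
  have h3 : ContDiff ℝ ∞ fun x : ℝ => Real.cos (2 * Real.pi * x) := by fun_prop
  have h4 : ContDiff ℝ ∞ fun x : ℝ => Real.sin (2 * Real.pi * x) := by fun_prop
  have h5 : ∀ p q : ℍ[ℝ], ContDiff ℝ ∞ (circlePath p q) := fun p q =>
    (h3.smul contDiff_const).add (h4.smul contDiff_const)
  exact (((h5 _ _).comp ((h1.add contDiff_const).add contDiff_const)).const_smul A).add
    (((h5 _ _).comp ((h2.add contDiff_const).add contDiff_const)).const_smul B)

/-- A product of two circles in the 3-sphere whose coordinate vector fields are perpendicular and of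
equal length is a flat CMC surface: its metric, and its second fundamental form with respect to the
normal obtained by exchanging the radii, have constant coefficients. -/
lemma isFlatCMCImmersion (hr : D.r ^ 2 + D.r' ^ 2 = 1)
    (hconf : (D.r * D.φ 1) ^ 2 + (D.r' * D.φ' 1) ^ 2 =
      (D.r * D.φ Complex.I) ^ 2 + (D.r' * D.φ' Complex.I) ^ 2)
    (horth : D.r ^ 2 * (D.φ 1 * D.φ Complex.I) + D.r' ^ 2 * (D.φ' 1 * D.φ' Complex.I) = 0) :
    IsFlatCMCImmersion f := by
  have hX : ∀ A B θ : ℝ, partialX (D.wave A B θ) =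
      D.wave (2 * Real.pi * D.φ 1 * A) (2 * Real.pi * D.φ' 1 * B) (θ + 1 / 4) :=
    fun A B θ => funext fun z => D.fderiv_wave A B θ z 1
  have hY : ∀ A B θ : ℝ, partialY (D.wave A B θ) =
      D.wave (2 * Real.pi * D.φ Complex.I * A) (2 * Real.pi * D.φ' Complex.I * B) (θ + 1 / 4) :=
    fun A B θ => funext fun z => D.fderiv_wave A B θ z Complex.I
  have hnorm : ∀ (A B θ : ℝ) (z : ℂ), ‖D.wave A B θ z‖ = Real.sqrt (A ^ 2 + B ^ 2) := by
    intro A B θ z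
    rw [norm_eq_sqrt_real_inner, inner_wave]
    congr 1
    simp
    ring
  set E := (2 * Real.pi * D.φ 1 * D.r) ^ 2 + (2 * Real.pi * D.φ' 1 * D.r') ^ 2 with hE
  have hE' : E = (2 * Real.pi * D.φ Complex.I * D.r) ^ 2 +
      (2 * Real.pi * D.φ' Complex.I * D.r') ^ 2 := by
    rw [hE]; linear_combination (2 * Real.pi) ^ 2 * hconf
  have hEpos : 0 < E := by
    have hp := Real.pi_pos
    have h1 := D.r_pos
    have h2 := D.r'_pos
    by_cases h0 : D.φ 1 = 0
    · have h0' : D.φ' 1 ≠ 0 := fun h => one_ne_zero (D.eq_zero 1 h0 h)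
      have : 2 * Real.pi * D.φ' 1 * D.r' ≠ 0 := by positivity
      positivity
    · have : 2 * Real.pi * D.φ 1 * D.r ≠ 0 := by positivity
      positivity
  have hc1 : Real.cos (2 * Real.pi * (1 / 4)) = 0 := by
    rw [show 2 * Real.pi * (1 / 4) = Real.pi / 2 by ring, Real.cos_pi_div_two]
  suffices h : IsFlatCMCImmersion (D.wave D.r D.r' 0) by rwa [← D.eq_wave] at h
  refine ⟨D.contDiff_wave _ _ _, fun z => ?_, fun _ => Real.sqrt E,
    D.wave D.r' (-D.r) 0, -(((2 * Real.pi) ^ 2 * (D.φ 1 ^ 2 + D.φ Complex.I ^ 2) * D.r * D.r' -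
      (2 * Real.pi) ^ 2 * (D.φ' 1 ^ 2 + D.φ' Complex.I ^ 2) * D.r * D.r') / (2 * E)),
    fun z => ⟨Real.sqrt_pos.mpr hEpos, ?_, ?_, ?_⟩, fun z => ?_,
    (D.contDiff_wave _ _ _).continuous, fun z => ⟨?_, ?_, ?_, ?_⟩, fun z => ?_⟩
  · rw [hnorm, hr, Real.sqrt_one]
  · rw [hX, hnorm]
  · rw [hY, hnorm, hE']
  · rw [hX, hY, inner_wave]
    linear_combination (2 * Real.pi) ^ 2 * Real.cos (2 * Real.pi * (0 + 1 / 4 - (0 + 1 / 4))) *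
      horth
  · have h1 : partialX (fun _ : ℂ => Real.log (Real.sqrt E)) = fun _ => 0 := by
      funext w; simp [partialX]
    have h2 : partialY (fun _ : ℂ => Real.log (Real.sqrt E)) = fun _ => 0 := by
      funext w; simp [partialY]
    rw [planeLaplacian, h1, h2]
    simp [partialX, partialY]
  · rw [hnorm, neg_sq, add_comm, hr, Real.sqrt_one]
  · rw [inner_wave]; ring
  · rw [hX, inner_wave, show (0 : ℝ) - (0 + 1 / 4) = -(1 / 4) by ring, mul_neg, Real.cos_neg,
      hc1, mul_zero]
  · rw [hY, inner_wave, show (0 : ℝ) - (0 + 1 / 4) = -(1 / 4) by ring, mul_neg, Real.cos_neg,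
      hc1, mul_zero]
  · have hc2 : Real.cos (2 * Real.pi * (0 + 1 / 4 + 1 / 4 - 0)) = -1 := by
      rw [show 2 * Real.pi * (0 + 1 / 4 + 1 / 4 - 0) = Real.pi by ring, Real.cos_pi]
    rw [planeLaplacian, hX, hY, hX, hY, inner_add_left, inner_wave, inner_wave, hc2,
      Real.sq_sqrt hEpos.le]
    field_simp
    ring

end CircleProduct

/-! ### The triple of integers as an invariant of spectral data -/

lemma planeCross_comm (z w : ℂ) : planeCross w z = -planeCross z w := by
  simp only [planeCross]; ring

lemma planeCross_neg_left (z w : ℂ) : planeCross (-z) w = -planeCross z w := by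
  simp only [planeCross, Complex.neg_re, Complex.neg_im]; ring

lemma planeCross_neg_right (z w : ℂ) : planeCross z (-w) = -planeCross z w := by
  simp only [planeCross, Complex.neg_re, Complex.neg_im]; ring

lemma planeCross_conj (z w : ℂ) :
    planeCross ((starRingEnd ℂ) z) ((starRingEnd ℂ) w) = -planeCross z w := by
  simp only [planeCross, Complex.conj_re, Complex.conj_im]; ring

lemma planeCross_mul {δ : ℂ} (hδ : δ.re ^ 2 + δ.im ^ 2 = 1) (z w : ℂ) :
    planeCross (δ * z) (δ * w) = planeCross z w := by
  simp only [planeCross, Complex.mul_re, Complex.mul_im]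
  linear_combination (z.re * w.im - z.im * w.re) * hδ

/-- The generating relations of the equivalence of spectral data, on triples of points of the unit
circle: rotation, inversion, and swapping of the last two points. -/
def SpectralStep (lam lam' : Fin 3 → Circle) : Prop :=
  (∃ δ : Circle, ∀ i, lam' i = δ * lam i) ∨ (∀ i, lam' i = (lam i)⁻¹) ∨
    (lam' 0 = lam 0 ∧ lam' 1 = lam 2 ∧ lam' 2 = lam 1)

lemma SpectralStep.injective {lam lam' : Fin 3 → Circle} (h : SpectralStep lam lam')
    (hl : Function.Injective lam) : Function.Injective lam' := by
  rcases h with ⟨δ, h⟩ | h | ⟨h0, h1, h2⟩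
  · intro i j hij
    rw [h, h] at hij
    exact hl (mul_left_cancel hij)
  · intro i j hij
    rw [h, h] at hij
    exact hl (inv_injective hij)
  · have : lam' = lam ∘ Equiv.swap 1 2 := by
      funext i
      fin_cases i
      · simpa [Equiv.swap_apply_def] using h0
      · simpa [Equiv.swap_apply_def] using h1
      · simpa [Equiv.swap_apply_def] using h2
    rw [this]
    exact hl.comp (Equiv.injective _)

lemma exists_sq_eq_circle (δ : Circle) : ∃ μ : ℂ, μ ^ 2 = δ :=
  IsAlgClosed.exists_pow_nat_eq _ two_pos

lemma coe_inv_eq_conj_sq {μ : ℂ} {lam : Circle} (h : μ ^ 2 = lam) :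
    (starRingEnd ℂ) μ ^ 2 = ((lam⁻¹ : Circle) : ℂ) := by
  rw [Circle.coe_inv_eq_conj, ← h, map_pow]

lemma SpectralStep.hasTurnTriple {lam lam' : Fin 3 → Circle} (h : SpectralStep lam lam')
    {l : TurnTriple} (hl : HasTurnTriple lam l) : HasTurnTriple lam' l := by
  obtain ⟨m, hm, c, hc, h0, h1, h2⟩ := hl
  rcases h with ⟨δ, h⟩ | h | ⟨k0, k1, k2⟩
  · obtain ⟨μ, hμ⟩ := exists_sq_eq_circle δ
    refine ⟨fun i => μ * m i, fun i => by rw [mul_pow, hμ, hm, h, Circle.coe_mul], c, hc, ?_⟩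
    have hμ1 := re_sq_add_im_sq_of_sq_eq hμ
    simp only [turnVector_zero, turnVector_one, turnVector_two] at h0 h1 h2 ⊢
    simp only [planeCross_mul hμ1]
    exact ⟨h0, h1, h2⟩
  · refine ⟨fun i => (starRingEnd ℂ) (m i), fun i => by rw [coe_inv_eq_conj_sq (hm i), h],
      c, hc, ?_⟩
    simp only [turnVector_zero, turnVector_one, turnVector_two] at h0 h1 h2 ⊢
    simp only [planeCross_conj]
    rw [mul_neg, mul_neg, mul_neg, abs_neg, ← neg_add, abs_neg, neg_sub_neg, abs_sub_comm (2 * _)]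
    exact ⟨h0, h1, h2⟩
  · refine ⟨![m 0, m 2, m 1], fun i => ?_, c, hc, ?_⟩
    · fin_cases i
      · simpa [k0] using hm 0
      · simpa [k1] using hm 2
      · simpa [k2] using hm 1
    · simp only [turnVector_zero, turnVector_one, turnVector_two] at h0 h1 h2 ⊢
      change |2 * planeCross (m 2) (m 1)| = _ ∧
        min |2 * planeCross (m 1) (m 0) + 2 * planeCross (m 0) (m 2)|
          |2 * planeCross (m 1) (m 0) - 2 * planeCross (m 0) (m 2)| = _ ∧
        max |2 * planeCross (m 1) (m 0) + 2 * planeCross (m 0) (m 2)|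
          |2 * planeCross (m 1) (m 0) - 2 * planeCross (m 0) (m 2)| = _
      rw [planeCross_comm (m 1) (m 2), planeCross_comm (m 0) (m 1), planeCross_comm (m 2) (m 0),
        mul_neg, mul_neg, mul_neg, abs_neg, ← neg_add, abs_neg, neg_sub_neg, add_comm (2 * _)]
      exact ⟨h0, h1, h2⟩

lemma min_max_abs_add_sub_eq {x y x' y' : ℝ} (hx : x' = x ∨ x' = -x) (hy : y' = y ∨ y' = -y) :
    min |x' + y'| |x' - y'| = min |x + y| |x - y| ∧
      max |x' + y'| |x' - y'| = max |x + y| |x - y| := by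
  have e1 : |-x + y| = |x - y| := by rw [← abs_neg]; congr 1; ring
  have e2 : |-x - y| = |x + y| := by rw [← abs_neg]; congr 1; ring
  rcases hx with rfl | rfl <;> rcases hy with rfl | rfl
  · exact ⟨rfl, rfl⟩
  · rw [← sub_eq_add_neg, sub_neg_eq_add, min_comm, max_comm]; exact ⟨rfl, rfl⟩
  · rw [e1, e2, min_comm, max_comm]; exact ⟨rfl, rfl⟩
  · rw [sub_neg_eq_add, e1, ← sub_eq_add_neg, e2]; exact ⟨rfl, rfl⟩

/-- The triple depends neither on the choice of the square roots nor on the common factor. -/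
lemma HasTurnTriple.unique {lam : Fin 3 → Circle} {l l' : TurnTriple} (h : HasTurnTriple lam l)
    (h' : HasTurnTriple lam l') : l = l' := by
  obtain ⟨m, hm, c, hc, h0, h1, h2⟩ := h
  obtain ⟨m', hm', c', hc', h0', h1', h2'⟩ := h'
  have hsign : ∀ i, m' i = m i ∨ m' i = -m i := fun i =>
    sq_eq_sq_iff_eq_or_eq_neg.mp (by rw [hm, hm'])
  have hcross : ∀ i j, 2 * planeCross (m' i) (m' j) = 2 * planeCross (m i) (m j) ∨
      2 * planeCross (m' i) (m' j) = -(2 * planeCross (m i) (m j)) := by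
    intro i j
    rcases hsign i with hi | hi <;> rcases hsign j with hj | hj <;>
      simp only [hi, hj, planeCross_neg_left, planeCross_neg_right, neg_neg, mul_neg] <;> simp
  have e0 : |turnVector m' 0| = |turnVector m 0| := by
    rw [turnVector_zero, turnVector_zero]
    exact abs_eq_abs.mpr (hcross 1 2)
  obtain ⟨e1, e2⟩ := min_max_abs_add_sub_eq (hcross 2 0) (hcross 0 1)
  rw [← turnVector_one, ← turnVector_one, ← turnVector_two, ← turnVector_two] at e1 e2
  rw [e0, h0] at h0'
  rw [e1, h1] at h1'
  rw [e2, h2] at h2'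
  have key : ∀ a b a' b' : ℕ, c * (a : ℝ) = c' * a' → c * (b : ℝ) = c' * b' → a * b' = a' * b := by
    intro a b a' b' ha hb
    have : c * c' * ((a : ℝ) * b') = c * c' * (a' * b) := by
      linear_combination (c' * (b' : ℝ)) * ha - c' * a' * hb
    have := mul_left_cancel₀ (mul_pos hc hc').ne' this
    exact_mod_cast this
  have k1 := key _ _ _ _ h0' h1'
  have k2 := key _ _ _ _ h0' h2'
  have hl0 : l.l0 = l'.l0 := by
    calc l.l0 = l.l0 * Nat.gcd (Nat.gcd l'.l0 l'.l1) l'.l2 := by rw [l'.coprime, mul_one]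
      _ = Nat.gcd (Nat.gcd (l.l0 * l'.l0) (l.l0 * l'.l1)) (l.l0 * l'.l2) := by
          rw [Nat.gcd_mul_left, Nat.gcd_mul_left]
      _ = l'.l0 * Nat.gcd (Nat.gcd l.l0 l.l1) l.l2 := by
          rw [k1, k2, mul_comm l.l0, Nat.gcd_mul_left, Nat.gcd_mul_left]
      _ = l'.l0 := by rw [l.coprime, mul_one]
  have hpos : 0 < l'.l0 := lt_of_le_of_lt (Nat.zero_le _) l'.lt1
  rw [hl0] at k1 k2
  have hl1 := Nat.eq_of_mul_eq_mul_left hpos k1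
  have hl2 := Nat.eq_of_mul_eq_mul_left hpos k2
  cases l
  cases l'
  simp only at hl0 hl1 hl2
  subst hl0 hl1 hl2
  rfl

/-- The strict triangle inequalities for the triangle with edges `s₀ m₀`, `s₁ m₁`, `s₂ m₂`. -/
lemma turnVector_sq_mul_sq_neg {m : Fin 3 → ℂ} (hm : ∀ i, (m i).re ^ 2 + (m i).im ^ 2 = 1)
    (h0 : turnVector m 0 ≠ 0) (h1 : turnVector m 1 ≠ 0) (h2 : turnVector m 2 ≠ 0) :
    (turnVector m 0 ^ 2 - (turnVector m 1 + turnVector m 2) ^ 2) *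
      (turnVector m 0 ^ 2 - (turnVector m 1 - turnVector m 2) ^ 2) < 0 := by
  have hcos := planeCross_sq_add_planePairing_sq (hm 1) (hm 2)
  have hrel := planeCross_mul_add (m 0) (m 1) (m 2)
  have hre := congrArg Complex.re hrel
  have him := congrArg Complex.im hrel
  simp only [Complex.add_re, Complex.add_im, Complex.mul_re, Complex.mul_im, Complex.ofReal_re,
    Complex.ofReal_im, zero_mul, sub_zero, add_zero, Complex.zero_re, Complex.zero_im] at hre him
  rw [turnVector_zero] at h0 ⊢
  rw [turnVector_one] at h1 ⊢
  rw [turnVector_two] at h2 ⊢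
  rw [planePairing_apply] at hcos
  have n0 := hm 0
  have n1 := hm 1
  have n2 := hm 2
  generalize planeCross (m 1) (m 2) = z at *
  generalize planeCross (m 2) (m 0) = x at *
  generalize planeCross (m 0) (m 1) = y at *
  -- the law of cosines
  have hlaw : z ^ 2 = x ^ 2 + y ^ 2 +
      2 * x * y * ((m 1).re * (m 2).re + (m 1).im * (m 2).im) := by
    have e1 : z * (m 0).re = -(x * (m 1).re + y * (m 2).re) := by linarith
    have e2 : z * (m 0).im = -(x * (m 1).im + y * (m 2).im) := by linarith
    have e3 : z ^ 2 = (z * (m 0).re) ^ 2 + (z * (m 0).im) ^ 2 := by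
      linear_combination (-z ^ 2) * n0
    rw [e3, e1, e2]
    linear_combination x ^ 2 * n1 + y ^ 2 * n2
  generalize (m 1).re * (m 2).re + (m 1).im * (m 2).im = D at *
  have e : ((2 * z) ^ 2 - (2 * x + 2 * y) ^ 2) * ((2 * z) ^ 2 - (2 * x - 2 * y) ^ 2) =
      -(8 * x * y * z) ^ 2 := by
    have a1 : (2 * z) ^ 2 - (2 * x + 2 * y) ^ 2 = 8 * x * y * (D - 1) := by
      linear_combination 4 * hlaw
    have a2 : (2 * z) ^ 2 - (2 * x - 2 * y) ^ 2 = 8 * x * y * (D + 1) := by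
      linear_combination 4 * hlaw
    rw [a1, a2]
    linear_combination (8 * x * y) ^ 2 * hcos
  rw [e]
  have hz : z ≠ 0 := right_ne_zero_of_mul h0
  have hx : x ≠ 0 := right_ne_zero_of_mul h1
  have hy : y ≠ 0 := right_ne_zero_of_mul h2
  have : 0 < (8 * x * y * z) ^ 2 := by positivity
  linarith

lemma turnVector_ne_zero {lam : Fin 3 → Circle} (hl : Function.Injective lam) {m : Fin 3 → ℂ}
    (hm : ∀ i, m i ^ 2 = (lam i : ℂ)) :
    turnVector m 0 ≠ 0 ∧ turnVector m 1 ≠ 0 ∧ turnVector m 2 ≠ 0 := by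
  rw [turnVector_zero, turnVector_one, turnVector_two]
  exact ⟨mul_ne_zero two_ne_zero (planeCross_ne_zero (hm 1) (hm 2) (hl.ne (by decide))),
    mul_ne_zero two_ne_zero (planeCross_ne_zero (hm 2) (hm 0) (hl.ne (by decide))),
    mul_ne_zero two_ne_zero (planeCross_ne_zero (hm 0) (hm 1) (hl.ne (by decide)))⟩

/-- Proportional positive integers can be made coprime. -/
lemma exists_turnTriple_of_proportional {x y z : ℝ} {c : ℝ} (hc : 0 < c) {a b b' : ℕ}
    (hx : x = c * a) (hy : y = c * b) (hz : z = c * b') (h1 : b < a) (h2 : a < b') :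
    ∃ (l : TurnTriple) (c : ℝ), 0 < c ∧ x = c * l.l0 ∧ y = c * l.l1 ∧ z = c * l.l2 := by
  have hg : 0 < Nat.gcd (Nat.gcd a b) b' := Nat.gcd_pos_of_pos_right _ (by omega)
  obtain ⟨a₁, ha⟩ : Nat.gcd (Nat.gcd a b) b' ∣ a :=
    (Nat.gcd_dvd_left _ _).trans (Nat.gcd_dvd_left _ _)
  obtain ⟨b₁, hb⟩ : Nat.gcd (Nat.gcd a b) b' ∣ b :=
    (Nat.gcd_dvd_left _ _).trans (Nat.gcd_dvd_right _ _)
  obtain ⟨b₁', hb'⟩ : Nat.gcd (Nat.gcd a b) b' ∣ b' := Nat.gcd_dvd_right _ _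
  set g := Nat.gcd (Nat.gcd a b) b' with hgdef
  have hcop : Nat.gcd (Nat.gcd a₁ b₁) b₁' = 1 := by
    have : g * Nat.gcd (Nat.gcd a₁ b₁) b₁' = g * 1 := by
      rw [← Nat.gcd_mul_left, ← Nat.gcd_mul_left, ← ha, ← hb, ← hb', mul_one]
    exact Nat.eq_of_mul_eq_mul_left hg this
  refine ⟨⟨a₁, b₁, b₁', hcop, ?_, ?_⟩, c * g, by positivity, ?_, ?_, ?_⟩
  · rw [ha, hb] at h1; exact Nat.lt_of_mul_lt_mul_left h1
  · rw [ha, hb'] at h2; exact Nat.lt_of_mul_lt_mul_left h2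
  · have e : (a : ℝ) = g * a₁ := by exact_mod_cast ha
    rw [hx, e, mul_assoc]
  · have e : (b : ℝ) = g * b₁ := by exact_mod_cast hb
    rw [hy, e, mul_assoc]
  · have e : (b' : ℝ) = g * b₁' := by exact_mod_cast hb'
    rw [hz, e, mul_assoc]

/-- The existence of the triple: two independent lattice periods give two linear equations with
integral coefficients for the ratios of `s₀`, `s₁ - s₂`, `s₁ + s₂`. -/
lemma SpectralFrame.exists_hasTurnTriple {T : FlatCMCTorus} {lam : Fin 3 → Circle}
    (S : SpectralFrame T lam) : ∃ l, HasTurnTriple lam l := by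
  choose m hm using fun i => exists_sq_eq_circle (lam i)
  obtain ⟨hs0, hs1, hs2⟩ := turnVector_ne_zero S.distinct hm
  have hneg := turnVector_sq_mul_sq_neg (fun i => re_sq_add_im_sq_of_sq_eq (hm i)) hs0 hs1 hs2
  set D := S.circleProduct m hm with hD
  obtain ⟨w₁, w₂, hind, hlat⟩ := T.isLattice
  have hper : ∀ γ ∈ T.lattice, ∃ i j n : ℤ, D.φ γ = i ∧ D.φ' γ = j ∧
      turnVector m 0 * n = -((turnVector m 1 - turnVector m 2) * i +
        (turnVector m 1 + turnVector m 2) * j) := by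
    intro γ hγ
    obtain ⟨⟨i, hi⟩, j, hj⟩ := (D.isPeriod_iff γ).mp (T.periodic γ hγ)
    obtain ⟨n, hn⟩ := (flatFrame_eq_one_or_neg_one_iff (hm 0) _).mp (S.double γ hγ)
    refine ⟨i, j, n, hi, hj, ?_⟩
    have hi' : planePairing (m 1 - m 2) (S.a * γ) = i := hi
    have hj' : planePairing (m 1 + m 2) (S.a * γ) = j := hj
    rw [← hn, turnVector_mul_planePairing, hi', hj']
  obtain ⟨i₁, j₁, n₁, hi₁, hj₁, h₁⟩ := hper w₁ (by
    rw [hlat]; exact AddSubgroup.subset_closure (by simp))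
  obtain ⟨i₂, j₂, n₂, hi₂, hj₂, h₂⟩ := hper w₂ (by
    rw [hlat]; exact AddSubgroup.subset_closure (by simp))
  -- the phases are coordinates of the plane, so that independent periods have independent phases
  have hdet : i₁ * j₂ - i₂ * j₁ ≠ 0 := by
    intro h0
    have h0' : (i₁ : ℝ) * j₂ - i₂ * j₁ = 0 := by exact_mod_cast h0
    rw [LinearIndependent.pair_iff] at hind
    have z1 := hind j₂ (-j₁) (D.ext_phase
      (by simp only [map_add, map_smul, smul_eq_mul, hi₁, hi₂, map_zero]; linarith)
      (by simp only [map_add, map_smul, smul_eq_mul, hj₁, hj₂, map_zero]; ring))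
    have z2 := hind i₂ (-i₁) (D.ext_phase
      (by simp only [map_add, map_smul, smul_eq_mul, hi₁, hi₂, map_zero]; ring)
      (by simp only [map_add, map_smul, smul_eq_mul, hj₁, hj₂, map_zero]; linarith))
    have hw : w₁ = 0 := D.ext_phase (by rw [hi₁, map_zero]; linarith [z2.2])
      (by rw [hj₁, map_zero]; linarith [z1.2])
    have := hind 1 0 (by rw [hw]; simp)
    exact one_ne_zero this.1
  set A := i₁ * j₂ - i₂ * j₁ with hA
  have hAR : (A : ℝ) = i₁ * j₂ - i₂ * j₁ := by rw [hA]; push_cast; rfl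
  have e1 : (turnVector m 1 - turnVector m 2) * A =
      turnVector m 0 * ((n₂ * j₁ - n₁ * j₂ : ℤ) : ℝ) := by
    rw [hAR]; push_cast; linear_combination (j₂ : ℝ) * h₁ - (j₁ : ℝ) * h₂
  have e2 : (turnVector m 1 + turnVector m 2) * A =
      turnVector m 0 * ((n₁ * i₂ - n₂ * i₁ : ℤ) : ℝ) := by
    rw [hAR]; push_cast; linear_combination (i₁ : ℝ) * h₂ - (i₂ : ℝ) * h₁
  generalize n₂ * j₁ - n₁ * j₂ = B at e1
  generalize n₁ * i₂ - n₂ * i₁ = B' at e2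
  have hA0 : (A : ℝ) ≠ 0 := by exact_mod_cast hdet
  have hcpos : 0 < |turnVector m 0| / |(A : ℝ)| :=
    div_pos (abs_pos.mpr hs0) (abs_pos.mpr hA0)
  have hcast : ∀ n : ℤ, ((n.natAbs : ℕ) : ℝ) = |(n : ℝ)| := fun n => by
    rw [Nat.cast_natAbs, Int.cast_abs]
  have f0 : |turnVector m 0| = |turnVector m 0| / |(A : ℝ)| * A.natAbs := by
    rw [hcast]; field_simp
  have f1 : |turnVector m 1 - turnVector m 2| = |turnVector m 0| / |(A : ℝ)| * B.natAbs := by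
    rw [hcast, div_mul_eq_mul_div, eq_div_iff (abs_pos.mpr hA0).ne', ← abs_mul, e1, abs_mul]
  have f2 : |turnVector m 1 + turnVector m 2| = |turnVector m 0| / |(A : ℝ)| * B'.natAbs := by
    rw [hcast, div_mul_eq_mul_div, eq_div_iff (abs_pos.mpr hA0).ne', ← abs_mul, e2, abs_mul]
  set c := |turnVector m 0| / |(A : ℝ)| with hcdef
  rw [← sq_abs, ← sq_abs (turnVector m 1 + turnVector m 2),
    ← sq_abs (turnVector m 1 - turnVector m 2), f0, f1, f2] at hneg
  have hint : ((A.natAbs : ℤ) ^ 2 - (B'.natAbs : ℤ) ^ 2) *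
      ((A.natAbs : ℤ) ^ 2 - (B.natAbs : ℤ) ^ 2) < 0 := by
    have h3 : (c ^ 2 * c ^ 2) * (((A.natAbs : ℝ) ^ 2 - (B'.natAbs : ℝ) ^ 2) *
        ((A.natAbs : ℝ) ^ 2 - (B.natAbs : ℝ) ^ 2)) < 0 := by
      refine lt_of_eq_of_lt ?_ hneg
      ring
    have h4 := neg_of_mul_neg_right h3 (by positivity)
    exact_mod_cast h4
  have hcases : (B.natAbs < A.natAbs ∧ A.natAbs < B'.natAbs) ∨
      (B'.natAbs < A.natAbs ∧ A.natAbs < B.natAbs) := by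
    rcases mul_neg_iff.mp hint with ⟨g1, g2⟩ | ⟨g1, g2⟩
    · right
      exact ⟨by exact_mod_cast lt_of_pow_lt_pow_left₀ 2 (by positivity) (sub_pos.mp g1),
        by exact_mod_cast lt_of_pow_lt_pow_left₀ 2 (by positivity) (sub_neg.mp g2)⟩
    · left
      exact ⟨by exact_mod_cast lt_of_pow_lt_pow_left₀ 2 (by positivity) (sub_pos.mp g2),
        by exact_mod_cast lt_of_pow_lt_pow_left₀ 2 (by positivity) (sub_neg.mp g1)⟩
  rcases hcases with ⟨g1, g2⟩ | ⟨g1, g2⟩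
  · obtain ⟨l, c', hc', k0, k1, k2⟩ := exists_turnTriple_of_proportional hcpos f0 f1 f2 g1 g2
    have hle : |turnVector m 1 - turnVector m 2| ≤ |turnVector m 1 + turnVector m 2| := by
      rw [f1, f2]
      exact mul_le_mul_of_nonneg_left (by exact_mod_cast (g1.trans g2).le) hcpos.le
    exact ⟨l, m, hm, c', hc', k0, by rw [min_eq_right hle, k1], by rw [max_eq_left hle, k2]⟩
  · obtain ⟨l, c', hc', k0, k1, k2⟩ := exists_turnTriple_of_proportional hcpos f0 f2 f1 g1 g2
    have hle : |turnVector m 1 + turnVector m 2| ≤ |turnVector m 1 - turnVector m 2| := by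
      rw [f1, f2]
      exact mul_le_mul_of_nonneg_left (by exact_mod_cast (g1.trans g2).le) hcpos.le
    exact ⟨l, m, hm, c', hc', k0, by rw [min_eq_left hle, k1], by rw [max_eq_right hle, k2]⟩

/-- Three distinct points with a triple of integers are spectral data: the surface
`F_{λ₁} F_{λ₂}⁻¹` closes up on the sublattice of index `ℓ₀²` of its periods. -/
lemma exists_spectralFrame {lam : Fin 3 → Circle} (hl : Function.Injective lam) {l : TurnTriple}
    (h : HasTurnTriple lam l) : ∃ T : FlatCMCTorus, Nonempty (SpectralFrame T lam) := by
  obtain ⟨m, hm, c, hc, a, b, b', ha, hb, hb', ha0, -⟩ := h.exists_int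
  have hℓ : 0 < l.l0 := lt_of_le_of_lt (Nat.zero_le _) l.lt1
  have hane : a ≠ 0 := by rintro rfl; simp at ha0; omega
  let f : ℂ → ℍ[ℝ] := fun z => flatFrame (lam 1) z * (flatFrame (lam 2) z)⁻¹
  let D : CircleProduct f := CircleProduct.ofFrame (U := 1) (V := 1) norm_one norm_one one_ne_zero
    (hm 1) (hm 2) (hl.ne (by decide)) (fun z => by simp [f])
  have n1 := re_sq_add_im_sq_of_sq_eq (hm 1)
  have n2 := re_sq_add_im_sq_of_sq_eq (hm 2)
  have hcs := planeCross_sq_add_planePairing_sq n1 n2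
  have hφ : ∀ z, D.φ z = planePairing (m 1 - m 2) z := fun z => by
    change planePairing (m 1 - m 2) (1 * z) = _
    rw [one_mul]
  have hφ' : ∀ z, D.φ' z = planePairing (m 1 + m 2) z := fun z => by
    change planePairing (m 1 + m 2) (1 * z) = _
    rw [one_mul]
  have hr : D.r ^ 2 = (1 + planePairing (m 2) (m 1)) / 2 := Real.sq_sqrt (by nlinarith)
  have hr' : D.r' ^ 2 = (1 - planePairing (m 2) (m 1)) / 2 := Real.sq_sqrt (by nlinarith)
  rw [planePairing_apply] at hr hr'
  have hcmc : IsFlatCMCImmersion f := by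
    refine D.isFlatCMCImmersion (by rw [hr, hr']; ring) ?_ ?_
    · rw [mul_pow, mul_pow, mul_pow, mul_pow, hr, hr']
      simp only [hφ, hφ', planePairing_apply, Complex.one_re, Complex.one_im, Complex.I_re,
        Complex.I_im, Complex.add_re, Complex.add_im, Complex.sub_re, Complex.sub_im]
      linear_combination (1 / 2) * (((m 1).re - (m 2).re) * ((m 1).re + (m 2).re) -
          ((m 1).im - (m 2).im) * ((m 1).im + (m 2).im)) * (n1 - n2) -
        (1 / 4) * (((m 1).re - (m 2).re) ^ 2 - ((m 1).im - (m 2).im) ^ 2 +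
          ((m 1).re + (m 2).re) ^ 2 - ((m 1).im + (m 2).im) ^ 2) * (n1 + n2)
    · rw [hr, hr']
      simp only [hφ, hφ', planePairing_apply, Complex.one_re, Complex.one_im, Complex.I_re,
        Complex.I_im, Complex.add_re, Complex.add_im, Complex.sub_re, Complex.sub_im]
      linear_combination (1 / 4) * (((m 1).re - (m 2).re) * ((m 1).im + (m 2).im) +
          ((m 1).im - (m 2).im) * ((m 1).re + (m 2).re)) * (n1 - n2) -
        (1 / 4) * (((m 1).re - (m 2).re) * ((m 1).im - (m 2).im) +
          ((m 1).re + (m 2).re) * ((m 1).im + (m 2).im)) * (n1 + n2)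
  have hℓ0 : (l.l0 : ℝ) ≠ 0 := by exact_mod_cast hℓ.ne'
  have hmem : ∀ γ, γ ∈ AddSubgroup.closure {D.point l.l0 0, D.point 0 l.l0} →
      ∃ i j : ℤ, D.φ γ = ((l.l0 * i : ℤ) : ℝ) ∧ D.φ' γ = ((l.l0 * j : ℤ) : ℝ) := by
    intro γ hγ
    obtain ⟨i, j, rfl⟩ := AddSubgroup.mem_closure_pair.mp hγ
    refine ⟨i, j, ?_, ?_⟩
    · rw [map_add, map_zsmul, map_zsmul, D.φ_point, D.φ_point]; simp [mul_comm]
    · rw [map_add, map_zsmul, map_zsmul, D.φ'_point, D.φ'_point]; simp [mul_comm]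
  let T : FlatCMCTorus :=
    { immersion := f
      isFlatCMC := hcmc
      lattice := AddSubgroup.closure {D.point l.l0 0, D.point 0 l.l0}
      isLattice := ⟨_, _, D.linearIndependent_point _ _ hℓ0 hℓ0, rfl⟩
      periodic := fun γ hγ => by
        obtain ⟨i, j, hi, hj⟩ := hmem γ hγ
        exact (D.isPeriod_iff γ).mpr ⟨⟨_, hi⟩, _, hj⟩ }
  refine ⟨T, ⟨{ distinct := hl, a := 1, a_ne_zero := one_ne_zero, U := 1, V := 1,
                norm_U := norm_one, norm_V := norm_one, sym := fun z => by simp [T, f],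
                double := fun γ hγ => ?_ }⟩⟩
  obtain ⟨i, j, hi, hj⟩ := hmem γ hγ
  rw [one_mul, flatFrame_eq_one_or_neg_one_iff (hm 0),
    exists_int_two_mul_planePairing_iff hc hane ha hb hb' ((hφ γ).symm.trans hi)
      ((hφ' γ).symm.trans hj), ← Int.natAbs_dvd, ha0]
  exact ⟨b * i + b' * j, by ring⟩

/-! ### Normal form of spectral data -/

/-- The numbers `s₀`, `s₁ - s₂`, `s₁ + s₂` are, for some choice of the square roots, positive
multiples of the integers `a`, `b`, `b'` by the same factor. -/
def HasSignedTriple (lam : Fin 3 → Circle) (a b b' : ℤ) : Prop :=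
  ∃ m : Fin 3 → ℂ, (∀ i, m i ^ 2 = (lam i : ℂ)) ∧ ∃ c : ℝ, 0 < c ∧
    turnVector m 0 = c * a ∧ turnVector m 1 - turnVector m 2 = c * b ∧
    turnVector m 1 + turnVector m 2 = c * b'

namespace HasSignedTriple

variable {lam lam' : Fin 3 → Circle} {a b b' : ℤ}

/-- The effect of the other choice of the square root of the double point. -/
lemma neg_zero (h : HasSignedTriple lam a b b') : HasSignedTriple lam a (-b) (-b') := by
  obtain ⟨m, hm, c, hc, h0, h1, h2⟩ := h
  refine ⟨![-m 0, m 1, m 2], fun i => ?_, c, hc, ?_⟩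
  · fin_cases i
    · simpa using hm 0
    · simpa using hm 1
    · simpa using hm 2
  · simp only [turnVector_zero, turnVector_one, turnVector_two] at h0 h1 h2 ⊢
    change 2 * planeCross (m 1) (m 2) = _ ∧
      2 * planeCross (m 2) (-m 0) - 2 * planeCross (-m 0) (m 1) = _ ∧
      2 * planeCross (m 2) (-m 0) + 2 * planeCross (-m 0) (m 1) = _
    rw [planeCross_neg_left, planeCross_neg_right]
    push_cast
    exact ⟨h0, by linarith, by linarith⟩

/-- The effect of the other choice of the square root of the first Sym point. -/
lemma neg_one (h : HasSignedTriple lam a b b') : HasSignedTriple lam (-a) b' b := by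
  obtain ⟨m, hm, c, hc, h0, h1, h2⟩ := h
  refine ⟨![m 0, -m 1, m 2], fun i => ?_, c, hc, ?_⟩
  · fin_cases i
    · simpa using hm 0
    · simpa using hm 1
    · simpa using hm 2
  · simp only [turnVector_zero, turnVector_one, turnVector_two] at h0 h1 h2 ⊢
    change 2 * planeCross (-m 1) (m 2) = _ ∧
      2 * planeCross (m 2) (m 0) - 2 * planeCross (m 0) (-m 1) = _ ∧
      2 * planeCross (m 2) (m 0) + 2 * planeCross (m 0) (-m 1) = _
    rw [planeCross_neg_left, planeCross_neg_right]
    push_cast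
    exact ⟨by linarith, by linarith, by linarith⟩

lemma inv (h : HasSignedTriple lam a b b') :
    HasSignedTriple (fun i => (lam i)⁻¹) (-a) (-b) (-b') := by
  obtain ⟨m, hm, c, hc, h0, h1, h2⟩ := h
  refine ⟨fun i => (starRingEnd ℂ) (m i), fun i => coe_inv_eq_conj_sq (hm i), c, hc, ?_⟩
  simp only [turnVector_zero, turnVector_one, turnVector_two] at h0 h1 h2 ⊢
  simp only [planeCross_conj]
  push_cast
  exact ⟨by linarith, by linarith, by linarith⟩

lemma swap (h : HasSignedTriple lam a b b') :
    HasSignedTriple ![lam 0, lam 2, lam 1] (-a) b (-b') := by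
  obtain ⟨m, hm, c, hc, h0, h1, h2⟩ := h
  refine ⟨![m 0, m 2, m 1], fun i => ?_, c, hc, ?_⟩
  · fin_cases i
    · simpa using hm 0
    · simpa using hm 2
    · simpa using hm 1
  · simp only [turnVector_zero, turnVector_one, turnVector_two] at h0 h1 h2 ⊢
    change 2 * planeCross (m 2) (m 1) = _ ∧
      2 * planeCross (m 1) (m 0) - 2 * planeCross (m 0) (m 2) = _ ∧
      2 * planeCross (m 1) (m 0) + 2 * planeCross (m 0) (m 2) = _
    rw [planeCross_comm (m 1) (m 2), planeCross_comm (m 0) (m 1), planeCross_comm (m 2) (m 0)]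
    push_cast
    exact ⟨by linarith, by linarith, by linarith⟩

end HasSignedTriple

/-- Inversion, swapping and the choice of the square roots make all signs positive. -/
lemma HasTurnTriple.exists_signedTriple {lam : Fin 3 → Circle} {l : TurnTriple}
    (h : HasTurnTriple lam l) : ∃ lam', Relation.ReflTransGen SpectralStep lam lam' ∧
      HasSignedTriple lam' l.l0 l.l1 l.l2 := by
  have hinv : ∀ lam : Fin 3 → Circle, SpectralStep lam fun i => (lam i)⁻¹ :=
    fun lam => Or.inr (Or.inl fun i => rfl)
  have hswap : ∀ lam : Fin 3 → Circle, SpectralStep lam ![lam 0, lam 2, lam 1] :=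
    fun lam => Or.inr (Or.inr ⟨rfl, rfl, rfl⟩)
  obtain ⟨a, b, ha, hb, h1⟩ : ∃ a b : ℤ, a.natAbs = l.l0 ∧ b.natAbs = l.l1 ∧
      HasSignedTriple lam a b l.l2 := by
    obtain ⟨a, b, b', ha, hb, hb', h1⟩ : ∃ a b b' : ℤ, a.natAbs = l.l0 ∧ b.natAbs = l.l1 ∧
        b'.natAbs = l.l2 ∧ HasSignedTriple lam a b b' := by
      obtain ⟨m, hm, c, hc, a, b, b', h0, h1, h2, ha, ⟨hb, hb'⟩ | ⟨hb, hb'⟩⟩ := h.exists_int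
      · exact ⟨a, b, b', ha, hb, hb', m, hm, c, hc, h0, h1, h2⟩
      · exact ⟨-a, b', b, by rwa [Int.natAbs_neg], hb', hb,
          HasSignedTriple.neg_one ⟨m, hm, c, hc, h0, h1, h2⟩⟩
    rcases Int.natAbs_eq b' with e | e
    · exact ⟨a, b, ha, hb, by rw [← hb', ← e]; exact h1⟩
    · refine ⟨a, -b, ha, by rwa [Int.natAbs_neg], ?_⟩
      have := h1.neg_zero
      rwa [e, neg_neg, hb'] at this
  rcases Int.natAbs_eq a with ea | ea <;> rcases Int.natAbs_eq b with eb | eb <;>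
    rw [ea, eb, ha, hb] at h1
  · exact ⟨lam, .refl, h1⟩
  · refine ⟨_, (Relation.ReflTransGen.single (hswap _)).tail (hinv _), ?_⟩
    simpa only [neg_neg] using h1.swap.inv
  · refine ⟨_, Relation.ReflTransGen.single (hinv _), ?_⟩
    simpa only [neg_neg] using h1.inv.neg_zero
  · refine ⟨_, Relation.ReflTransGen.single (hswap _), ?_⟩
    simpa only [neg_neg] using h1.swap.neg_zero

/-- Square roots with `m₀ = 1` that are the directions of the edges of a triangle with side lengths
`2 ℓ₀`, `ℓ₁ + ℓ₂`, `ℓ₂ - ℓ₁`, oriented by the sign of `Im m₁`. -/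
def IsNormalRoots (l : TurnTriple) (lam : Fin 3 → Circle) (m : Fin 3 → ℂ) : Prop :=
  (∀ i, m i ^ 2 = (lam i : ℂ)) ∧ m 0 = 1 ∧
    2 * (l.l0 : ℂ) + (l.l1 + l.l2) * m 1 + (l.l2 - l.l1) * m 2 = 0 ∧ 0 < (m 1).im

/-- Rotating the double point to `1` makes `m₀` equal to `1`; the relation between the square roots
becomes the closing condition of the triangle. -/
lemma HasSignedTriple.exists_isNormalRoots {lam : Fin 3 → Circle} {l : TurnTriple}
    (h : HasSignedTriple lam l.l0 l.l1 l.l2) :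
    ∃ m, IsNormalRoots l (fun i => (lam 0)⁻¹ * lam i) m := by
  obtain ⟨m, hm, c, hc, h0, h1, h2⟩ := h
  have n0 := re_sq_add_im_sq_of_sq_eq (hm 0)
  have n0' : ((starRingEnd ℂ) (m 0)).re ^ 2 + ((starRingEnd ℂ) (m 0)).im ^ 2 = 1 := by
    rw [Complex.conj_re, Complex.conj_im, neg_sq, n0]
  set m' : Fin 3 → ℂ := fun i => (starRingEnd ℂ) (m 0) * m i with hm'
  have hm0 : m' 0 = 1 := by
    rw [hm']
    apply Complex.ext
    · simp; linarith
    · simp; ring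
  have hcross : ∀ i j, planeCross (m' i) (m' j) = planeCross (m i) (m j) := fun i j =>
    planeCross_mul n0' _ _
  rw [turnVector_zero] at h0
  rw [turnVector_one, turnVector_two] at h1 h2
  simp only [← hcross] at h0 h1 h2
  push_cast at h0 h1 h2
  refine ⟨m', fun i => ?_, hm0, ?_, ?_⟩
  · rw [hm', mul_pow, coe_inv_eq_conj_sq (hm 0), hm, Circle.coe_mul]
  · have hrel := planeCross_mul_add (m' 0) (m' 1) (m' 2)
    have e0 : planeCross (m' 1) (m' 2) = c / 4 * (2 * l.l0) := by linarith
    have e1 : planeCross (m' 2) (m' 0) = c / 4 * (l.l1 + l.l2) := by linarith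
    have e2 : planeCross (m' 0) (m' 1) = c / 4 * (l.l2 - l.l1) := by linarith
    rw [e0, e1, e2, hm0] at hrel
    have hc' : (c : ℂ) / 4 ≠ 0 := div_ne_zero (by exact_mod_cast hc.ne') (by norm_num)
    apply mul_left_cancel₀ hc'
    push_cast at hrel
    rw [mul_zero, ← hrel]
    ring
  · have e2 : planeCross (m' 0) (m' 1) = c / 4 * (l.l2 - l.l1) := by linarith
    have hlt : (l.l1 : ℝ) < l.l2 := by exact_mod_cast l.lt1.trans l.lt2
    have : planeCross (m' 0) (m' 1) = (m' 1).im := by rw [hm0, planeCross]; simp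
    rw [← this, e2]
    exact mul_pos (by positivity) (sub_pos.mpr hlt)

/-- A triangle is determined by its side lengths, orientation and the direction of one edge. -/
lemma IsNormalRoots.unique {l : TurnTriple} {lam lam' : Fin 3 → Circle} {m m' : Fin 3 → ℂ}
    (h : IsNormalRoots l lam m) (h' : IsNormalRoots l lam' m') : lam = lam' := by
  have hl0 : (0 : ℝ) < l.l0 := by exact_mod_cast lt_of_le_of_lt (Nat.zero_le _) l.lt1
  have hl1 : (0 : ℝ) ≤ l.l1 := by positivity
  have hlt : (l.l1 : ℝ) < l.l2 := by exact_mod_cast l.lt1.trans l.lt2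
  have key : ∀ {lam : Fin 3 → Circle} {m : Fin 3 → ℂ}, IsNormalRoots l lam m →
      (2 * l.l0 : ℝ) ^ 2 + (l.l1 + l.l2) ^ 2 + 2 * (2 * l.l0) * (l.l1 + l.l2) * (m 1).re =
        (l.l2 - l.l1) ^ 2 := by
    rintro lam m ⟨hm, -, hrel, -⟩
    have n1 := re_sq_add_im_sq_of_sq_eq (hm 1)
    have n2 := re_sq_add_im_sq_of_sq_eq (hm 2)
    have hre := congrArg Complex.re hrel
    have him := congrArg Complex.im hrel
    simp at hre him
    have e1 : ((l.l2 : ℝ) - l.l1) * (m 2).re = -(2 * l.l0 + (l.l1 + l.l2) * (m 1).re) := by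
      linarith
    have e2 : ((l.l2 : ℝ) - l.l1) * (m 2).im = -((l.l1 + l.l2) * (m 1).im) := by linarith
    have e3 : ((l.l2 : ℝ) - l.l1) ^ 2 = (((l.l2 : ℝ) - l.l1) * (m 2).re) ^ 2 +
        (((l.l2 : ℝ) - l.l1) * (m 2).im) ^ 2 := by
      linear_combination (-((l.l2 : ℝ) - l.l1) ^ 2) * n2
    rw [e3, e1, e2]
    linear_combination (-((l.l1 : ℝ) + l.l2) ^ 2) * n1
  have k := key h
  have k' := key h'
  obtain ⟨hm, h0, hrel, hpos⟩ := h
  obtain ⟨hm', h0', hrel', hpos'⟩ := h'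
  have n1 := re_sq_add_im_sq_of_sq_eq (hm 1)
  have n1' := re_sq_add_im_sq_of_sq_eq (hm' 1)
  have hne : 2 * (2 * (l.l0 : ℝ)) * (l.l1 + l.l2) ≠ 0 := by
    have : (0 : ℝ) < l.l1 + l.l2 := by linarith
    positivity
  have hre : (m 1).re = (m' 1).re := mul_left_cancel₀ hne (by linarith)
  have him : (m 1).im = (m' 1).im := by
    rw [hre] at n1
    exact (pow_left_inj₀ hpos.le hpos'.le two_ne_zero).mp (by linarith)
  have e1 : m 1 = m' 1 := Complex.ext hre him
  have hne2 : (l.l2 : ℂ) - l.l1 ≠ 0 := by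
    have : ((l.l2 : ℝ) - l.l1 : ℝ) ≠ 0 := (sub_pos.mpr hlt).ne'
    exact_mod_cast this
  have e2 : m 2 = m' 2 := by
    rw [e1] at hrel
    exact mul_left_cancel₀ hne2 (add_left_cancel (hrel.trans hrel'.symm))
  have hall : ∀ i, m i = m' i := by
    intro i
    fin_cases i
    · exact h0.trans h0'.symm
    · exact e1
    · exact e2
  funext i
  apply Subtype.ext
  rw [← hm, ← hm', hall]

/-- The triangle with side lengths `2 ℓ₀`, `ℓ₁ + ℓ₂`, `ℓ₂ - ℓ₁` exists, the strict triangle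
inequalities being `ℓ₁ < ℓ₀ < ℓ₂`. -/
lemma exists_hasTurnTriple_lam (l : TurnTriple) :
    ∃ lam : Fin 3 → Circle, Function.Injective lam ∧ HasTurnTriple lam l := by
  have hl1 : (0 : ℝ) ≤ l.l1 := by positivity
  have hl01 : (l.l1 : ℝ) < l.l0 := by exact_mod_cast l.lt1
  have hl02 : (l.l0 : ℝ) < l.l2 := by exact_mod_cast l.lt2
  set p : ℝ := 2 * l.l0 with hp
  set q : ℝ := l.l1 + l.l2 with hq
  set r : ℝ := l.l2 - l.l1 with hr
  have hp0 : 0 < p := by linarith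
  have hq0 : 0 < q := by linarith
  have hr0 : 0 < r := by linarith
  -- the direction of the second edge, by the law of cosines
  set x : ℝ := (r ^ 2 - p ^ 2 - q ^ 2) / (2 * p * q) with hx
  have hxe : 2 * p * q * x = r ^ 2 - p ^ 2 - q ^ 2 := by rw [hx]; field_simp
  have hx1 : x ^ 2 < 1 := by
    have h1 : x < 1 := by
      have : r ^ 2 < (p + q) ^ 2 := by nlinarith
      rw [hx, div_lt_one (by positivity)]; nlinarith
    have h2 : -1 < x := by
      have h3 : 0 < (r + (p - q)) * (r - (p - q)) := mul_pos (by linarith) (by linarith)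
      rw [hx, lt_div_iff₀ (by positivity)]; nlinarith
    nlinarith
  set y : ℝ := Real.sqrt (1 - x ^ 2) with hy
  have hy0 : 0 < y := Real.sqrt_pos.mpr (by linarith)
  have hxy : x ^ 2 + y ^ 2 = 1 := by
    rw [hy, Real.sq_sqrt (by linarith)]; ring
  -- the third edge closes the triangle
  set x' : ℝ := -(p + q * x) / r with hx'
  set y' : ℝ := -(q * y) / r with hy'
  have hxy' : x' ^ 2 + y' ^ 2 = 1 := by
    rw [hx', hy', div_pow, div_pow, ← add_div, div_eq_one_iff_eq (by positivity)]
    linear_combination q ^ 2 * hxy + hxe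
  have hcircle : ∀ x y : ℝ, x ^ 2 + y ^ 2 = 1 → ∃ δ : Circle, (⟨x, y⟩ : ℂ) = δ := by
    intro x y h
    refine ⟨⟨⟨x, y⟩, mem_sphere_zero_iff_norm.mpr ?_⟩, rfl⟩
    rw [← sq_eq_sq₀ (norm_nonneg _) zero_le_one, ← Complex.normSq_eq_norm_sq,
      Complex.normSq_apply]
    linarith
  obtain ⟨δ, hδ⟩ := hcircle x y hxy
  obtain ⟨δ', hδ'⟩ := hcircle x' y' hxy'
  let m : Fin 3 → ℂ := ![1, ⟨x, y⟩, ⟨x', y'⟩]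
  let lam : Fin 3 → Circle := ![1, δ ^ 2, δ' ^ 2]
  have hm : ∀ i, m i ^ 2 = (lam i : ℂ) := by
    intro i
    fin_cases i
    · simp [m, lam]
    · simp [m, lam, hδ]
    · simp [m, lam, hδ']
  have c0 : planeCross (m 1) (m 2) = y / r * p := by
    change x * y' - y * x' = _
    rw [hx', hy']; field_simp; ring
  have c1 : planeCross (m 2) (m 0) = y / r * q := by
    change x' * 0 - y' * 1 = _
    rw [hy']; field_simp; ring
  have c2 : planeCross (m 0) (m 1) = y / r * r := by
    change 1 * y - 0 * x = _
    field_simp; ring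
  have hyr : 0 < y / r := div_pos hy0 hr0
  refine ⟨lam, ?_, m, hm, 4 * (y / r), by positivity, ?_⟩
  · have hne : ∀ i j, planeCross (m i) (m j) ≠ 0 → lam i ≠ lam j := by
      intro i j h he
      have hsq : m i ^ 2 = m j ^ 2 := by rw [hm, hm, he]
      apply h
      rcases sq_eq_sq_iff_eq_or_eq_neg.mp hsq with h1 | h1
      · rw [h1, planeCross]; ring
      · rw [h1, planeCross_neg_left, planeCross]; ring
    have h12 := hne 1 2 (by rw [c0]; positivity)
    have h20 := hne 2 0 (by rw [c1]; positivity)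
    have h01 := hne 0 1 (by rw [c2]; positivity)
    intro i j hij
    fin_cases i <;> fin_cases j <;> first | rfl | exact absurd hij ‹_› | exact absurd hij.symm ‹_›
  · rw [turnVector_zero, turnVector_one, turnVector_two, c0, c1, c2]
    have e1 : 2 * (y / r * q) + 2 * (y / r * r) = 4 * (y / r) * l.l2 := by
      rw [show q = l.l1 + l.l2 from hq]
      have : 2 * (y / r * r) = 2 * (y / r * (l.l2 - l.l1)) := by rw [← hr]
      rw [this]; ring
    have e2 : 2 * (y / r * q) - 2 * (y / r * r) = 4 * (y / r) * l.l1 := by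
      rw [show q = l.l1 + l.l2 from hq]
      have : 2 * (y / r * r) = 2 * (y / r * (l.l2 - l.l1)) := by rw [← hr]
      rw [this]; ring
    have e0 : 2 * (y / r * p) = 4 * (y / r) * l.l0 := by rw [hp]; ring
    rw [e0, e1, e2, abs_of_nonneg (by positivity), abs_of_nonneg (by positivity),
      abs_of_nonneg (by positivity)]
    have hle : 4 * (y / r) * (l.l1 : ℝ) ≤ 4 * (y / r) * l.l2 :=
      mul_le_mul_of_nonneg_left (by linarith) (by positivity)
    exact ⟨rfl, min_eq_right hle, max_eq_left hle⟩

/-! ### The classification of spectral data -/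

lemma SpectralData.injective (d : SpectralData) : Function.Injective d.1 := by
  obtain ⟨T, ⟨S⟩⟩ := d.2
  exact S.distinct

lemma SpectralData.exists_hasTurnTriple (d : SpectralData) : ∃ l, HasTurnTriple d.1 l := by
  obtain ⟨T, ⟨S⟩⟩ := d.2
  exact S.exists_hasTurnTriple

/-- Chains of elementary transformations starting at spectral data stay within spectral data. -/
lemma SpectralData.exists_of_reflTransGen (d : SpectralData) {l : TurnTriple}
    (hd : HasTurnTriple d.1 l) {lam : Fin 3 → Circle}
    (h : Relation.ReflTransGen SpectralStep d.1 lam) :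
    ∃ d' : SpectralData, d'.1 = lam ∧ HasTurnTriple lam l ∧
      Quot.mk SpectralData.Step d = Quot.mk SpectralData.Step d' := by
  induction h with
  | refl => exact ⟨d, rfl, hd, rfl⟩
  | tail _ hstep ih =>
    obtain ⟨d', rfl, hd', he⟩ := ih
    have hl := hstep.hasTurnTriple hd'
    exact ⟨⟨_, exists_spectralFrame (hstep.injective d'.injective) hl⟩, rfl, hl,
      he.trans (Quot.sound hstep)⟩

/-- Every spectral datum is equivalent to one in normal form. -/
lemma SpectralData.exists_normal (d : SpectralData) {l : TurnTriple} (hd : HasTurnTriple d.1 l) :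
    ∃ (d' : SpectralData) (m : Fin 3 → ℂ), IsNormalRoots l d'.1 m ∧
      Quot.mk SpectralData.Step d = Quot.mk SpectralData.Step d' := by
  obtain ⟨lam, hchain, hs⟩ := hd.exists_signedTriple
  obtain ⟨m, hm⟩ := hs.exists_isNormalRoots
  obtain ⟨d', hd', -, he⟩ := d.exists_of_reflTransGen hd
    (hchain.tail (c := fun i => (lam 0)⁻¹ * lam i) (Or.inl ⟨_, fun i => rfl⟩))
  exact ⟨d', m, by rw [hd']; exact hm, he⟩

/-- The triple classifies spectral data: it is injective on classes, because equal triples have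
equal normal forms, and surjective, because every triple of integers comes from a triangle. -/
theorem exists_spectralClass_equiv : ∃ e : SpectralClass ≃ TurnTriple,
    ∀ d : SpectralData, HasTurnTriple d.1 (e (Quot.mk SpectralData.Step d)) := by
  choose t ht using SpectralData.exists_hasTurnTriple
  have hwd : ∀ d d' : SpectralData, d.Step d' → t d = t d' := fun d d' h =>
    (SpectralStep.hasTurnTriple h (ht d)).unique (ht d')
  refine ⟨Equiv.ofBijective (Quot.lift t hwd) ⟨?_, ?_⟩, ht⟩
  · rintro ⟨d⟩ ⟨d'⟩ h
    have h' : t d = t d' := h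
    obtain ⟨e, m, hm, he⟩ := d.exists_normal (ht d)
    obtain ⟨e', m', hm', he'⟩ := d'.exists_normal (h' ▸ ht d')
    exact he.trans ((congrArg _ (Subtype.ext (hm.unique hm'))).trans he'.symm)
  · intro l
    obtain ⟨lam, hinj, hl⟩ := exists_hasTurnTriple_lam l
    exact ⟨Quot.mk _ ⟨lam, exists_spectralFrame hinj hl⟩, (ht _).unique hl⟩

end

theorem mainTheorem8 :
    (∃ e : SpectralClass ≃ TurnTriple,
      ∀ d : SpectralData, HasTurnTriple d.1 (e (Quot.mk SpectralData.Step d))) ∧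
    (∀ (T : FlatCMCTorus) (lam : Fin 3 → Circle) (S : SpectralFrame T lam) (l : TurnTriple),
      HasTurnTriple lam l → S.IsPrimitive →
        (∃ T' : FlatCMCTorus, T'.IsEmbedded ∧ T'.IsRectangular ∧ T.Covers T' l.l0) ∧
        (∃ A : Fin 2 → Set ℍ[ℝ], Function.Injective A ∧ (∀ B, S.IsAxis B ↔ ∃ k, B = A k) ∧
          ∀ (k : Fin 2) (u v n : ℍ[ℝ]), Orthonormal ℝ ![u, v, n] → greatCircle u v = A k →
            T.ProfileTotalTurning u v n l.l0 ∧
            T.ProfileWrapsCircle u v n (Nat.gcd l.l0 (![l.l1, l.l2] k))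
              (l.l0 / Nat.gcd l.l0 (![l.l1, l.l2] k)))) ∧
    (∀ (T : FlatCMCTorus) (lam : Fin 3 → Circle) (S : SpectralFrame T lam) (l : TurnTriple),
      HasTurnTriple lam l → (l.l1 = 0 ↔ S.IsRotational)) :=
  ⟨exists_spectralClass_equiv, fun _ _ S _ hl hS => S.primitive_geometry hl hS,
    fun _ _ S _ hl => S.l1_eq_zero_iff_isRotational hl⟩
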